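/- Let $N, M \ge 1$ be integers, and let $A = (A_{i,j})_{1\le i,j\le N}$, with blocks $A_{i,j} \in \mathbf{R}^{M\times M}$, be a random block matrix sampled from the probability density $a \mapsto Z^{-1} e^{-\frac{M}{4}\operatorname{tr} a^* a}$ (with respect to Lebesgue measure) on the space of block matrices $a \in (\mathbf{R}^{M\times M})^{N\times N}$ that satisfy $a^* = a$ and $a_{i,j} = 0$ for $|i-j|>1$. For $\lambda \in \mathbf{R}$ define $$D_1 = A_{1,1} - \lambda,\qquad B_k = -A_{k,k+1},\qquad D_{k+1} = A_{k+1,k+1} - \lambda - B_k^* D_k^{-1} B_k \qquad (1 \le k < N),$$ where $\lambda$ also denotes $\lambda$ times the identity matrix. Let $\|X\|_F = (\operatorname{tr} X^*X)^{1/2}$ denote the Frobenius norm. **Lemma 2.2.** For every $\varepsilon > 0$ there are constants $C_\varepsilon > 1 > c_\varepsilon > 0$, depending only on $\varepsilon$, such that for all $|\lambda| < \varepsilon^{-1}$, all $M \ge C_\varepsilon$, all $N$ and all $1 \le k < N$: almost surely $D_1,\dots,D_N$ are all invertible, and, with probability at least $1 - M^{-c_\varepsilon}$, the following bounds hold simultaneously: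 \begin{align*} & M^{1/2-\varepsilon} \leq \| A_{k+1,k+1} \|_F \leq M^{1/2+\varepsilon}, \\ & M^{1/2-\varepsilon} \leq \| B_k^* D_k^{-1} B_k \|_F \leq M^{1+\varepsilon}, \\ & |\operatorname{tr} A_{k+1,k+1} (\lambda + B_k^* D_k^{-1} B_k)| \leq M^{1/2+\varepsilon}, \\ & |\operatorname{tr} A_{k+1,k+1} B_k^* D_k^{-1} B_k| \leq M^{1/2+\varepsilon}. \end{align*} -/

import Mathlib

open MeasureTheory ProbabilityTheory
open scoped Matrix

namespace BlockBand

/-- `N × N` block matrices whose entries are real `M × M` matrices. -/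
abbrev BlockMatrix (N M : ℕ) : Type :=
  Matrix (Fin N) (Fin N) (Matrix (Fin M) (Fin M) ℝ)

/-- The space of symmetric block tridiagonal matrices: `a^* = a` and `a_{i,j} = 0` for
`|i - j| > 1`. The outer `ᴴ` also (conjugate) transposes the blocks: `(aᴴ) i j = (a j i)ᴴ`. -/
def tridiagonal (N M : ℕ) : Submodule ℝ (BlockMatrix N M) where
  carrier := {a | aᴴ = a ∧ ∀ i j : Fin N, 1 < |(i : ℤ) - (j : ℤ)| → a i j = 0}
  zero_mem' := by simp
  add_mem' := by
    rintro a b ⟨ha, ha'⟩ ⟨hb, hb'⟩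
    refine ⟨by rw [Matrix.conjTranspose_add, ha, hb], fun i j h => ?_⟩
    rw [Matrix.add_apply, ha' i j h, hb' i j h, add_zero]
  smul_mem' := by
    rintro r a ⟨ha, ha'⟩
    refine ⟨by rw [Matrix.conjTranspose_smul, ha, star_trivial], fun i j h => ?_⟩
    rw [Matrix.smul_apply, ha' i j h, smul_zero]

/-- Matrices carry the product σ-algebra. -/
instance (m n α : Type*) [MeasurableSpace α] : MeasurableSpace (Matrix m n α) :=
  inferInstanceAs (MeasurableSpace (m → n → α))

instance (m n α : Type*) [Countable m] [Countable n] [TopologicalSpace α]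
    [SecondCountableTopology α] [MeasurableSpace α] [BorelSpace α] :
    BorelSpace (Matrix m n α) :=
  inferInstanceAs (BorelSpace (m → n → α))

instance (N M : ℕ) : BorelSpace (BlockMatrix N M) :=
  have : SecondCountableTopology (Matrix (Fin M) (Fin M) ℝ) :=
    inferInstanceAs (SecondCountableTopology (Fin M → Fin M → ℝ))
  inferInstance

instance (N M : ℕ) : LocallyCompactSpace (tridiagonal N M) :=
  have : LocallyCompactSpace (BlockMatrix N M) :=
    inferInstanceAs (LocallyCompactSpace (Fin N → Fin N → Fin M → Fin M → ℝ))
  have : T2Space (BlockMatrix N M) :=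
    inferInstanceAs (T2Space (Fin N → Fin N → Fin M → Fin M → ℝ))
  (tridiagonal N M).closed_of_finiteDimensional.isClosedEmbedding_subtypeVal.locallyCompactSpace

/-- `tr a^* a`, the sum of the squares of all `(N M)²` scalar entries: the outer block trace is an
`M × M` matrix, of which the trace is taken. -/
def energy {N M : ℕ} (a : BlockMatrix N M) : ℝ :=
  (aᴴ * a).trace.trace

/-- The probability law on symmetric block tridiagonal matrices with density
`Z⁻¹ exp (-(M / 4) tr a^* a)` with respect to Lebesgue measure on that space. (`Measure.tilted`
includes the normalization `Z`, so that the scaling of Lebesgue measure is immaterial.) -/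
noncomputable def law (N M : ℕ) : Measure (tridiagonal N M) :=
  (Measure.addHaar : Measure (tridiagonal N M)).tilted
    fun a => -((M : ℝ) / 4) * energy (a : BlockMatrix N M)

/-- The Frobenius norm `(tr X^* X)^{1/2}`. -/
noncomputable def frob {M : ℕ} (X : Matrix (Fin M) (Fin M) ℝ) : ℝ :=
  Real.sqrt (Xᴴ * X).trace

variable {N M : ℕ}

/-- `B_k = -A_{k,k+1}`. Block indices start at `0`. -/
def B (a : BlockMatrix N M) (k : ℕ) (hk : k + 1 < N) : Matrix (Fin M) (Fin M) ℝ :=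
  -a ⟨k, Nat.lt_of_succ_lt hk⟩ ⟨k + 1, hk⟩

/-- The chain `D_0 = A_{0,0} - lam`, `D_{k+1} = A_{k+1,k+1} - lam - B_k^* D_k⁻¹ B_k`.
Block indices start at `0`. -/
noncomputable def D (lam : ℝ) (a : BlockMatrix N M) :
    (k : ℕ) → k < N → Matrix (Fin M) (Fin M) ℝ
  | 0, hk => a ⟨0, hk⟩ ⟨0, hk⟩ - lam • 1
  | k + 1, hk => a ⟨k + 1, hk⟩ ⟨k + 1, hk⟩ - lam • 1 -
      (B a k hk)ᴴ * (D lam a k (Nat.lt_of_succ_lt hk))⁻¹ * B a k hk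

/-- `B_k^* D_k⁻¹ B_k`. -/
noncomputable def Q (lam : ℝ) (a : BlockMatrix N M) (k : ℕ) (hk : k + 1 < N) :
    Matrix (Fin M) (Fin M) ℝ :=
  (B a k hk)ᴴ * (D lam a k (Nat.lt_of_succ_lt hk))⁻¹ * B a k hk

end BlockBand

/-! All bounds are proved up to powers of a scale `y = M ^ δ`, with `δ` so small that `y ^ 8 ≤ M ^
ε`. They may fail with probability `O(1 / y)` plus `M ^ 2` times a multiple of `exp (-y / 2)`. Two
independences drive the argument. `D_k` is `A_{k,k}` plus a matrix not involving `A_{k,k}`, so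
conditionally it is a symmetric Gaussian matrix with an arbitrary fixed shift. The columns of `B_k`
are independent of each other and of `D_k`. The shift is uncontrolled, so the estimates for one
Gaussian matrix must be uniform in it. In return the constants do not depend on `k` or `N`, and no
induction along the chain is needed.

There are two such estimates. The first is of Wegner type: `‖D⁻¹‖_F > M y` has probability `O(1 /
y)` (`lintegral_inv_frobSq_le`). For one vector `u` it comes from coordinates in which `|D⁻¹ u|` is
governed by a single real variable `q` whose conditional density is an affine function times a
Gaussian. Averaging over random sign vectors `u` turns this into the Frobenius norm with only a
constant lost. The second says that at most half of the eigenvalues are smaller than `y ^ (-2)` in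
modulus (`lintegral_trace_regInv_le`). It comes from bounding a diagonal entry of `(D² + η²)⁻¹` by a
quadratic form in one row, whose coefficients come from the complementary minor and are independent
of that row.

The second estimate bounds `‖A_{k+1,k+1}‖_F` from below. Applied to the predecessor of `D_k`, it
writes `D_k` as a matrix of controlled Frobenius norm plus one of rank at most `3 M / 4`, which
bounds `‖D_k⁻¹‖_F` from below (`frobSq_schur_inv_ge`). The passage from `X = D_k⁻¹` to `Bᵀ X B` is
made one column of `B` at a time: exponential tails of linear forms give the upper bound
(`frobSq_conj_le`), and small ball estimates for quadratic forms give the lower bound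
(`frobSq_conj_ge`). Finally `A_{k+1,k+1}` is independent of `Bᵀ X B`, so the trace of their product
is a Gaussian linear form of size `‖Bᵀ X B‖_F / √M`, which is smaller than Cauchy–Schwarz would
give. -/

namespace BlockBand

/-! ### Conditioning and exponential tilting -/

/-- Comparison of two integrals over a group from the comparison along the cosets of a direct
summand `L E`. -/
theorem lintegral_le_of_fiber {V E : Type*} [MeasurableSpace V] [MeasurableSpace E]
    [AddCommGroup V] [AddCommGroup E] [MeasurableAdd₂ V] [MeasurableNeg V] [MeasurableSub₂ V]
    [MeasurableAdd₂ E] [MeasurableNeg E] [MeasurableSub₂ E]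
    (μ : Measure V) [SFinite μ] [μ.IsAddLeftInvariant]
    (ν : Measure E) [SFinite ν] [ν.IsAddLeftInvariant] [ν.IsNegInvariant]
    (L : E →+ V) (π : V →+ E) (hL : Measurable L) (hπ : Measurable π) (hπL : ∀ x, π (L x) = x)
    (K : Set E) (hK : MeasurableSet K) (hK1 : ν K = 1)
    {f g : V → ENNReal} (hf : Measurable f) (hg : Measurable g)
    (h : ∀ a, π a = 0 → ∫⁻ x, f (a + L x) ∂ν ≤ ∫⁻ x, g (a + L x) ∂ν) :
    ∫⁻ a, f a ∂μ ≤ ∫⁻ a, g a ∂μ := by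
  have key : ∀ f : V → ENNReal, Measurable f → ∫⁻ a, f a ∂μ
      = ∫⁻ a, K.indicator 1 (π a) * ∫⁻ x, f (a - L x) ∂ν ∂μ := by
    intro f hf
    have hχ : Measurable (K.indicator (1 : E → ENNReal)) := measurable_one.indicator hK
    -- The inserted factor integrates to `ν K = 1`. It replaces a product decomposition of `μ`:
    -- after exchanging the integrals and translating by `L x`, the cut-off depends on `π a` alone
    -- and the integral of `f` over a full coset appears.
    calc ∫⁻ a, f a ∂μ = ∫⁻ a, ∫⁻ x, K.indicator 1 (π a + x) * f a ∂ν ∂μ := by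
          refine lintegral_congr fun a => ?_
          rw [lintegral_mul_const _ (f := fun x => K.indicator 1 (π a + x)) (hχ.comp (measurable_const_add _)),
            lintegral_add_left_eq_self (fun x => K.indicator (1 : E → ENNReal) x)]
          simp [lintegral_indicator hK, hK1]
      _ = ∫⁻ x, ∫⁻ a, K.indicator 1 (π a + x) * f a ∂μ ∂ν := by
          refine lintegral_lintegral_swap (Measurable.aemeasurable ?_)
          exact (hχ.comp ((hπ.comp measurable_fst).add measurable_snd)).mul (hf.comp measurable_fst)
      _ = ∫⁻ x, ∫⁻ a, K.indicator 1 (π a) * f (a - L x) ∂μ ∂ν := by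
          refine lintegral_congr fun x => ?_
          rw [← lintegral_add_left_eq_self (fun a => K.indicator 1 (π a) * f (a - L x)) (L x)]
          refine lintegral_congr fun a => ?_
          rw [map_add, hπL, add_comm x, add_sub_cancel_left]
      _ = ∫⁻ a, ∫⁻ x, K.indicator 1 (π a) * f (a - L x) ∂ν ∂μ := by
          refine lintegral_lintegral_swap (Measurable.aemeasurable ?_)
          exact (hχ.comp (hπ.comp measurable_snd)).mul
            (hf.comp (measurable_snd.sub (hL.comp measurable_fst)))
      _ = _ := by
          refine lintegral_congr fun a => ?_
          rw [lintegral_const_mul _ (f := fun x => f (a - L x)) (hf.comp (measurable_const.sub hL))]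
  rw [key f hf, key g hg]
  refine lintegral_mono fun a => mul_le_mul_right ?_ _
  -- Each coset is re-based at its point in the kernel of `π`, where `h` applies; this uses
  -- invariance of `ν` under `x ↦ π a - x`.
  have conv : ∀ f : V → ENNReal, ∫⁻ x, f (a - L x) ∂ν = ∫⁻ x, f ((a - L (π a)) + L x) ∂ν := by
    intro f
    rw [← lintegral_sub_left_eq_self (fun x => f ((a - L (π a)) + L x)) (π a)]
    refine lintegral_congr fun x => ?_
    congr 1
    rw [map_sub]; abel
  rw [conv f, conv g]
  exact h _ (by rw [map_sub, hπL, sub_self])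

/-- Exponential Markov inequality for a weight which an exponential tilt turns into a translate. -/
theorem lintegral_tail_le {E : Type*} [MeasurableSpace E] [AddGroup E] [MeasurableAdd E]
    [MeasurableNeg E] [MeasurableSub E]
    (ν : Measure E) [ν.IsAddRightInvariant] {w : E → ENNReal} (hw : Measurable w) (ℓ : E → ℝ)
    (h : E) (c r : ℝ)
    (H : ∀ x, ENNReal.ofReal (Real.exp (ℓ x)) * w x ≤ ENNReal.ofReal (Real.exp c) * w (x - h)) :
    ∫⁻ x, {x | r < ℓ x}.indicator w x ∂ν ≤ ENNReal.ofReal (Real.exp (c - r)) * ∫⁻ x, w x ∂ν := by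
  calc ∫⁻ x, {x | r < ℓ x}.indicator w x ∂ν
      ≤ ∫⁻ x, ENNReal.ofReal (Real.exp (c - r)) * w (x - h) ∂ν := by
        refine lintegral_mono fun x => ?_
        refine Set.indicator_apply_le' (fun hx => ?_) (fun _ => zero_le)
        have hx : r < ℓ x := hx
        have h1 : (1 : ENNReal) ≤ ENNReal.ofReal (Real.exp (-r)) * ENNReal.ofReal (Real.exp (ℓ x)) := by
          rw [← ENNReal.ofReal_mul (Real.exp_nonneg _), ← Real.exp_add, ENNReal.one_le_ofReal]
          exact Real.one_le_exp (by linarith)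
        calc w x = 1 * w x := (one_mul _).symm
          _ ≤ ENNReal.ofReal (Real.exp (-r)) * (ENNReal.ofReal (Real.exp (ℓ x)) * w x) := by
              rw [← mul_assoc]; gcongr
          _ ≤ ENNReal.ofReal (Real.exp (-r)) * (ENNReal.ofReal (Real.exp c) * w (x - h)) := by
              exact mul_le_mul_right (H x) _
          _ = _ := by
              rw [← mul_assoc, ← ENNReal.ofReal_mul (Real.exp_nonneg _), ← Real.exp_add]
              congr 3; ring
    _ = _ := by
        rw [lintegral_const_mul _ (f := fun x => w (x - h)) (hw.comp (measurable_sub_const h)),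
          lintegral_sub_right_eq_self w h]

/-! ### Small ball estimates for Gaussian quadratic forms -/

theorem one_add_sum_le_prod_one_add {ι : Type*} (s : Finset ι) (x : ι → ℝ) (hx : ∀ i, 0 ≤ x i) :
    1 + ∑ i ∈ s, x i ≤ ∏ i ∈ s, (1 + x i) := by
  classical
  induction s using Finset.induction_on with
  | empty => simp
  | insert a s ha ih =>
    rw [Finset.sum_insert ha, Finset.prod_insert ha]
    have h1 := hx a
    have h2 : 0 ≤ ∑ i ∈ s, x i := Finset.sum_nonneg fun i _ => hx i
    nlinarith

section SmallBall

variable {ι : Type*} [Fintype ι] [DecidableEq ι]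

/-- The linear change of variables `x ↦ C x` in `ℝ^ι`. -/
theorem lintegral_comp_mulVec (C : Matrix ι ι ℝ) (hC : C.det ≠ 0) {f : (ι → ℝ) → ENNReal}
    (hf : Measurable f) :
    ∫⁻ x, f x = ENNReal.ofReal |C.det| * ∫⁻ x, f (C *ᵥ x) := by
  have h := Real.map_matrix_volume_pi_eq_smul_volume_pi hC
  have hm : Measurable (⇑(Matrix.toLin' C)) :=
    (LinearMap.continuous_on_pi (Matrix.toLin' C)).measurable
  have h2 : ∫⁻ x, f (C *ᵥ x) = ENNReal.ofReal |C.det⁻¹| * ∫⁻ x, f x := by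
    rw [← smul_eq_mul, ← lintegral_smul_measure, ← h, lintegral_map hf hm]
    rfl
  rw [h2, ← mul_assoc, ← ENNReal.ofReal_mul (abs_nonneg _), ← abs_mul, mul_inv_cancel₀ hC]
  simp

/-- Orthogonal diagonalisation of a real symmetric matrix. -/
theorem exists_orthogonal_diagonalization (W : Matrix ι ι ℝ) (hH : W.IsHermitian) :
    ∃ U : Matrix ι ι ℝ, U * Uᵀ = 1 ∧ Uᵀ * U = 1 ∧
      W = U * Matrix.diagonal hH.eigenvalues * Uᵀ := by
  refine ⟨(hH.eigenvectorUnitary : Matrix ι ι ℝ), ?_, ?_, ?_⟩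
  · have := Unitary.coe_mul_star_self hH.eigenvectorUnitary
    simpa [Matrix.star_eq_conjTranspose] using this
  · have := Unitary.coe_star_mul_self hH.eigenvectorUnitary
    simpa [Matrix.star_eq_conjTranspose] using this
  · conv_lhs => rw [hH.spectral_theorem]
    rw [Unitary.conjStarAlgAut_apply]
    simp [Matrix.star_eq_conjTranspose]

/-- A Gram factor of `1 + s W` together with the lower bound `1 + s tr W` for its determinant. -/
theorem exists_gram_one_add (W : Matrix ι ι ℝ) (hW : W.PosSemidef) {s : ℝ} (hs : 0 ≤ s) :
    ∃ C : Matrix ι ι ℝ, Cᵀ * C = 1 + s • W ∧ 1 + s * W.trace ≤ C.det ^ 2 := by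
  have hH := hW.isHermitian
  obtain ⟨U, hU1, hU2, hWU⟩ := exists_orthogonal_diagonalization W hH
  have hnn : ∀ i, 0 ≤ s * hH.eigenvalues i := fun i => mul_nonneg hs (hW.eigenvalues_nonneg i)
  refine ⟨Matrix.diagonal (fun i => Real.sqrt (1 + s * hH.eigenvalues i)) * Uᵀ, ?_, ?_⟩
  · rw [Matrix.transpose_mul, Matrix.transpose_transpose, Matrix.diagonal_transpose,
      Matrix.mul_assoc, ← Matrix.mul_assoc (Matrix.diagonal _) (Matrix.diagonal _),
      Matrix.diagonal_mul_diagonal]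
    have : (Matrix.diagonal fun i => Real.sqrt (1 + s * hH.eigenvalues i) *
        Real.sqrt (1 + s * hH.eigenvalues i)) = 1 + s • Matrix.diagonal hH.eigenvalues := by
      rw [← Matrix.diagonal_one, ← Matrix.diagonal_smul, Matrix.diagonal_add]
      congr 1; funext i
      rw [Real.mul_self_sqrt (by linarith [hnn i])]
      simp
    rw [this, Matrix.add_mul, Matrix.mul_add, Matrix.one_mul, hU1, Matrix.smul_mul,
      Matrix.mul_smul, ← Matrix.mul_assoc, ← hWU]
  · have hd : U.det ^ 2 = 1 := by
      have := congrArg Matrix.det hU1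
      rw [Matrix.det_mul, Matrix.det_transpose, Matrix.det_one] at this
      rw [sq, this]
    have ht : W.trace = ∑ i, hH.eigenvalues i := by
      have := hH.trace_eq_sum_eigenvalues
      simpa using this
    rw [Matrix.det_mul, Matrix.det_transpose, mul_pow, hd, mul_one, Matrix.det_diagonal,
      ← Finset.prod_pow, ht, Finset.mul_sum]
    refine (one_add_sum_le_prod_one_add _ _ hnn).trans (le_of_eq ?_)
    refine Finset.prod_congr rfl fun i _ => ?_
    rw [Real.sq_sqrt (by linarith [hnn i])]

/-- Laplace transform of a positive semidefinite quadratic form under a shifted Gaussian weight. -/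
theorem lintegral_laplace_le (W : Matrix ι ι ℝ) (hW : W.PosSemidef) {γ τ : ℝ} (hγ : 0 < γ)
    (hτ : 0 ≤ τ) (x₀ : ι → ℝ) :
    ∫⁻ x : ι → ℝ, ENNReal.ofReal (Real.exp (-τ * (x ⬝ᵥ W *ᵥ x) - γ * ∑ i, (x i - x₀ i) ^ 2)) ≤
      ENNReal.ofReal ((1 + τ / γ * W.trace) ^ (-(1 / 2) : ℝ)) *
        ∫⁻ x : ι → ℝ, ENNReal.ofReal (Real.exp (-γ * ∑ i, (x i - x₀ i) ^ 2)) := by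
  obtain ⟨C, hC, hdet⟩ := exists_gram_one_add W hW (div_nonneg hτ hγ.le)
  have htr : 0 ≤ τ / γ * W.trace := mul_nonneg (div_nonneg hτ hγ.le) hW.trace_nonneg
  have hC0 : C.det ≠ 0 := by intro h; rw [h] at hdet; norm_num at hdet; linarith
  -- Completing the square: with `Cᵀ y₀ = x₀` the exponent equals `-γ |C x - y₀|² + γ (|y₀|² -
  -- |x₀|²)`, so only `|y₀| ≤ |x₀|` and the Jacobian of `C` are needed.
  obtain ⟨y₀, hCT⟩ : ∃ y₀ : ι → ℝ, Cᵀ *ᵥ y₀ = x₀ := by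
    have : IsUnit (Cᵀ).det := by rw [Matrix.det_transpose]; exact hC0.isUnit
    exact ⟨(Cᵀ)⁻¹ *ᵥ x₀, by
      rw [Matrix.mulVec_mulVec, Matrix.mul_nonsing_inv _ this, Matrix.one_mulVec]⟩
  have quad : ∀ x : ι → ℝ, (C *ᵥ x) ⬝ᵥ (C *ᵥ x) = x ⬝ᵥ x + τ / γ * (x ⬝ᵥ W *ᵥ x) := by
    intro x
    rw [Matrix.dotProduct_mulVec, ← Matrix.mulVec_transpose, Matrix.mulVec_mulVec, hC,
      Matrix.add_mulVec, Matrix.one_mulVec, Matrix.smul_mulVec, add_dotProduct, smul_dotProduct,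
      dotProduct_comm (W *ᵥ x), smul_eq_mul]
  -- Since `CᵀC ≥ 1`, the map `C` does not shrink and the inverse of `Cᵀ` does not stretch. This
  -- makes the bound uniform in the centre.
  have hy₀ : y₀ ⬝ᵥ y₀ ≤ x₀ ⬝ᵥ x₀ := by
    set x₁ : ι → ℝ := C⁻¹ *ᵥ y₀
    have hx₁ : C *ᵥ x₁ = y₀ := by
      rw [Matrix.mulVec_mulVec, Matrix.mul_nonsing_inv _ hC0.isUnit, Matrix.one_mulVec]
    have h1 : y₀ ⬝ᵥ y₀ = x₁ ⬝ᵥ x₀ := by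
      rw [← hCT, Matrix.dotProduct_mulVec, Matrix.vecMul_transpose, hx₁]
    have h2 : x₁ ⬝ᵥ x₁ ≤ y₀ ⬝ᵥ y₀ := by
      have := quad x₁
      rw [hx₁] at this
      have h3 : 0 ≤ x₁ ⬝ᵥ W *ᵥ x₁ := by simpa using hW.dotProduct_mulVec_nonneg x₁
      have := mul_nonneg (div_nonneg hτ hγ.le) h3
      linarith
    have h4 : (x₁ ⬝ᵥ x₀) ^ 2 ≤ (x₁ ⬝ᵥ x₁) * (x₀ ⬝ᵥ x₀) := by
      have := Finset.sum_mul_sq_le_sq_mul_sq Finset.univ x₁ x₀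
      simpa only [dotProduct, sq] using this
    have h5 : 0 ≤ x₀ ⬝ᵥ x₀ := Finset.sum_nonneg fun i _ => mul_self_nonneg (x₀ i)
    rw [← h1] at h4
    have h6 : (y₀ ⬝ᵥ y₀) ^ 2 ≤ (y₀ ⬝ᵥ y₀) * (x₀ ⬝ᵥ x₀) :=
      h4.trans (mul_le_mul_of_nonneg_right h2 h5)
    by_contra! hlt
    have : 0 < y₀ ⬝ᵥ y₀ := lt_of_le_of_lt h5 hlt
    nlinarith
  have expand : ∀ x y : ι → ℝ, ∑ i, (x i - y i) ^ 2 = x ⬝ᵥ x - 2 * (x ⬝ᵥ y) + y ⬝ᵥ y := by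
    intro x y
    simp only [dotProduct, Finset.mul_sum, ← Finset.sum_sub_distrib, ← Finset.sum_add_distrib]
    exact Finset.sum_congr rfl fun i _ => by ring
  have hm : ∀ z : ι → ℝ, Measurable fun x : ι → ℝ =>
      ENNReal.ofReal (Real.exp (-γ * ∑ i, (x i - z i) ^ 2)) := by
    intro z; fun_prop
  have shift : ∀ z : ι → ℝ, ∫⁻ x : ι → ℝ, ENNReal.ofReal (Real.exp (-γ * ∑ i, (x i - z i) ^ 2)) =
      ∫⁻ x : ι → ℝ, ENNReal.ofReal (Real.exp (-γ * ∑ i, (x i) ^ 2)) := by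
    intro z
    exact lintegral_sub_right_eq_self
      (fun x : ι → ℝ => ENNReal.ofReal (Real.exp (-γ * ∑ i, (x i) ^ 2))) z
  have step : ∫⁻ x : ι → ℝ, ENNReal.ofReal
      (Real.exp (-τ * (x ⬝ᵥ W *ᵥ x) - γ * ∑ i, (x i - x₀ i) ^ 2)) ≤
      ∫⁻ x : ι → ℝ, ENNReal.ofReal (Real.exp (-γ * ∑ i, ((C *ᵥ x) i - y₀ i) ^ 2)) := by
    refine lintegral_mono fun x => ENNReal.ofReal_le_ofReal (Real.exp_le_exp.mpr ?_)
    have h1 : (C *ᵥ x) ⬝ᵥ y₀ = x ⬝ᵥ x₀ := by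
      rw [← hCT, Matrix.dotProduct_mulVec, Matrix.vecMul_transpose]
    rw [expand, expand, quad, h1]
    have : γ * (τ / γ * (x ⬝ᵥ W *ᵥ x)) = τ * (x ⬝ᵥ W *ᵥ x) := by field_simp
    nlinarith
  have cov := lintegral_comp_mulVec C hC0 (hm y₀)
  rw [shift y₀, ← shift x₀] at cov
  refine step.trans ?_
  rw [cov, ← mul_assoc, ← ENNReal.ofReal_mul (Real.rpow_nonneg (by linarith) _)]
  have hge : 1 ≤ (1 + τ / γ * W.trace) ^ (-(1 / 2) : ℝ) * |C.det| := by
    rw [Real.rpow_neg (by linarith), ← Real.sqrt_eq_rpow, ← Real.sqrt_sq_eq_abs]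
    have hpos : 0 < Real.sqrt (1 + τ / γ * W.trace) := Real.sqrt_pos.mpr (by linarith)
    rw [inv_mul_eq_div, le_div_iff₀ hpos, one_mul]
    exact Real.sqrt_le_sqrt hdet
  calc _ = 1 * _ := (one_mul _).symm
    _ ≤ _ := mul_le_mul_left (ENNReal.one_le_ofReal.mpr hge) _

/-- Small ball estimate for a positive semidefinite quadratic form. -/
theorem lintegral_small_ball_le (W : Matrix ι ι ℝ) (hW : W.PosSemidef) {γ b : ℝ} (hγ : 0 < γ)
    (hb : 0 < b) (x₀ : ι → ℝ) :
    ∫⁻ x : ι → ℝ, {x | x ⬝ᵥ W *ᵥ x ≤ b}.indicator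
        (fun x => ENNReal.ofReal (Real.exp (-γ * ∑ i, (x i - x₀ i) ^ 2))) x ≤
      ENNReal.ofReal (Real.exp 1 * (1 + W.trace / (γ * b)) ^ (-(1 / 2) : ℝ)) *
        ∫⁻ x : ι → ℝ, ENNReal.ofReal (Real.exp (-γ * ∑ i, (x i - x₀ i) ^ 2)) := by
  -- Markov's inequality with `τ = 1 / b`: on the event the Laplace weight is at least `exp (-1)`.
  have h := lintegral_laplace_le W hW hγ (inv_nonneg.mpr hb.le) x₀
  have e1 : b⁻¹ / γ * W.trace = W.trace / (γ * b) := by field_simp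
  rw [e1] at h
  rw [ENNReal.ofReal_mul (Real.exp_nonneg _), mul_assoc]
  refine le_trans ?_ (mul_le_mul_right h _)
  rw [← lintegral_const_mul' _ _ ENNReal.ofReal_ne_top]
  refine lintegral_mono fun x => ?_
  refine Set.indicator_apply_le' (fun hx => ?_) (fun _ => zero_le)
  rw [← ENNReal.ofReal_mul (Real.exp_nonneg _), ← Real.exp_add]
  refine ENNReal.ofReal_le_ofReal (Real.exp_le_exp.mpr ?_)
  have hx : x ⬝ᵥ W *ᵥ x ≤ b := hx
  have : b⁻¹ * (x ⬝ᵥ W *ᵥ x) ≤ 1 := by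
    rw [inv_mul_le_iff₀ hb]; linarith
  linarith

end SmallBall

/-! ### Lebesgue measure on symmetric matrices, in coordinates on unordered pairs -/

section SymMat

variable {ι κ : Type*}

/-- The symmetric matrix with prescribed entries on unordered pairs. -/
def symMat (x : Sym2 ι → ℝ) : Matrix ι ι ℝ := Matrix.of fun i j => x s(i, j)

@[simp] theorem symMat_apply (x : Sym2 ι → ℝ) (i j : ι) : symMat x i j = x s(i, j) := rfl

theorem symMat_transpose (x : Sym2 ι → ℝ) : (symMat x)ᵀ = symMat x := by
  ext i j; simp [Sym2.eq_swap]

theorem symMat_add (x y : Sym2 ι → ℝ) : symMat (x + y) = symMat x + symMat y := rfl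

theorem symMat_sub (x y : Sym2 ι → ℝ) : symMat (x - y) = symMat x - symMat y := rfl

theorem symMat_smul (r : ℝ) (y : Sym2 ι → ℝ) : symMat (r • y) = r • symMat y := rfl

/-- The coordinates of the symmetric part of a matrix. -/
noncomputable def symCoord (X : Matrix ι ι ℝ) : Sym2 ι → ℝ :=
  Sym2.lift ⟨fun i j => (X i j + X j i) / 2, fun i j => by simp only [add_comm]⟩

@[simp] theorem symCoord_mk (X : Matrix ι ι ℝ) (i j : ι) :
    symCoord X s(i, j) = (X i j + X j i) / 2 := rfl

theorem symMat_symCoord {X : Matrix ι ι ℝ} (hX : Xᵀ = X) : symMat (symCoord X) = X := by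
  ext i j
  have : X j i = X i j := congrFun (congrFun hX i) j
  simp [this]

theorem symCoord_symMat (x : Sym2 ι → ℝ) : symCoord (symMat x) = x := by
  funext z
  induction z using Sym2.ind with
  | _ i j => simp [Sym2.eq_swap (a := j)]

/-- The unnormalised Gaussian weight `exp (-β ‖X - S‖_F²)` on symmetric matrices. -/
noncomputable def gaussWeight [Fintype ι] (β : ℝ) (S x : Sym2 ι → ℝ) : ENNReal :=
  ENNReal.ofReal (Real.exp (-β * ∑ i, ∑ j, (x s(i, j) - S s(i, j)) ^ 2))

theorem measurable_gaussWeight [Fintype ι] [Countable (Sym2 ι)] (β : ℝ) (S : Sym2 ι → ℝ) :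
    Measurable (gaussWeight β S) := by
  unfold gaussWeight; fun_prop

/-- Unordered pairs of `Option κ`: those containing `none`, and the others. -/
noncomputable def sym2OptionEquiv (κ : Type*) : Option κ ⊕ Sym2 κ ≃ Sym2 (Option κ) :=
  Equiv.ofBijective (Sum.elim (fun o => s(none, o)) (Sym2.map some)) <| by
    constructor
    · rintro (a | a) (b | b) h
      · have h : s(none, a) = s(none, b) := h
        exact congrArg Sum.inl (Sym2.congr_right.mp h)
      · induction b using Sym2.ind with
        | _ i j => simp at h
      · induction a using Sym2.ind with
        | _ i j => simp at h
      · simpa using Sym2.map.injective (Option.some_injective κ) h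
    · intro z
      induction z using Sym2.ind with
      | _ i j =>
        rcases i with _ | i
        · exact ⟨Sum.inl j, rfl⟩
        · rcases j with _ | j
          · exact ⟨Sum.inl (some i), Sym2.eq_swap⟩
          · exact ⟨Sum.inr s(i, j), rfl⟩

/-- The symmetric matrix with corner `d`, first row `v`, and remaining block `z`. -/
noncomputable def border (d : ℝ) (v : κ → ℝ) (z : Sym2 κ → ℝ) : Sym2 (Option κ) → ℝ :=
  fun p => Sum.elim (fun o => o.elim d v) z ((sym2OptionEquiv κ).symm p)

theorem border_inl (d : ℝ) (v : κ → ℝ) (z : Sym2 κ → ℝ) (o : Option κ) :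
    border d v z s(none, o) = o.elim d v := by
  have : s(none, o) = sym2OptionEquiv κ (Sum.inl o) := rfl
  rw [border, this, Equiv.symm_apply_apply]; rfl

@[simp] theorem border_none_none (d : ℝ) (v : κ → ℝ) (z : Sym2 κ → ℝ) :
    border d v z s(none, none) = d := border_inl d v z none

@[simp] theorem border_none_some (d : ℝ) (v : κ → ℝ) (z : Sym2 κ → ℝ) (i : κ) :
    border d v z s(none, some i) = v i := border_inl d v z (some i)

@[simp] theorem border_some_none (d : ℝ) (v : κ → ℝ) (z : Sym2 κ → ℝ) (i : κ) :
    border d v z s(some i, none) = v i := by rw [Sym2.eq_swap, border_none_some]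

@[simp] theorem border_some_some (d : ℝ) (v : κ → ℝ) (z : Sym2 κ → ℝ) (i j : κ) :
    border d v z s(some i, some j) = z s(i, j) := by
  have : s(some i, some j) = sym2OptionEquiv κ (Sum.inr s(i, j)) := rfl
  rw [border, this, Equiv.symm_apply_apply]; rfl

theorem measurable_border [Fintype κ] :
    Measurable fun p : (Sym2 κ → ℝ) × (κ → ℝ) × ℝ => border p.2.2 p.2.1 p.1 := by
  refine measurable_pi_iff.mpr fun q => ?_
  induction q using Sym2.ind with
  | _ i j => rcases i with _ | i <;> rcases j with _ | j <;> simp <;> fun_prop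

variable [Fintype κ]

/-- Fubini for the decomposition of a symmetric matrix into corner, first row and block. -/
theorem lintegral_sym2_option {F : (Sym2 (Option κ) → ℝ) → ENNReal} (hF : Measurable F) :
    ∫⁻ x, F x = ∫⁻ z : Sym2 κ → ℝ, ∫⁻ v : κ → ℝ, ∫⁻ d : ℝ, F (border d v z) := by
  have h1 := (volume_measurePreserving_piCongrLeft (fun _ : Sym2 (Option κ) => ℝ)
    (sym2OptionEquiv κ))
  have h2 := volume_measurePreserving_sumPiEquivProdPi_symm (fun _ : Option κ ⊕ Sym2 κ => ℝ)
  have h3 := h1.comp h2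
  have h4 : MeasurePreserving (MeasurableEquiv.piOptionEquivProd (fun _ : Option κ => ℝ)).symm
      volume volume :=
    ⟨MeasurableEquiv.measurable _, Measure.pi_map_piOptionEquivProd (fun _ : Option κ => volume)⟩
  rw [← h3.lintegral_comp hF, Measure.volume_eq_prod]
  have hm := hF.comp h3.measurable
  refine (lintegral_prod_symm' _ hm).trans ?_
  refine lintegral_congr fun z => ?_
  have hm' := hm.comp (measurable_prodMk_right (y := z))
  refine (h4.lintegral_comp hm').symm.trans ?_
  refine (lintegral_prod _ (hm'.comp h4.measurable).aemeasurable).trans ?_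
  refine lintegral_congr fun v => lintegral_congr fun d => ?_
  refine congrArg F (funext fun p => ?_)
  obtain ⟨q, rfl⟩ := (sym2OptionEquiv κ).surjective p
  simp only [border, Equiv.symm_apply_apply, Function.comp_apply]
  erw [Equiv.piCongrLeft_apply_apply]
  rcases q with (_ | o) | q <;> rfl

end SymMat

/-! ### Rotation invariance -/

section Transfer

/-- The image of Lebesgue measure is a positive finite multiple of Lebesgue measure, and the factor
cancels from the comparison. Hence the Jacobian of orthogonal conjugation on symmetric matrices
never has to be computed. -/
theorem lintegral_le_of_linearEquiv {ι κ : Type*} [Fintype ι] [Fintype κ]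
    (L : (κ → ℝ) ≃ₗ[ℝ] (ι → ℝ)) {f g : (ι → ℝ) → ENNReal} (hf : Measurable f) (hg : Measurable g)
    (h : ∫⁻ x, f (L x) ≤ ∫⁻ x, g (L x)) : ∫⁻ x, f x ≤ ∫⁻ x, g x := by
  have hLm : Measurable L := (LinearMap.continuous_on_pi L.toLinearMap).measurable
  have : (Measure.map L (volume : Measure (κ → ℝ))).IsAddHaarMeasure :=
    L.toContinuousLinearEquiv.isAddHaarMeasure_map volume
  rw [← lintegral_map hf hLm, ← lintegral_map hg hLm,
    Measure.isAddLeftInvariant_eq_smul (Measure.map L volume) (volume : Measure (ι → ℝ))] at h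
  have hpos := Measure.addHaarScalarFactor_pos_of_isAddHaarMeasure
    (Measure.map L volume) (volume : Measure (ι → ℝ))
  simp only [lintegral_smul_measure, ENNReal.smul_def, smul_eq_mul] at h
  exact (ENNReal.mul_le_mul_iff_right (by simpa using hpos.ne') ENNReal.coe_ne_top).mp h

variable {ι κ : Type*} [Fintype ι] [Fintype κ] [DecidableEq ι] [DecidableEq κ]

/-- Conjugation of symmetric matrices by an orthogonal matrix. -/
noncomputable def orthConj (O : Matrix ι κ ℝ) (h1 : O * Oᵀ = 1) (h2 : Oᵀ * O = 1) :
    (Sym2 κ → ℝ) ≃ₗ[ℝ] (Sym2 ι → ℝ) where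
  toFun x := symCoord (O * symMat x * Oᵀ)
  invFun x := symCoord (Oᵀ * symMat x * O)
  map_add' x y := by
    funext z
    induction z using Sym2.ind with
    | _ i j => simp [symMat_add, Matrix.mul_add, Matrix.add_mul]; ring
  map_smul' r x := by
    funext z
    induction z using Sym2.ind with
    | _ i j => simp [symMat_smul]; ring
  left_inv x := by
    have : (O * symMat x * Oᵀ)ᵀ = O * symMat x * Oᵀ := by
      simp [Matrix.transpose_mul, symMat_transpose, Matrix.mul_assoc]
    simp only
    rw [symMat_symCoord this]
    have e : Oᵀ * (O * symMat x * Oᵀ) * O = (Oᵀ * O) * symMat x * (Oᵀ * O) := by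
      simp only [Matrix.mul_assoc]
    rw [e, h2, Matrix.one_mul, Matrix.mul_one, symCoord_symMat]
  right_inv x := by
    have : (Oᵀ * symMat x * O)ᵀ = Oᵀ * symMat x * O := by
      simp [Matrix.transpose_mul, symMat_transpose, Matrix.mul_assoc]
    simp only
    rw [symMat_symCoord this]
    have e : O * (Oᵀ * symMat x * O) * Oᵀ = (O * Oᵀ) * symMat x * (O * Oᵀ) := by
      simp only [Matrix.mul_assoc]
    rw [e, h1, Matrix.one_mul, Matrix.mul_one, symCoord_symMat]

theorem symMat_orthConj (O : Matrix ι κ ℝ) (h1 : O * Oᵀ = 1) (h2 : Oᵀ * O = 1) (x : Sym2 κ → ℝ) :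
    symMat (orthConj O h1 h2 x) = O * symMat x * Oᵀ :=
  symMat_symCoord (by simp [Matrix.transpose_mul, symMat_transpose, Matrix.mul_assoc])

theorem sum_sq_eq_trace {ι : Type*} [Fintype ι] (X : Matrix ι ι ℝ) : ∑ i, ∑ j, X i j ^ 2 =
    (Xᵀ * X).trace := by
  rw [Finset.sum_comm]
  simp [Matrix.trace, Matrix.mul_apply, sq]

/-- The Frobenius distance is invariant under conjugation. The centre rotates along, which is
harmless because the estimates below are uniform in it. -/
theorem gaussWeight_orthConj (O : Matrix ι κ ℝ) (h1 : O * Oᵀ = 1) (h2 : Oᵀ * O = 1) (β : ℝ)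
    (S : Sym2 ι → ℝ) (x : Sym2 κ → ℝ) :
    gaussWeight β S (orthConj O h1 h2 x) = gaussWeight β ((orthConj O h1 h2).symm S) x := by
  obtain ⟨S, rfl⟩ := (orthConj O h1 h2).surjective S
  rw [LinearEquiv.symm_apply_apply]
  unfold gaussWeight
  have e : ∀ (x y : Sym2 ι → ℝ), ∑ i, ∑ j, (x s(i, j) - y s(i, j)) ^ 2
      = ((symMat (x - y))ᵀ * symMat (x - y)).trace := fun x y => sum_sq_eq_trace (symMat (x - y))
  have e' : ∀ (x y : Sym2 κ → ℝ), ∑ i, ∑ j, (x s(i, j) - y s(i, j)) ^ 2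
      = ((symMat (x - y))ᵀ * symMat (x - y)).trace := fun x y => sum_sq_eq_trace (symMat (x - y))
  rw [e, e', ← map_sub, symMat_orthConj]
  congr 4
  set Y := symMat (x - S)
  have : (O * Y * Oᵀ)ᵀ * (O * Y * Oᵀ) = O * (Yᵀ * (Oᵀ * O) * Y * Oᵀ) := by
    simp only [Matrix.transpose_mul, Matrix.transpose_transpose, Matrix.mul_assoc]
  rw [this, h2, Matrix.mul_one, Matrix.trace_mul_comm, Matrix.mul_assoc, Matrix.mul_assoc, h2,
    Matrix.mul_one]

/-- An orthogonal matrix with prescribed first column. -/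
theorem exists_orthogonal_col (i₀ : ι) (u : ι → ℝ) (hu : u ⬝ᵥ u = 1) :
    ∃ O : Matrix ι (Option {i // i ≠ i₀}) ℝ, O * Oᵀ = 1 ∧ Oᵀ * O = 1 ∧ ∀ i, O i none = u i := by
  obtain ⟨H, hsymm, hH, hcol⟩ : ∃ H : Matrix ι ι ℝ, Hᵀ = H ∧ H * H = 1 ∧ ∀ i, H i i₀ = u i := by
    by_cases hue : u = Pi.single i₀ 1
    · exact ⟨1, by simp, by simp, fun i => by
        rw [hue, Matrix.one_apply, Pi.single_apply]⟩
    -- Householder reflection along `w`, which exchanges the two unit vectors. The case `w = 0` had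
    -- to be split off.
    set w : ι → ℝ := u - Pi.single i₀ 1
    have hww : w ⬝ᵥ w = 2 - 2 * u i₀ := by
      simp only [w, sub_dotProduct, dotProduct_sub, hu, dotProduct_single, single_dotProduct,
        Pi.sub_apply, Pi.single_eq_same]
      ring
    have hw0 : w ⬝ᵥ w ≠ 0 := fun h => hue (sub_eq_zero.mp (dotProduct_self_eq_zero.mp h))
    refine ⟨1 - (2 / (w ⬝ᵥ w)) • Matrix.vecMulVec w w, ?_, ?_, fun i => ?_⟩
    · simp [Matrix.transpose_vecMulVec]
    · have : Matrix.vecMulVec w w * Matrix.vecMulVec w w = (w ⬝ᵥ w) • Matrix.vecMulVec w w := by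
        rw [Matrix.vecMulVec_mul_vecMulVec]
        ext i j
        simp [Matrix.vecMulVec_apply]
        ring
      have e : 2 / (w ⬝ᵥ w) * (2 / (w ⬝ᵥ w) * (w ⬝ᵥ w)) = 2 / (w ⬝ᵥ w) + 2 / (w ⬝ᵥ w) := by
        field_simp; norm_num
      set R := (2 / (w ⬝ᵥ w)) • Matrix.vecMulVec w w with hR
      have hRR : R * R = R + R := by
        rw [hR, Matrix.smul_mul, Matrix.mul_smul, this, smul_smul, smul_smul, mul_assoc, e, add_smul]
      rw [Matrix.sub_mul, Matrix.one_mul, Matrix.mul_sub, hRR, Matrix.mul_one]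
      abel
    · have e : w i₀ = u i₀ - 1 := by simp [w]
      have e2 : w i = u i - (1 : Matrix ι ι ℝ) i i₀ := by simp [w, Matrix.one_apply, Pi.single_apply]
      have h0 : 2 / (w ⬝ᵥ w) * w i₀ = -1 := by
        rw [div_mul_eq_mul_div, div_eq_iff hw0, hww, e]; ring
      simp only [Matrix.sub_apply, Matrix.smul_apply, Matrix.vecMulVec_apply, smul_eq_mul]
      rw [mul_comm (w i), ← mul_assoc, h0, e2]; ring
  refine ⟨H.submatrix id (Equiv.optionSubtypeNe i₀), ?_, ?_, fun i => ?_⟩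
  · rw [Matrix.transpose_submatrix, hsymm,
      Matrix.submatrix_mul_equiv H H id (Equiv.optionSubtypeNe i₀) id, hH]
    simp
  · rw [Matrix.transpose_submatrix, hsymm]
    rw [← Matrix.submatrix_mul _ _ _ _ _ Function.bijective_id, hH]
    simp
  · simp [hcol]

end Transfer

/-! ### Wegner estimate for the inverse applied to one vector -/

/-- An affine density times a Gaussian puts mass `O(r √γ)` on an interval of radius `r`. -/
theorem lintegral_affine_gaussian_le (a₀ a₁ q₀ c : ℝ) {γ r : ℝ} (hγ : 0 < γ) (hr : 0 ≤ r) :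
    ∫⁻ q : ℝ, {q | |q| < r}.indicator
        (fun q => ENNReal.ofReal (|a₀ + a₁ * q| * Real.exp (-γ * (q - q₀) ^ 2 + c))) q ≤
      ENNReal.ofReal (2 * Real.exp 4 * (r * Real.sqrt γ)) *
        ∫⁻ q : ℝ, ENNReal.ofReal (|a₀ + a₁ * q| * Real.exp (-γ * (q - q₀) ^ 2 + c)) := by
  set A := a₀ + a₁ * q₀
  set s := (Real.sqrt γ)⁻¹
  have hsq : 0 < Real.sqrt γ := Real.sqrt_pos.mpr hγ
  have hs : 0 < s := inv_pos.mpr hsq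
  have hss : Real.sqrt γ * s = 1 := mul_inv_cancel₀ hsq.ne'
  have hγs : γ * s ^ 2 = 1 := by
    have : γ = Real.sqrt γ ^ 2 := (Real.sq_sqrt hγ.le).symm
    rw [this, ← mul_pow, hss, one_pow]
  set m := |A| + |a₁| * s
  have hm : 0 ≤ m := by positivity
  have hA : ∀ q, a₀ + a₁ * q = A + a₁ * (q - q₀) := fun q => by simp only [A]; ring
  -- `s` is the width of the Gaussian and `m` the typical size of the affine factor at that distance
  -- from the centre. The density is at most `m exp c` everywhere, so the interval of length `2 r`
  -- carries mass at most `2 r m exp c`.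
  have upper : ∀ q, |a₀ + a₁ * q| * Real.exp (-γ * (q - q₀) ^ 2 + c) ≤ m * Real.exp c := by
    intro q
    rw [Real.exp_add, ← mul_assoc]
    refine mul_le_mul_of_nonneg_right ?_ (Real.exp_nonneg _)
    set τ := q - q₀
    have h1 : |a₀ + a₁ * q| ≤ |A| + |a₁| * |τ| := by
      rw [hA, ← abs_mul]; exact abs_add_le _ _
    have h2 : Real.exp (-γ * τ ^ 2) ≤ 1 := Real.exp_le_one_iff.mpr (by nlinarith [sq_nonneg τ])
    have h3 : |τ| * Real.exp (-γ * τ ^ 2) ≤ s := by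
      rw [neg_mul, Real.exp_neg, ← div_eq_mul_inv, div_le_iff₀ (Real.exp_pos _)]
      have h4 := Real.add_one_le_exp (γ * τ ^ 2)
      have h5 : |τ| ≤ s * (γ * τ ^ 2 + 1) := by
        have h6 : s * (γ * τ ^ 2 + 1) * s = τ ^ 2 + s ^ 2 := by
          linear_combination τ ^ 2 * hγs
        have h7 : |τ| * s ≤ τ ^ 2 + s ^ 2 := by
          rw [← sq_abs τ]; nlinarith [sq_nonneg (|τ| - s), abs_nonneg τ]
        rw [← h6] at h7
        exact le_of_mul_le_mul_right h7 hs
      exact h5.trans (mul_le_mul_of_nonneg_left h4 hs.le)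
    calc |a₀ + a₁ * q| * Real.exp (-γ * τ ^ 2)
        ≤ (|A| + |a₁| * |τ|) * Real.exp (-γ * τ ^ 2) := by gcongr
      _ = |A| * Real.exp (-γ * τ ^ 2) + |a₁| * (|τ| * Real.exp (-γ * τ ^ 2)) := by ring
      _ ≤ |A| * 1 + |a₁| * s := by gcongr
      _ = m := by simp [m]
  -- An interval of length `s`, between `s` and `2 s` away from the centre and on the side where the
  -- two terms of the affine function have the same sign, carries mass at least `m exp (-4) exp c *
  -- s`. A zero of the affine factor therefore does no harm.
  have lower : ∀ I : Set ℝ, MeasurableSet I → volume I = ENNReal.ofReal s →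
      (∀ q ∈ I, |q - q₀| ≤ 2 * s ∧ s ≤ |q - q₀| ∧ 0 ≤ A * (a₁ * (q - q₀))) →
      ENNReal.ofReal (m * Real.exp (-4) * Real.exp c * s) ≤
        ∫⁻ q : ℝ, ENNReal.ofReal (|a₀ + a₁ * q| * Real.exp (-γ * (q - q₀) ^ 2 + c)) := by
    intro I hI hvol hq
    calc ENNReal.ofReal (m * Real.exp (-4) * Real.exp c * s)
        = ∫⁻ q in I, ENNReal.ofReal (m * Real.exp (-4) * Real.exp c) := by
          rw [lintegral_const, Measure.restrict_apply_univ, hvol,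
            ← ENNReal.ofReal_mul (by positivity)]
      _ ≤ ∫⁻ q in I, ENNReal.ofReal (|a₀ + a₁ * q| * Real.exp (-γ * (q - q₀) ^ 2 + c)) := by
          refine setLIntegral_mono' hI fun q hqI => ENNReal.ofReal_le_ofReal ?_
          obtain ⟨h1, h2, h3⟩ := hq q hqI
          rw [Real.exp_add, ← mul_assoc]
          refine mul_le_mul_of_nonneg_right ?_ (Real.exp_nonneg _)
          have h4 : m ≤ |a₀ + a₁ * q| := by
            rw [hA, abs_add_eq_add_abs_iff A (a₁ * (q - q₀)) |>.mpr, abs_mul]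
            · simp only [m]; gcongr
            · rcases mul_nonneg_iff.mp h3 with h | h
              · exact Or.inl h
              · exact Or.inr h
          have h5 : Real.exp (-4) ≤ Real.exp (-γ * (q - q₀) ^ 2) := by
            refine Real.exp_le_exp.mpr ?_
            have : (q - q₀) ^ 2 ≤ (2 * s) ^ 2 := sq_le_sq' (by linarith [abs_le.mp h1]) (abs_le.mp h1).2
            nlinarith
          exact mul_le_mul h4 h5 (Real.exp_nonneg _) (abs_nonneg _)
      _ ≤ _ := setLIntegral_le_lintegral _ _
  have lower' : ENNReal.ofReal (m * Real.exp (-4) * Real.exp c * s) ≤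
        ∫⁻ q : ℝ, ENNReal.ofReal (|a₀ + a₁ * q| * Real.exp (-γ * (q - q₀) ^ 2 + c)) := by
    rcases le_total 0 (A * a₁) with h | h
    · refine lower (Set.Icc (q₀ + s) (q₀ + 2 * s)) measurableSet_Icc ?_ fun q hq => ?_
      · rw [Real.volume_Icc]; congr 1; ring
      · have : 0 ≤ q - q₀ := by linarith [hq.1]
        rw [abs_of_nonneg this]
        exact ⟨by linarith [hq.2], by linarith [hq.1], by rw [← mul_assoc]; positivity⟩
    · refine lower (Set.Icc (q₀ - 2 * s) (q₀ - s)) measurableSet_Icc ?_ fun q hq => ?_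
      · rw [Real.volume_Icc]; congr 1; ring
      · have : q - q₀ ≤ 0 := by linarith [hq.2]
        rw [abs_of_nonpos this]
        exact ⟨by linarith [hq.1], by linarith [hq.2],
          by rw [← mul_assoc]; exact mul_nonneg_of_nonpos_of_nonpos h this⟩
  calc _ ≤ ∫⁻ q : ℝ, (Set.Ioo (-r) r).indicator (fun _ => ENNReal.ofReal (m * Real.exp c)) q := by
        refine lintegral_mono fun q => ?_
        refine Set.indicator_apply_le' (fun hq => ?_) (fun _ => zero_le)
        rw [Set.indicator_of_mem (show q ∈ Set.Ioo (-r) r from abs_lt.mp hq)]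
        exact ENNReal.ofReal_le_ofReal (upper q)
    _ = ENNReal.ofReal (m * Real.exp c * (2 * r)) := by
        rw [lintegral_indicator measurableSet_Ioo, lintegral_const, Measure.restrict_apply_univ,
          Real.volume_Ioo, ← ENNReal.ofReal_mul (by positivity)]
        congr 2; ring
    _ = ENNReal.ofReal (2 * Real.exp 4 * (r * Real.sqrt γ)) *
          ENNReal.ofReal (m * Real.exp (-4) * Real.exp c * s) := by
        rw [← ENNReal.ofReal_mul (by positivity)]
        congr 1
        have : Real.exp 4 * Real.exp (-4) = 1 := by rw [← Real.exp_add]; simp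
        linear_combination (-2 * r * m * Real.exp c) * this
          - (2 * r * m * Real.exp c) * (Real.exp 4 * Real.exp (-4)) * hss
    _ ≤ _ := mul_le_mul_right lower' _

/-- A matrix is invertible after almost every shift by a multiple of the identity. -/
theorem volume_det_add_smul_one_eq_zero {κ : Type*} [Fintype κ] [DecidableEq κ]
    (A : Matrix κ κ ℝ) : volume {t : ℝ | (A + t • 1).det = 0} = 0 := by
  refine Set.Finite.measure_zero ?_ _
  refine Set.Finite.subset ((-A).charpoly.roots.toFinset.finite_toSet) fun t ht => ?_
  have ht : (A + t • 1).det = 0 := ht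
  simp only [Finset.mem_coe, Multiset.mem_toFinset]
  rw [Polynomial.mem_roots (Matrix.charpoly_monic _).ne_zero, Polynomial.IsRoot.def,
    Matrix.eval_charpoly, ← ht]
  congr 1
  rw [sub_neg_eq_add, add_comm, Matrix.scalar_apply, Matrix.smul_one_eq_diagonal]

theorem measurable_det {α κ : Type*} [Fintype κ] [DecidableEq κ] [MeasurableSpace α]
    {f : α → Matrix κ κ ℝ} (hf : ∀ i j, Measurable fun a => f a i j) :
    Measurable fun a => (f a).det := by
  simp only [Matrix.det_apply]
  fun_prop

theorem measurable_symMat {κ : Type*} (i j : κ) :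
    Measurable fun x : Sym2 κ → ℝ => symMat x i j := by
  simp only [symMat_apply]; fun_prop

/-- Fubini along the lines `a + t • 1`: on each of them the determinant vanishes at finitely many
`t` only. One diagonal entry serves as the coordinate on the lines. -/
theorem ae_det_symMat_ne_zero {κ : Type*} [Fintype κ] [DecidableEq κ] :
    ∀ᵐ z : Sym2 κ → ℝ, (symMat z).det ≠ 0 := by
  rcases isEmpty_or_nonempty κ with hκ | ⟨⟨i₀⟩⟩
  · exact ae_of_all _ fun z => by simp [Matrix.det_isEmpty]
  have hms : MeasurableSet {z : Sym2 κ → ℝ | (symMat z).det = 0} :=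
    measurable_det measurable_symMat (measurableSet_singleton 0)
  rw [ae_iff]
  simp only [not_not]
  rw [← lintegral_indicator_one hms, ← nonpos_iff_eq_zero]
  have key := lintegral_le_of_fiber (V := Sym2 κ → ℝ) (E := ℝ) volume volume
    { toFun := fun t => t • symCoord 1, map_zero' := by simp, map_add' := fun a b => add_smul _ _ _ }
    { toFun := fun x => x s(i₀, i₀), map_zero' := rfl, map_add' := fun _ _ => rfl }
    (by simp only [AddMonoidHom.coe_mk, ZeroHom.coe_mk]; fun_prop)
    (by simp only [AddMonoidHom.coe_mk, ZeroHom.coe_mk]; fun_prop)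
    (by intro x; simp) (Set.Icc 0 1) measurableSet_Icc (by simp)
    (f := {z : Sym2 κ → ℝ | (symMat z).det = 0}.indicator 1) (g := fun _ => 0)
    (measurable_one.indicator hms) measurable_const ?_
  · simpa using key
  · intro a _
    simp only [AddMonoidHom.coe_mk, ZeroHom.coe_mk, lintegral_zero, nonpos_iff_eq_zero]
    have hae : ∀ᵐ t : ℝ, (symMat a + t • 1).det ≠ 0 := by
      rw [ae_iff]; simpa using volume_det_add_smul_one_eq_zero (symMat a)
    rw [lintegral_eq_zero_iff']
    · filter_upwards [hae] with t ht
      refine Set.indicator_of_notMem ?_ _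
      simp only [Set.mem_ofPred_eq, symMat_add, symMat_smul]
      rwa [symMat_symCoord (Matrix.transpose_one)]
    · exact ((measurable_one.indicator hms).comp (by fun_prop)).aemeasurable

section Resolvent

variable {κ : Type*} [Fintype κ] [DecidableEq κ]

/-- The perturbation has rank one: the determinant equals that of a bordered matrix in which `q`
occurs in a single column, and is thus affine in `q`. -/
theorem exists_det_sub_smul_vecMulVec (A : Matrix κ κ ℝ) (y : κ → ℝ) :
    ∃ a₀ a₁ : ℝ, ∀ q : ℝ, (A - q • Matrix.vecMulVec y y).det = a₀ + a₁ * q := by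
  set N : ℝ → Matrix (Unit ⊕ κ) (Unit ⊕ κ) ℝ := fun q =>
    Matrix.fromBlocks 1 (Matrix.replicateRow Unit y) (q • Matrix.replicateCol Unit y) A
  have h1 : ∀ q, (A - q • Matrix.vecMulVec y y).det = (N q).det := by
    intro q
    rw [Matrix.det_fromBlocks_one₁₁]
    congr 2
    ext i j
    simp [Matrix.mul_apply, Matrix.vecMulVec_apply, mul_assoc]
  have h2 : ∀ q, N q = (N 0).updateCol (Sum.inl ())
      (Pi.single (Sum.inl ()) 1 + q • Sum.elim (fun _ => (0 : ℝ)) y) := by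
    intro q
    ext i j
    rcases i with i | i <;> rcases j with j | j <;> simp [N]
  refine ⟨((N 0).updateCol (Sum.inl ()) (Pi.single (Sum.inl ()) 1)).det,
    ((N 0).updateCol (Sum.inl ()) (Sum.elim (fun _ => (0 : ℝ)) y)).det, fun q => ?_⟩
  rw [h1, h2, Matrix.det_updateCol_add, Matrix.det_updateCol_smul, mul_comm q]

/-- The symmetric matrix `D` on `Option κ` with `D (1, y) = n² q e_none`, where `n = 1 + |y|²`, in
the coordinates for which `q` moves `D` along a fixed direction. -/
noncomputable def ray (y : κ → ℝ) (z : Sym2 κ → ℝ) (q : ℝ) : Sym2 (Option κ) → ℝ :=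
  border (y ⬝ᵥ symMat z *ᵥ y + q * (1 + 2 * (y ⬝ᵥ y)))
    (-(symMat z *ᵥ y) + (q * (y ⬝ᵥ y)) • y) (z - q • symCoord (Matrix.vecMulVec y y))

theorem symMat_symCoord_vecMulVec {κ : Type*} (y : κ → ℝ) :
    symMat (symCoord (Matrix.vecMulVec y y)) = Matrix.vecMulVec y y :=
  symMat_symCoord (Matrix.transpose_vecMulVec y y)

theorem measurable_mulVec {α ι κ : Type*} [Fintype κ] [MeasurableSpace α]
    {f : α → Matrix ι κ ℝ} {g : α → κ → ℝ} (hf : ∀ i j, Measurable fun a => f a i j)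
    (hg : ∀ j, Measurable fun a => g a j) (i : ι) : Measurable fun a => (f a *ᵥ g a) i := by
  simp only [Matrix.mulVec, dotProduct]
  fun_prop

theorem measurable_dotProduct {α κ : Type*} [Fintype κ] [MeasurableSpace α]
    {f g : α → κ → ℝ} (hf : ∀ j, Measurable fun a => f a j)
    (hg : ∀ j, Measurable fun a => g a j) : Measurable fun a => f a ⬝ᵥ g a := by
  simp only [dotProduct]
  fun_prop

theorem symMat_border_mulVec {κ : Type*} [Fintype κ] (d c : ℝ) (v w : κ → ℝ) (z : Sym2 κ → ℝ) :
    symMat (border d v z) *ᵥ (fun o => o.elim c w) =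
      fun o => o.elim (d * c + v ⬝ᵥ w) (c • v + symMat z *ᵥ w) := by
  funext o
  rcases o with _ | i <;>
    simp [Matrix.mulVec, dotProduct, Fintype.sum_option, mul_comm]

theorem measurable_symMat_mulVec {κ : Type*} [Fintype κ] :
    Measurable fun p : (Sym2 κ → ℝ) × (κ → ℝ) => symMat p.1 *ᵥ p.2 := by
  refine measurable_pi_iff.mpr fun i => measurable_mulVec (fun i j => ?_) (fun j => ?_) i
  · simp only [symMat_apply]; fun_prop
  · fun_prop

/-- The integrand after the substitution `v = -D' y`, `d = n² q + yᵀ D' y`. -/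
noncomputable def rayIntegrand (F : (Sym2 (Option κ) → ℝ) → ENNReal) (z : Sym2 κ → ℝ)
    (y : κ → ℝ) (q : ℝ) : ENNReal :=
  ENNReal.ofReal (|(symMat z).det| * (1 + y ⬝ᵥ y) ^ 2) *
    F (border ((1 + y ⬝ᵥ y) ^ 2 * q + y ⬝ᵥ symMat z *ᵥ y) (-(symMat z *ᵥ y)) z)

theorem measurable_comp_border {κ : Type*} [Fintype κ] {α : Type*} [MeasurableSpace α]
    {F : (Sym2 (Option κ) → ℝ) → ENNReal} (hF : Measurable F)
    {d : α → ℝ} {v : α → κ → ℝ} {z : α → Sym2 κ → ℝ}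
    (hd : Measurable d) (hv : Measurable v) (hz : Measurable z) :
    Measurable fun a => F (border (d a) (v a) (z a)) :=
  hF.comp (measurable_border.comp (hz.prodMk (hv.prodMk hd)))

theorem measurable_rayIntegrand {F : (Sym2 (Option κ) → ℝ) → ENNReal} (hF : Measurable F)
    {α : Type*} [MeasurableSpace α] {z : α → Sym2 κ → ℝ} {y : α → κ → ℝ} {q : α → ℝ}
    (hz : Measurable z) (hy : Measurable y) (hq : Measurable q) :
    Measurable fun a => rayIntegrand F (z a) (y a) (q a) := by
  have hmv : Measurable fun a => symMat (z a) *ᵥ y a :=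
    measurable_symMat_mulVec.comp (hz.prodMk hy)
  have h1 : Measurable fun a => y a ⬝ᵥ y a :=
    measurable_dotProduct (fun j => (measurable_pi_apply j).comp hy)
      (fun j => (measurable_pi_apply j).comp hy)
  have h2 : Measurable fun a => y a ⬝ᵥ symMat (z a) *ᵥ y a :=
    measurable_dotProduct (fun j => (measurable_pi_apply j).comp hy)
      (fun j => (measurable_pi_apply j).comp hmv)
  have h3 : Measurable fun a => (symMat (z a)).det :=
    measurable_det fun i j => (measurable_symMat i j).comp hz
  unfold rayIntegrand
  refine Measurable.mul ?_ (measurable_comp_border hF ?_ hmv.neg hz)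
  · fun_prop
  · fun_prop

theorem one_add_dotProduct_self_pos {κ : Type*} [Fintype κ] (y : κ → ℝ) : 0 < 1 + y ⬝ᵥ y := by
  have : 0 ≤ y ⬝ᵥ y := Finset.sum_nonneg fun i _ => mul_self_nonneg _
  linarith

/-- The substitution in the first row is linear with Jacobian `|det D'|`, which needs `D'`
invertible; the affine substitution in the corner contributes `(1 + |y|²) ^ 2`. -/
theorem lintegral_row_eq {F : (Sym2 (Option κ) → ℝ) → ENNReal} (hF : Measurable F)
    (z : Sym2 κ → ℝ) (hz : (symMat z).det ≠ 0) :
    ∫⁻ v : κ → ℝ, ∫⁻ d : ℝ, F (border d v z) =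
      ∫⁻ y : κ → ℝ, ∫⁻ q : ℝ, rayIntegrand F z y q := by
  have hz' : (-(symMat z)).det ≠ 0 := by
    rw [Matrix.det_neg]; exact mul_ne_zero (pow_ne_zero _ (by norm_num)) hz
  have habs : |(-(symMat z)).det| = |(symMat z).det| := by
    rw [Matrix.det_neg, abs_mul, abs_pow, abs_neg, abs_one, one_pow, one_mul]
  have hin : Measurable fun v : κ → ℝ => ∫⁻ d : ℝ, F (border d v z) :=
    Measurable.lintegral_prod_right' (f := fun p : (κ → ℝ) × ℝ => F (border p.2 p.1 z))
      (measurable_comp_border hF measurable_snd measurable_fst measurable_const)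
  rw [lintegral_comp_mulVec _ hz' hin, habs, ← lintegral_const_mul' _ _ ENNReal.ofReal_ne_top]
  refine lintegral_congr fun y => ?_
  simp only [Matrix.neg_mulVec, rayIntegrand]
  set n := (1 + y ⬝ᵥ y) ^ 2
  have hn' : 0 < n := pow_pos (one_add_dotProduct_self_pos y) 2
  rw [lintegral_const_mul' _ _ ENNReal.ofReal_ne_top, ENNReal.ofReal_mul (abs_nonneg _), mul_assoc]
  congr 1
  rw [← lintegral_add_right_eq_self (fun d => F (border d (-(symMat z *ᵥ y)) z))
    (y ⬝ᵥ symMat z *ᵥ y)]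
  have hm : Measurable fun d : ℝ => F (border (d + y ⬝ᵥ symMat z *ᵥ y) (-(symMat z *ᵥ y)) z) :=
    measurable_comp_border hF (measurable_id.add_const _) measurable_const measurable_const
  have h5 : ∫⁻ d : ℝ, F (border (n * d + y ⬝ᵥ symMat z *ᵥ y) (-(symMat z *ᵥ y)) z)
      = ENNReal.ofReal n⁻¹ *
        ∫⁻ d : ℝ, F (border (d + y ⬝ᵥ symMat z *ᵥ y) (-(symMat z *ᵥ y)) z) := by
    have := lintegral_map hm (measurable_const_mul n) (μ := (volume : Measure ℝ))
    rw [← this, Real.map_volume_mul_left hn'.ne', lintegral_smul_measure, smul_eq_mul,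
      abs_of_pos (inv_pos.mpr hn')]
  rw [h5, ← mul_assoc, ← ENNReal.ofReal_mul hn'.le, mul_inv_cancel₀ hn'.ne', ENNReal.ofReal_one,
    one_mul]

theorem sub_smul_vecMulVec_mulVec {κ : Type*} [Fintype κ] (z : Sym2 κ → ℝ) (y : κ → ℝ) (q : ℝ) :
    symMat (z - q • symCoord (Matrix.vecMulVec y y)) *ᵥ y
      = symMat z *ᵥ y - (q * (y ⬝ᵥ y)) • y := by
  rw [symMat_sub, symMat_smul, symMat_symCoord_vecMulVec,
    Matrix.sub_mulVec, Matrix.smul_mulVec, Matrix.vecMulVec_mulVec]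
  ext i; simp; ring

theorem rayIntegrand_sub (F : (Sym2 (Option κ) → ℝ) → ENNReal) (z : Sym2 κ → ℝ)
    (y : κ → ℝ) (q : ℝ) :
    rayIntegrand F (z - q • symCoord (Matrix.vecMulVec y y)) y q =
      ENNReal.ofReal (|(symMat z - q • Matrix.vecMulVec y y).det| * (1 + y ⬝ᵥ y) ^ 2) *
        F (ray y z q) := by
  rw [rayIntegrand, ray, sub_smul_vecMulVec_mulVec, symMat_sub, symMat_smul,
    symMat_symCoord_vecMulVec, dotProduct_sub, dotProduct_smul, smul_eq_mul]
  congr 3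
  · ring
  · abel

theorem lintegral_ray {F : (Sym2 (Option κ) → ℝ) → ENNReal} (hF : Measurable F) :
    ∫⁻ x, F x = ∫⁻ y : κ → ℝ, ∫⁻ z : Sym2 κ → ℝ, ∫⁻ q : ℝ,
      ENNReal.ofReal (|(symMat z - q • Matrix.vecMulVec y y).det| * (1 + y ⬝ᵥ y) ^ 2) *
        F (ray y z q) := by
  calc ∫⁻ x, F x = ∫⁻ z : Sym2 κ → ℝ, ∫⁻ y : κ → ℝ, ∫⁻ q : ℝ, rayIntegrand F z y q := by
        rw [lintegral_sym2_option hF]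
        refine lintegral_congr_ae ?_
        filter_upwards [ae_det_symMat_ne_zero (κ := κ)] with z hz using lintegral_row_eq hF z hz
    _ = ∫⁻ y : κ → ℝ, ∫⁻ z : Sym2 κ → ℝ, ∫⁻ q : ℝ, rayIntegrand F z y q := by
        refine lintegral_lintegral_swap (Measurable.aemeasurable ?_)
        exact Measurable.lintegral_prod_right'
          (f := fun p : ((Sym2 κ → ℝ) × (κ → ℝ)) × ℝ => rayIntegrand F p.1.1 p.1.2 p.2)
          (measurable_rayIntegrand hF measurable_fst.fst measurable_fst.snd measurable_snd)
    -- A measure preserving shear in the block. If `q` moved only the corner, the ray would have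
    -- squared speed `n ^ 4` with `n = 1 + |y|²`, too large to be compensated later. The shear
    -- reduces it to `2 n ^ 3 - n ^ 2` and keeps the Jacobian affine in `q`.
    _ = ∫⁻ y : κ → ℝ, ∫⁻ z : Sym2 κ → ℝ, ∫⁻ q : ℝ,
          rayIntegrand F (z - q • symCoord (Matrix.vecMulVec y y)) y q := by
        refine lintegral_congr fun y => ?_
        rw [lintegral_lintegral_swap (f := fun z q => rayIntegrand F z y q)
          (measurable_rayIntegrand hF measurable_fst measurable_const measurable_snd).aemeasurable,
          lintegral_lintegral_swap
            (f := fun z q => rayIntegrand F (z - q • symCoord (Matrix.vecMulVec y y)) y q)]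
        · exact lintegral_congr fun q =>
            (lintegral_sub_right_eq_self (fun z => rayIntegrand F z y q) _).symm
        · refine (measurable_rayIntegrand hF ?_ measurable_const measurable_snd).aemeasurable
          exact measurable_fst.sub (measurable_snd.smul_const _)
    _ = _ := by simp_rw [rayIntegrand_sub]

/-- The purpose of the coordinates: if the matrix is invertible, its inverse maps the basis vector
at `none` to `(1, y) / (n ^ 2 q)` with `n = 1 + |y|²`, a vector of squared length `1 / (n ^ 3 q ^
2)`. -/
theorem symMat_ray_mulVec (y : κ → ℝ) (z : Sym2 κ → ℝ) (q : ℝ) :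
    symMat (ray y z q) *ᵥ (fun o => o.elim 1 y) =
      ((1 + y ⬝ᵥ y) ^ 2 * q) • Pi.single none (1 : ℝ) := by
  rw [ray, symMat_border_mulVec, sub_smul_vecMulVec_mulVec]
  funext o
  rcases o with _ | i
  · simp only [Option.elim, add_dotProduct, neg_dotProduct, smul_dotProduct, smul_eq_mul,
      Pi.smul_apply, Pi.single_eq_same, dotProduct_comm y]
    ring
  · simp

/-- The squared distance to a fixed matrix is quadratic along a ray. -/
theorem exists_sum_sq_ray {κ : Type*} [Fintype κ] (S : Sym2 (Option κ) → ℝ) (y : κ → ℝ)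
    (z : Sym2 κ → ℝ) :
    ∃ b c : ℝ, ∀ q : ℝ, ∑ i, ∑ j, (ray y z q s(i, j) - S s(i, j)) ^ 2 =
      (2 * (1 + y ⬝ᵥ y) ^ 3 - (1 + y ⬝ᵥ y) ^ 2) * q ^ 2 + b * q + c := by
  set m := y ⬝ᵥ y with hm
  -- The velocity of the ray. Its squared length is the leading coefficient, the only one whose
  -- value matters.
  set H : Sym2 (Option κ) → ℝ :=
    border (1 + 2 * m) (m • y) (-symCoord (Matrix.vecMulVec y y)) with hH
  have hray : ∀ q i j, ray y z q s(i, j) = ray y z 0 s(i, j) + q * H s(i, j) := by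
    intro q i j
    rcases i with _ | i <;> rcases j with _ | j <;> simp [ray, hH, ← hm] <;> ring
  have hHH : ∑ i, ∑ j, H s(i, j) ^ 2 = 2 * (1 + m) ^ 3 - (1 + m) ^ 2 := by
    have e1 : ∑ i, (m * y i) ^ 2 = m ^ 3 := by
      simp_rw [mul_pow]
      rw [← Finset.mul_sum]
      have : ∑ i, y i ^ 2 = m := by simp [hm, dotProduct, sq]
      rw [this]; ring
    have e2 : ∑ i, ∑ j, ((y i * y j + y j * y i) / 2) ^ 2 = m ^ 2 := by
      have : ∀ i j, ((y i * y j + y j * y i) / 2) ^ 2 = (y i * y i) * (y j * y j) := by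
        intro i j; ring
      simp_rw [this, ← Finset.mul_sum, ← Finset.sum_mul]
      rw [hm, dotProduct, sq]
    simp only [Fintype.sum_option, hH, border_none_none, border_none_some, border_some_none,
      border_some_some, Pi.smul_apply, smul_eq_mul, Pi.neg_apply, symCoord_mk,
      Matrix.vecMulVec_apply, neg_sq, Finset.sum_add_distrib, e1, e2]
    ring
  refine ⟨∑ i, ∑ j, 2 * H s(i, j) * (ray y z 0 s(i, j) - S s(i, j)),
    ∑ i, ∑ j, (ray y z 0 s(i, j) - S s(i, j)) ^ 2, fun q => ?_⟩
  rw [← hHH]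
  simp only [Finset.sum_mul, ← Finset.sum_add_distrib]
  refine Finset.sum_congr rfl fun i _ => Finset.sum_congr rfl fun j _ => ?_
  rw [hray]; ring

end Resolvent

theorem measurable_inv_apply {α κ : Type*} [Fintype κ] [DecidableEq κ] [MeasurableSpace α]
    {f : α → Matrix κ κ ℝ} (hf : ∀ i j, Measurable fun a => f a i j) (i j : κ) :
    Measurable fun a => (f a)⁻¹ i j := by
  simp only [Matrix.inv_def, Matrix.smul_apply, Ring.inverse_eq_inv', smul_eq_mul,
    Matrix.adjugate_apply]
  refine (measurable_det hf).inv.mul (measurable_det fun k l => ?_)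
  simp only [Matrix.updateRow_apply]
  split_ifs
  · exact measurable_const
  · exact hf k l

theorem measurableSet_inv_mulVec {κ : Type*} [Fintype κ] [DecidableEq κ] (u : κ → ℝ) (t : ℝ) :
    MeasurableSet {x : Sym2 κ → ℝ |
      t < ((symMat x)⁻¹ *ᵥ u) ⬝ᵥ ((symMat x)⁻¹ *ᵥ u)} := by
  have h : ∀ i, Measurable fun x : Sym2 κ → ℝ => ((symMat x)⁻¹ *ᵥ u) i :=
    measurable_mulVec (measurable_inv_apply measurable_symMat) fun j => measurable_const
  exact measurableSet_lt measurable_const (measurable_dotProduct h h)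

/-- For fixed `y` and `z` the event forces `|q| < r = 1 / (t n ^ (3 / 2))`, while `q` has an affine
density times a Gaussian of rate at most `2 β n ^ 3`. The powers of `n` cancel, so the bound is
uniform in `y`, `z` and the centre. -/
theorem lintegral_inv_mulVec_single_le {κ : Type*} [Fintype κ] [DecidableEq κ]
    (S : Sym2 (Option κ) → ℝ) {β t : ℝ} (hβ : 0 < β) (ht : 0 < t) :
    ∫⁻ x, {x : Sym2 (Option κ) → ℝ | t ^ 2 < ((symMat x)⁻¹ *ᵥ Pi.single none 1) ⬝ᵥ
        ((symMat x)⁻¹ *ᵥ Pi.single none 1)}.indicator (gaussWeight β S) x ≤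
      ENNReal.ofReal (2 * Real.exp 4 * (Real.sqrt (2 * β) / t)) * ∫⁻ x, gaussWeight β S x := by
  have hgm := measurable_gaussWeight β S
  rw [lintegral_ray hgm, lintegral_ray (hgm.indicator (measurableSet_inv_mulVec _ _)),
    ← lintegral_const_mul' _ _ ENNReal.ofReal_ne_top]
  refine lintegral_mono fun y => ?_
  dsimp only
  rw [← lintegral_const_mul' _ _ ENNReal.ofReal_ne_top]
  refine lintegral_mono fun z => ?_
  dsimp only
  obtain ⟨a₀, a₁, hdet⟩ := exists_det_sub_smul_vecMulVec (symMat z) y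
  obtain ⟨b, c, hquad⟩ := exists_sum_sq_ray S y z
  have hn : 1 ≤ 1 + y ⬝ᵥ y := by
    have : 0 ≤ y ⬝ᵥ y := Finset.sum_nonneg fun i _ => mul_self_nonneg _
    linarith
  have hθ : (fun o : Option κ => o.elim 1 y) ⬝ᵥ (fun o : Option κ => o.elim 1 y) = 1 + y ⬝ᵥ y := by
    simp [dotProduct, Fintype.sum_option]
  have hray := symMat_ray_mulVec y z
  set n := 1 + y ⬝ᵥ y
  have hn2 : n ^ 2 ≤ n ^ 3 := pow_le_pow_right₀ hn (by norm_num)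
  have hn3 : 0 < n ^ 3 := by positivity
  set α := 2 * n ^ 3 - n ^ 2
  have hα : 0 < α := by simp only [α]; linarith
  set r := 1 / (t * Real.sqrt (n ^ 3))
  have hsn : 0 < Real.sqrt (n ^ 3) := Real.sqrt_pos.mpr hn3
  have hr : 0 < r := by positivity
  have hw : ∀ q, gaussWeight β S (ray y z q) = ENNReal.ofReal (Real.exp
      (-(β * α) * (q - -b / (2 * α)) ^ 2 + β * (b ^ 2 / (4 * α) - c))) := by
    intro q
    rw [gaussWeight, hquad]
    congr 2
    field_simp
    ring
  have hin : ∀ q, t ^ 2 < ((symMat (ray y z q))⁻¹ *ᵥ Pi.single none 1) ⬝ᵥ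
      ((symMat (ray y z q))⁻¹ *ᵥ Pi.single none 1) → |q| < r := by
    intro q hq
    have h1 := hray q
    set Dm := symMat (ray y z q)
    by_cases hu : IsUnit Dm.det
    · have h2 := congrArg (fun v => Dm⁻¹ *ᵥ v) h1
      simp only [Matrix.mulVec_mulVec, Matrix.nonsing_inv_mul _ hu, Matrix.one_mulVec,
        Matrix.mulVec_smul] at h2
      rw [h2, smul_dotProduct, dotProduct_smul, smul_eq_mul, smul_eq_mul] at hθ
      set W := (Dm⁻¹ *ᵥ Pi.single none 1) ⬝ᵥ (Dm⁻¹ *ᵥ Pi.single none 1)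
      have hq0 : q ≠ 0 := by
        rintro rfl
        simp at hθ
        linarith
      have hnp : 0 < n := by linarith
      have h3 : n ^ 4 * q ^ 2 * t ^ 2 < n := by
        have : n ^ 4 * q ^ 2 * t ^ 2 < n ^ 4 * q ^ 2 * W := by gcongr
        nlinarith
      have h4 : n ^ 3 * q ^ 2 * t ^ 2 < 1 := by
        have : n * (n ^ 3 * q ^ 2 * t ^ 2) < n * 1 := by nlinarith
        exact lt_of_mul_lt_mul_left this hnp.le
      refine abs_lt_of_sq_lt_sq ?_ hr.le
      simp only [r, div_pow, mul_pow, Real.sq_sqrt hn3.le]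
      rw [lt_div_iff₀ (by positivity)]
      nlinarith
    -- For a singular matrix the inverse is zero by convention and the event does not occur.
    · rw [Matrix.nonsing_inv_apply_not_isUnit _ hu] at hq
      rw [Matrix.zero_mulVec, zero_dotProduct] at hq
      nlinarith
  calc ∫⁻ q : ℝ, ENNReal.ofReal (|(symMat z - q • Matrix.vecMulVec y y).det| * n ^ 2) *
        {x : Sym2 (Option κ) → ℝ | t ^ 2 < ((symMat x)⁻¹ *ᵥ Pi.single none 1) ⬝ᵥ
        ((symMat x)⁻¹ *ᵥ Pi.single none 1)}.indicator (gaussWeight β S) (ray y z q)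
      ≤ ∫⁻ q : ℝ, ENNReal.ofReal (n ^ 2) * {q | |q| < r}.indicator (fun q => ENNReal.ofReal
          (|a₀ + a₁ * q| * Real.exp (-(β * α) * (q - -b / (2 * α)) ^ 2
            + β * (b ^ 2 / (4 * α) - c)))) q := by
        refine lintegral_mono fun q => ?_
        by_cases hq : t ^ 2 < ((symMat (ray y z q))⁻¹ *ᵥ Pi.single none 1) ⬝ᵥ
            ((symMat (ray y z q))⁻¹ *ᵥ Pi.single none 1)
        · rw [Set.indicator_of_mem (by exact hq), Set.indicator_of_mem (by exact hin q hq), hw, hdet,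
            mul_comm _ (n ^ 2), ENNReal.ofReal_mul (by positivity),
            ENNReal.ofReal_mul (abs_nonneg _), mul_assoc]
        · rw [Set.indicator_of_notMem (by exact hq), mul_zero]
          exact zero_le
    _ ≤ ENNReal.ofReal (n ^ 2) * (ENNReal.ofReal (2 * Real.exp 4 * (r * Real.sqrt (β * α))) *
          ∫⁻ q : ℝ, ENNReal.ofReal (|a₀ + a₁ * q| *
            Real.exp (-(β * α) * (q - -b / (2 * α)) ^ 2 + β * (b ^ 2 / (4 * α) - c)))) := by
        rw [lintegral_const_mul' _ _ ENNReal.ofReal_ne_top]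
        exact mul_le_mul_right (lintegral_affine_gaussian_le _ _ _ _ (mul_pos hβ hα) hr.le) _
    _ = ENNReal.ofReal (2 * Real.exp 4 * (r * Real.sqrt (β * α))) *
          ∫⁻ q : ℝ, ENNReal.ofReal (|(symMat z - q • Matrix.vecMulVec y y).det| * n ^ 2) *
            gaussWeight β S (ray y z q) := by
        rw [mul_left_comm, ← lintegral_const_mul' _ _ ENNReal.ofReal_ne_top]
        congr 1
        refine lintegral_congr fun q => ?_
        rw [hw, hdet, mul_comm _ (n ^ 2), ENNReal.ofReal_mul (by positivity) (p := n ^ 2),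
            ENNReal.ofReal_mul (abs_nonneg _), mul_assoc]
    _ ≤ _ := by
        refine mul_le_mul_left (ENNReal.ofReal_le_ofReal ?_) _
        refine mul_le_mul_of_nonneg_left ?_ (by positivity)
        -- The inequality `α ≤ 2 n ^ 3` is what cancels the factor `n ^ (3 / 2)` in the denominator
        -- of `r`.
        have : Real.sqrt (β * α) ≤ Real.sqrt (2 * β) * Real.sqrt (n ^ 3) := by
          rw [← Real.sqrt_mul (by positivity)]
          refine Real.sqrt_le_sqrt ?_
          have : α ≤ 2 * n ^ 3 := by simp only [α]; nlinarith [sq_nonneg n]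
          nlinarith
        rw [one_div_mul_eq_div, div_le_div_iff₀ (by positivity) ht]
        nlinarith

section Frobenius

variable {ι : Type*} [Fintype ι] [DecidableEq ι]

theorem inv_orthogonal_conj {κ : Type*} [Fintype κ] [DecidableEq κ] (O : Matrix ι κ ℝ)
    (h1 : O * Oᵀ = 1) (h2 : Oᵀ * O = 1) (X : Matrix κ κ ℝ) :
    (O * X * Oᵀ)⁻¹ = O * X⁻¹ * Oᵀ := by
  by_cases hd : IsUnit (X).det
  · refine Matrix.inv_eq_right_inv ?_
    have : O * X * Oᵀ * (O * (X)⁻¹ * Oᵀ)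
        = O * (X * (Oᵀ * O) * (X)⁻¹) * Oᵀ := by
      simp only [Matrix.mul_assoc]
    rw [this, h2, Matrix.mul_one, Matrix.mul_nonsing_inv _ hd, Matrix.mul_one, h1]
  · have hd' : ¬ IsUnit (O * X * Oᵀ).det := by
      intro h
      apply hd
      have h3 : X * (Oᵀ * (O * X * Oᵀ)⁻¹ * O) = 1 := by
        have e : O * (X * (Oᵀ * (O * X * Oᵀ)⁻¹)) = 1 := by
          have := Matrix.mul_nonsing_inv _ h
          simpa only [Matrix.mul_assoc] using this
        have e2 : X * (Oᵀ * (O * X * Oᵀ)⁻¹) = Oᵀ := by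
          have := congrArg (fun Z => Oᵀ * Z) e
          simp only [← Matrix.mul_assoc, h2, Matrix.one_mul, Matrix.mul_one] at this
          simpa only [← Matrix.mul_assoc] using this
        rw [← Matrix.mul_assoc, e2, h2]
      exact Matrix.isUnit_det_of_right_inverse h3
    rw [Matrix.nonsing_inv_apply_not_isUnit _ hd, Matrix.nonsing_inv_apply_not_isUnit _ hd']
    simp

/-- A rotation takes `u` to the basis vector at `none`; uniformity in the centre absorbs the rotated
shift. -/
theorem lintegral_inv_mulVec_le (S : Sym2 ι → ℝ) {β t : ℝ} (hβ : 0 < β) (ht : 0 < t)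
    (u : ι → ℝ) (hu : u ⬝ᵥ u = 1) :
    ∫⁻ x, {x : Sym2 ι → ℝ | t ^ 2 < ((symMat x)⁻¹ *ᵥ u) ⬝ᵥ ((symMat x)⁻¹ *ᵥ u)}.indicator
        (gaussWeight β S) x ≤
      ENNReal.ofReal (2 * Real.exp 4 * (Real.sqrt (2 * β) / t)) * ∫⁻ x, gaussWeight β S x := by
  obtain ⟨i₀⟩ : Nonempty ι := by
    by_contra h
    rw [not_nonempty_iff] at h
    simp [dotProduct] at hu
  obtain ⟨O, h1, h2, hO⟩ := exists_orthogonal_col i₀ u hu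
  rw [← lintegral_const_mul' _ _ ENNReal.ofReal_ne_top]
  refine lintegral_le_of_linearEquiv (orthConj O h1 h2)
    ((measurable_gaussWeight β S).indicator (measurableSet_inv_mulVec _ _))
    ((measurable_gaussWeight β S).const_mul _) ?_
  simp only [gaussWeight_orthConj]
  rw [lintegral_const_mul' _ _ ENNReal.ofReal_ne_top]
  refine le_trans (le_of_eq ?_) (lintegral_inv_mulVec_single_le _ hβ ht)
  refine lintegral_congr fun x => ?_
  have hinv := inv_orthogonal_conj O h1 h2 (symMat x)
  have hu' : Oᵀ *ᵥ u = Pi.single none 1 := by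
    have : u = O *ᵥ Pi.single none 1 := by
      funext i; rw [Matrix.mulVec_single_one, Matrix.col_apply, hO]
    rw [this, Matrix.mulVec_mulVec, h2, Matrix.one_mulVec]
  have hdot : ∀ w : Option {i // i ≠ i₀} → ℝ, (O *ᵥ w) ⬝ᵥ (O *ᵥ w) = w ⬝ᵥ w := by
    intro w
    rw [Matrix.dotProduct_mulVec, ← Matrix.mulVec_transpose, Matrix.mulVec_mulVec, h2,
      Matrix.one_mulVec]
  have hset : ((symMat (orthConj O h1 h2 x))⁻¹ *ᵥ u) ⬝ᵥ ((symMat (orthConj O h1 h2 x))⁻¹ *ᵥ u)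
      = ((symMat x)⁻¹ *ᵥ Pi.single none 1) ⬝ᵥ ((symMat x)⁻¹ *ᵥ Pi.single none 1) := by
    rw [symMat_orthConj, hinv, ← Matrix.mulVec_mulVec, hu', ← Matrix.mulVec_mulVec, hdot]
  simp only [Set.indicator_apply, Set.mem_ofPred_eq, hset, gaussWeight_orthConj]

end Frobenius

/-! ### Random signs, and the Wegner estimate in Frobenius norm -/

section Signs

variable {ι κ : Type*} [DecidableEq ι] [Fintype κ]

/-- The signed sum of the vectors `x i`, `i ∈ s`, with sign `+` on `T` and `-` off `T`. -/
def signedSum {ι κ : Type*} [DecidableEq ι] (x : ι → κ → ℝ) (s T : Finset ι) : κ → ℝ :=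
  ∑ i ∈ s, (if i ∈ T then (1 : ℝ) else -1) • x i

theorem signedSum_insert {ι κ : Type*} [DecidableEq ι] (x : ι → κ → ℝ) {s T : Finset ι} {a : ι}
    (ha : a ∉ s) (hT : T ⊆ s) :
    signedSum x (insert a s) T = signedSum x s T - x a ∧
      signedSum x (insert a s) (insert a T) = signedSum x s T + x a := by
  have haT : a ∉ T := fun h => ha (hT h)
  constructor
  · rw [signedSum, Finset.sum_insert ha, if_neg haT, neg_one_smul, signedSum]; abel
  · rw [signedSum, Finset.sum_insert ha, if_pos (Finset.mem_insert_self _ _), one_smul, add_comm,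
      signedSum]
    congr 1
    refine Finset.sum_congr rfl fun i hi => ?_
    have : i ≠ a := fun h => ha (h ▸ hi)
    simp [Finset.mem_insert, this]

/-- Induction with the parallelogram law, pairing the two signs of the new vector. -/
theorem sum_signedSum_sq (x : ι → κ → ℝ) (s : Finset ι) :
    ∑ T ∈ s.powerset, signedSum x s T ⬝ᵥ signedSum x s T = 2 ^ s.card * ∑ i ∈ s, x i ⬝ᵥ x i := by
  induction s using Finset.induction_on with
  | empty => simp [signedSum]
  | insert a s ha ih =>
    have e : ∀ T ∈ s.powerset, signedSum x (insert a s) T ⬝ᵥ signedSum x (insert a s) T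
        + signedSum x (insert a s) (insert a T) ⬝ᵥ signedSum x (insert a s) (insert a T)
        = 2 * (signedSum x s T ⬝ᵥ signedSum x s T) + 2 * (x a ⬝ᵥ x a) := by
      intro T hT
      obtain ⟨h1, h2⟩ := signedSum_insert x ha (Finset.mem_powerset.mp hT)
      rw [h1, h2]
      simp only [sub_dotProduct, dotProduct_sub, add_dotProduct, dotProduct_add]
      ring
    rw [Finset.sum_powerset_insert ha, ← Finset.sum_add_distrib, Finset.sum_congr rfl e,
      Finset.sum_add_distrib, ← Finset.mul_sum, ih, Finset.sum_insert ha, Finset.sum_const,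
      Finset.card_powerset, Finset.card_insert_of_notMem ha]
    simp
    ring

theorem dotProduct_sq_le (a b : κ → ℝ) : (a ⬝ᵥ b) ^ 2 ≤ (a ⬝ᵥ a) * (b ⬝ᵥ b) := by
  have := Finset.sum_mul_sq_le_sq_mul_sq Finset.univ a b
  simpa only [dotProduct, sq] using this

theorem dotProduct_self_nonneg' (a : κ → ℝ) : 0 ≤ a ⬝ᵥ a :=
  Finset.sum_nonneg fun i _ => mul_self_nonneg (a i)

/-- Khintchine's inequality for fourth moments. -/
theorem sum_signedSum_fourth_le (x : ι → κ → ℝ) (s : Finset ι) :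
    ∑ T ∈ s.powerset, (signedSum x s T ⬝ᵥ signedSum x s T) ^ 2 ≤
      3 * 2 ^ s.card * (∑ i ∈ s, x i ⬝ᵥ x i) ^ 2 := by
  induction s using Finset.induction_on with
  | empty => simp [signedSum]
  | insert a s ha ih =>
    -- The two fourth powers sum to `2 (|v|² + |x|²)² + 8 (v · x)²`, to which Cauchy–Schwarz
    -- applies.
    have e : ∀ T ∈ s.powerset, (signedSum x (insert a s) T ⬝ᵥ signedSum x (insert a s) T) ^ 2
        + (signedSum x (insert a s) (insert a T) ⬝ᵥ signedSum x (insert a s) (insert a T)) ^ 2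
        ≤ 2 * (signedSum x s T ⬝ᵥ signedSum x s T) ^ 2 + 2 * (x a ⬝ᵥ x a) ^ 2
          + 12 * (x a ⬝ᵥ x a) * (signedSum x s T ⬝ᵥ signedSum x s T) := by
      intro T hT
      obtain ⟨h1, h2⟩ := signedSum_insert x ha (Finset.mem_powerset.mp hT)
      rw [h1, h2]
      set v := signedSum x s T
      have := dotProduct_sq_le v (x a)
      simp only [sub_dotProduct, dotProduct_sub, add_dotProduct, dotProduct_add,
        dotProduct_comm (x a) v]
      nlinarith
    rw [Finset.sum_powerset_insert ha, ← Finset.sum_add_distrib]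
    refine (Finset.sum_le_sum e).trans ?_
    rw [Finset.sum_add_distrib, Finset.sum_add_distrib, ← Finset.mul_sum, ← Finset.mul_sum,
      ← Finset.mul_sum, sum_signedSum_sq, Finset.sum_insert ha, Finset.sum_const,
      Finset.card_powerset, Finset.card_insert_of_notMem ha]
    simp only [nsmul_eq_mul, Nat.cast_pow, Nat.cast_ofNat]
    have h1 : (0 : ℝ) ≤ 2 ^ s.card * (x a ⬝ᵥ x a) ^ 2 := by positivity
    rw [pow_succ 2 s.card]
    generalize (2 : ℝ) ^ s.card = N at *
    generalize x a ⬝ᵥ x a = b at *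
    linear_combination 2 * ih + 4 * h1

/-- Paley–Zygmund for random signs: a fixed proportion of the signed sums are large. -/
theorem card_signedSum_large [Fintype ι] (x : ι → κ → ℝ) {t : ℝ} (ht : 0 ≤ t)
    (h : t < ∑ i, x i ⬝ᵥ x i) :
    (2 : ℝ) ^ Fintype.card ι ≤ 12 * ((Finset.univ : Finset ι).powerset.filter
      fun T => t / 2 < signedSum x Finset.univ T ⬝ᵥ signedSum x Finset.univ T).card := by
  set μ := ∑ i, x i ⬝ᵥ x i
  have hμ : 0 < μ := lt_of_le_of_lt ht h
  set P := (Finset.univ : Finset ι).powerset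
  set Z : Finset ι → ℝ := fun T => signedSum x Finset.univ T ⬝ᵥ signedSum x Finset.univ T
  set N : ℝ := 2 ^ Fintype.card ι
  have hN : 0 < N := by positivity
  have hcard : (P.card : ℝ) = N := by simp [P, N]
  have h1 : ∑ T ∈ P, Z T = N * μ := sum_signedSum_sq x Finset.univ
  have h2 : ∑ T ∈ P, Z T ^ 2 ≤ 3 * N * μ ^ 2 := sum_signedSum_fourth_le x Finset.univ
  set G := P.filter fun T => t / 2 < Z T
  -- Values below `t / 2 < μ / 2` contribute less than half of the total. Cauchy–Schwarz against the
  -- fourth moment then leaves at least `N / 12` large signs.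
  have h3 : N * μ / 2 ≤ ∑ T ∈ G, Z T := by
    have hs := Finset.sum_filter_add_sum_filter_not P (fun T => t / 2 < Z T) Z
    have hb : ∑ T ∈ P.filter (fun T => ¬ t / 2 < Z T), Z T ≤ N * (t / 2) := by
      refine (Finset.sum_le_card_nsmul _ _ (t / 2) fun T hT => ?_).trans ?_
      · exact not_lt.mp (Finset.mem_filter.mp hT).2
      · rw [nsmul_eq_mul, ← hcard]
        refine mul_le_mul_of_nonneg_right ?_ (by linarith)
        exact_mod_cast Finset.card_filter_le _ _
    have : N * (t / 2) ≤ N * (μ / 2) := by gcongr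
    linarith
  have h4 : (∑ T ∈ G, Z T) ^ 2 ≤ G.card * (3 * N * μ ^ 2) := by
    refine (sq_sum_le_card_mul_sum_sq (s := G) (f := Z)).trans ?_
    refine mul_le_mul_of_nonneg_left (le_trans ?_ h2) (Nat.cast_nonneg _)
    exact Finset.sum_le_sum_of_subset_of_nonneg (Finset.filter_subset _ _)
      fun _ _ _ => sq_nonneg _
  have h5 : (N * μ / 2) ^ 2 ≤ G.card * (3 * N * μ ^ 2) :=
    (pow_le_pow_left₀ (by positivity) h3 2).trans h4
  have h6 : (N * μ ^ 2) * N ≤ (N * μ ^ 2) * (12 * G.card) := by nlinarith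
  exact le_of_mul_le_mul_left h6 (by positivity)

end Signs

variable {ι : Type*} [Fintype ι] [DecidableEq ι]

/-- The sum of the squares of the entries. -/
def frobSq {ι : Type*} [Fintype ι] (X : Matrix ι ι ℝ) : ℝ := ∑ i, ∑ j, X i j ^ 2

theorem frobSq_nonneg {ι : Type*} [Fintype ι] (X : Matrix ι ι ℝ) : 0 ≤ frobSq X :=
  Finset.sum_nonneg fun _ _ => Finset.sum_nonneg fun _ _ => sq_nonneg _

/-- Wegner-type estimate at the optimal scale: the Frobenius norm of the inverse of a symmetric
Gaussian matrix with an arbitrary shift has a weak `L¹` tail. -/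
theorem lintegral_inv_frobSq_le (S : Sym2 ι → ℝ) {β t : ℝ} (hβ : 0 < β) (ht : 0 < t) :
    ∫⁻ x, {x : Sym2 ι → ℝ | t ^ 2 < frobSq (symMat x)⁻¹}.indicator (gaussWeight β S) x ≤
      ENNReal.ofReal (48 * Real.exp 4 * (Real.sqrt (β * Fintype.card ι) / t)) *
        ∫⁻ x, gaussWeight β S x := by
  rcases isEmpty_or_nonempty ι with hι | hι
  · have : {x : Sym2 ι → ℝ | t ^ 2 < frobSq (symMat x)⁻¹} = ∅ := by
      ext x
      have : ¬ t ^ 2 < 0 := by nlinarith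
      simpa [frobSq] using this
    rw [this]; simp
  set m : ℝ := (Fintype.card ι : ℝ)
  have hm : 0 < m := by simp only [m]; exact_mod_cast Fintype.card_pos
  set P := (Finset.univ : Finset ι).powerset
  -- Unit vectors with entries `± 1 / √m`. If `frobSq X > t ^ 2`, at least one in twelve satisfies
  -- `|X u|² > t ^ 2 / (2 m) = t' ^ 2`. The indicator is thus at most twelve times the average of
  -- the single vector indicators, and no union bound is needed.
  set u : Finset ι → ι → ℝ := fun T i => (Real.sqrt m)⁻¹ * (if i ∈ T then (1 : ℝ) else -1)
  have hsm : (Real.sqrt m)⁻¹ * (Real.sqrt m)⁻¹ = m⁻¹ := by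
    rw [← mul_inv, Real.mul_self_sqrt hm.le]
  have hu : ∀ T, u T ⬝ᵥ u T = 1 := by
    intro T
    have : ∀ i, u T i * u T i = m⁻¹ := by
      intro i
      simp only [u]
      split_ifs <;> linarith
    simp only [dotProduct, this, Finset.sum_const, nsmul_eq_mul, Finset.card_univ]
    exact mul_inv_cancel₀ hm.ne'
  set t' := t / Real.sqrt (2 * m)
  have ht' : 0 < t' := by positivity
  have ht2 : t' ^ 2 = t ^ 2 / 2 * m⁻¹ := by
    simp only [t']
    rw [div_pow, Real.sq_sqrt (by positivity)]
    field_simp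
  set N : ℝ := 2 ^ Fintype.card ι
  have hN : 0 < N := by positivity
  have hpt : ∀ x : Sym2 ι → ℝ,
      {x : Sym2 ι → ℝ | t ^ 2 < frobSq (symMat x)⁻¹}.indicator (gaussWeight β S) x ≤
      ENNReal.ofReal (12 / N) * ∑ T ∈ P, {x : Sym2 ι → ℝ | t' ^ 2 <
        ((symMat x)⁻¹ *ᵥ u T) ⬝ᵥ ((symMat x)⁻¹ *ᵥ u T)}.indicator (gaussWeight β S) x := by
    intro x
    refine Set.indicator_apply_le' (fun hx => ?_) (fun _ => zero_le)
    set X := (symMat x)⁻¹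
    have hx : t ^ 2 < ∑ i, (fun i k => X k i) i ⬝ᵥ (fun i k => X k i) i := by
      have : ∑ i, (fun i k => X k i) i ⬝ᵥ (fun i k => X k i) i = frobSq X := by
        rw [frobSq, Finset.sum_comm]
        simp [dotProduct, sq]
      rw [this]; exact hx
    have hc := card_signedSum_large (fun i k => X k i) (sq_nonneg t) hx
    have hvec : ∀ T, X *ᵥ u T = (Real.sqrt m)⁻¹ • signedSum (fun i k => X k i) Finset.univ T := by
      intro T
      funext k
      simp only [Matrix.mulVec, dotProduct, u, signedSum, Pi.smul_apply, Finset.sum_apply,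
        smul_eq_mul, Finset.mul_sum]
      exact Finset.sum_congr rfl fun i _ => by ring
    have hind : ∀ T, {x : Sym2 ι → ℝ | t' ^ 2 <
        ((symMat x)⁻¹ *ᵥ u T) ⬝ᵥ ((symMat x)⁻¹ *ᵥ u T)}.indicator (gaussWeight β S) x
        = if t ^ 2 / 2 < signedSum (fun i k => X k i) Finset.univ T ⬝ᵥ
          signedSum (fun i k => X k i) Finset.univ T then gaussWeight β S x else 0 := by
      intro T
      rw [Set.indicator_apply]
      refine if_congr ?_ rfl rfl
      change t' ^ 2 < (X *ᵥ u T) ⬝ᵥ (X *ᵥ u T) ↔ _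
      rw [hvec, smul_dotProduct, dotProduct_smul, smul_eq_mul, smul_eq_mul, ← mul_assoc, hsm, ht2,
        mul_comm m⁻¹]
      exact mul_lt_mul_iff_left₀ (inv_pos.mpr hm)
    simp_rw [hind]
    rw [← Finset.sum_filter, Finset.sum_const, nsmul_eq_mul, ← mul_assoc]
    refine le_mul_of_one_le_left zero_le ?_
    rw [← ENNReal.ofReal_natCast, ← ENNReal.ofReal_mul (by positivity), ENNReal.one_le_ofReal,
      div_mul_eq_mul_div, le_div_iff₀ hN, one_mul]
    exact hc
  calc _ ≤ ∫⁻ x, ENNReal.ofReal (12 / N) * ∑ T ∈ P, {x : Sym2 ι → ℝ | t' ^ 2 <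
        ((symMat x)⁻¹ *ᵥ u T) ⬝ᵥ ((symMat x)⁻¹ *ᵥ u T)}.indicator (gaussWeight β S) x :=
        lintegral_mono hpt
    _ = ENNReal.ofReal (12 / N) * ∑ T ∈ P, ∫⁻ x, {x : Sym2 ι → ℝ | t' ^ 2 <
        ((symMat x)⁻¹ *ᵥ u T) ⬝ᵥ ((symMat x)⁻¹ *ᵥ u T)}.indicator (gaussWeight β S) x := by
        rw [lintegral_const_mul' _ _ ENNReal.ofReal_ne_top, lintegral_finsetSum]
        exact fun T _ => (measurable_gaussWeight β S).indicator (measurableSet_inv_mulVec _ _)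
    _ ≤ ENNReal.ofReal (12 / N) * ∑ T ∈ P,
          ENNReal.ofReal (2 * Real.exp 4 * (Real.sqrt (2 * β) / t')) * ∫⁻ x, gaussWeight β S x := by
        gcongr with T _
        exact lintegral_inv_mulVec_le S hβ ht' (u T) (hu T)
    _ = _ := by
        rw [Finset.sum_const, nsmul_eq_mul, Finset.card_powerset, Finset.card_univ, ← mul_assoc,
          ← mul_assoc, ← ENNReal.ofReal_natCast, ← ENNReal.ofReal_mul (by positivity),
          ← ENNReal.ofReal_mul (by positivity)]
        congr 2
        have e : Real.sqrt (2 * β) * Real.sqrt (2 * m) = 2 * Real.sqrt (β * m) := by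
          rw [← Real.sqrt_mul (by positivity), show 2 * β * (2 * m) = 2 ^ 2 * (β * m) by ring,
            Real.sqrt_mul (by positivity), Real.sqrt_sq (by norm_num)]
        have hNc : ((2 ^ Fintype.card ι : ℕ) : ℝ) = N := by simp [N]
        rw [hNc, div_mul_cancel₀ _ hN.ne']
        simp only [t']
        rw [div_div_eq_mul_div, e]
        ring

/-! ### Few small eigenvalues, via the regularised inverse square -/

section Regularised

variable {ι κ : Type*} [Fintype ι] [DecidableEq ι] [Fintype κ] [DecidableEq κ]

/-- The regularised inverse square `(D² + η²)⁻¹`. -/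
noncomputable def regInv (η : ℝ) (D : Matrix ι ι ℝ) : Matrix ι ι ℝ := (D * D + η ^ 2 • 1)⁻¹

theorem posDef_sq_add {η : ℝ} (hη : 0 < η) {D : Matrix ι ι ℝ} (hD : Dᵀ = D) :
    (D * D + η ^ 2 • (1 : Matrix ι ι ℝ)).PosDef := by
  have h1 : (D * D).PosSemidef := by
    have := Matrix.posSemidef_conjTranspose_mul_self D
    rwa [Matrix.conjTranspose_eq_transpose_of_trivial, hD] at this
  exact Matrix.PosDef.posSemidef_add h1 (Matrix.PosDef.one.smul (by positivity))

theorem regInv_mul_cancel {η : ℝ} (hη : 0 < η) {D : Matrix ι ι ℝ} (hD : Dᵀ = D) (x : ι → ℝ) :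
    D *ᵥ (D *ᵥ (regInv η D *ᵥ x)) + η ^ 2 • (regInv η D *ᵥ x) = x := by
  have hu := (posDef_sq_add hη hD).isUnit.map Matrix.detMonoidHom
  have : (D * D + η ^ 2 • (1 : Matrix ι ι ℝ)) *ᵥ (regInv η D *ᵥ x) = x := by
    rw [regInv, Matrix.mulVec_mulVec, Matrix.mul_nonsing_inv _ hu, Matrix.one_mulVec]
  rw [Matrix.add_mulVec, ← Matrix.mulVec_mulVec, Matrix.smul_mulVec, Matrix.one_mulVec] at this
  exact this

theorem regInv_posSemidef {η : ℝ} (hη : 0 < η) {D : Matrix ι ι ℝ} (hD : Dᵀ = D) :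
    (regInv η D).PosSemidef := (posDef_sq_add hη hD).inv.posSemidef

theorem dotProduct_mulVec_symm {ι : Type*} [Fintype ι] {D : Matrix ι ι ℝ} (hD : Dᵀ = D)
    (x y : ι → ℝ) :
    x ⬝ᵥ D *ᵥ y = (D *ᵥ x) ⬝ᵥ y := by
  rw [Matrix.dotProduct_mulVec, ← Matrix.mulVec_transpose, hD]

theorem regInv_quad {η : ℝ} (hη : 0 < η) {D : Matrix ι ι ℝ} (hD : Dᵀ = D) (x : ι → ℝ) :
    x ⬝ᵥ regInv η D *ᵥ x = (D *ᵥ (regInv η D *ᵥ x)) ⬝ᵥ (D *ᵥ (regInv η D *ᵥ x))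
      + η ^ 2 * ((regInv η D *ᵥ x) ⬝ᵥ (regInv η D *ᵥ x)) := by
  have h := regInv_mul_cancel hη hD x
  set w := regInv η D *ᵥ x
  rw [← h, add_dotProduct, smul_dotProduct, smul_eq_mul, ← dotProduct_mulVec_symm hD]

/-- Duality for ridge regression: the left side is the minimum over `x` of the right side. The proof
adds the squares of `v + D x - η² a` and, with weight `η²`, of `x + D a`, where `a = (D² + η²)⁻¹ v`.
-/
theorem regInv_quad_le {η : ℝ} (hη : 0 < η) {D : Matrix ι ι ℝ} (hD : Dᵀ = D) (v x : ι → ℝ) :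
    η ^ 2 * (v ⬝ᵥ regInv η D *ᵥ v) ≤ (v + D *ᵥ x) ⬝ᵥ (v + D *ᵥ x) + η ^ 2 * (x ⬝ᵥ x) := by
  have h := regInv_quad hη hD v
  set a := regInv η D *ᵥ v
  have e1 : v ⬝ᵥ a = (v + D *ᵥ x) ⬝ᵥ a - x ⬝ᵥ D *ᵥ a := by
    rw [add_dotProduct, dotProduct_mulVec_symm hD]; ring
  have h1 := dotProduct_self_nonneg' ((v + D *ᵥ x) - η ^ 2 • a)
  have h2 := dotProduct_self_nonneg' (x + D *ᵥ a)
  set r := v + D *ᵥ x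
  simp only [sub_dotProduct, dotProduct_sub, add_dotProduct, dotProduct_add, smul_dotProduct,
    dotProduct_smul, smul_eq_mul, dotProduct_comm a r, dotProduct_comm (D *ᵥ a) x] at h1 h2
  have h3 := mul_nonneg (sq_nonneg η) h2
  nlinarith

/-- The quadratic form of an inverse is the supremum over `y` of the left side, the maximiser being
`a = (D² + η²)⁻¹ x`; the defect is the form `D² + η²` at `y - a`. -/
theorem regInv_variational {η : ℝ} (hη : 0 < η) {D : Matrix ι ι ℝ} (hD : Dᵀ = D) (x y : ι → ℝ) :
    2 * (x ⬝ᵥ y) - ((D *ᵥ y) ⬝ᵥ (D *ᵥ y) + η ^ 2 * (y ⬝ᵥ y)) ≤ x ⬝ᵥ regInv η D *ᵥ x := by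
  have h := regInv_quad hη hD x
  have hc := congrArg (fun u => u ⬝ᵥ y) (regInv_mul_cancel hη hD x)
  set a := regInv η D *ᵥ x
  simp only [add_dotProduct, smul_dotProduct, smul_eq_mul] at hc
  rw [← dotProduct_mulVec_symm hD] at hc
  have h1 := dotProduct_self_nonneg' (D *ᵥ y - D *ᵥ a)
  have h2 := mul_nonneg (sq_nonneg η) (dotProduct_self_nonneg' (y - a))
  simp only [sub_dotProduct, dotProduct_sub, dotProduct_comm (D *ᵥ y) (D *ᵥ a),
    dotProduct_comm y a] at h1 h2
  nlinarith

theorem dotProduct_option {κ : Type*} [Fintype κ] (f g : Option κ → ℝ) :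
    f ⬝ᵥ g = f none * g none + (fun i => f (some i)) ⬝ᵥ (fun i => g (some i)) := by
  simp [dotProduct, Fintype.sum_option]

theorem symMat_border_mulVec' {κ : Type*} [Fintype κ] (d : ℝ) (v : κ → ℝ) (z : Sym2 κ → ℝ)
    (w : Option κ → ℝ) :
    symMat (border d v z) *ᵥ w = fun o => o.elim (d * w none + v ⬝ᵥ (fun i => w (some i)))
      (w none • v + symMat z *ᵥ (fun i => w (some i))) := by
  rw [← symMat_border_mulVec]
  congr 1
  funext o
  rcases o with _ | i <;> rfl

/-- With `w` the column at `none` and `p` its entry there, `p = |D w|² + η² |w|²`. The lower part of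
this sum is the ridge functional of the minor at `p v`, so it is at least `η² p²` times the
quadratic form in `v`. Large values of that form, which does not involve `d`, force `p` to be small.
-/
theorem regInv_border_none_le {η : ℝ} (hη : 0 < η) (d : ℝ) (v : κ → ℝ) (z : Sym2 κ → ℝ) :
    regInv η (symMat (border d v z)) none none *
      (η ^ 2 * (1 + v ⬝ᵥ regInv η (symMat z) *ᵥ v)) ≤ 1 := by
  have hq := regInv_quad hη (symMat_transpose (border d v z)) (Pi.single none 1)
  have hW := (regInv_posSemidef hη (symMat_transpose (border d v z))).diag_nonneg (i := none)
  set W := regInv η (symMat (border d v z))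
  set w := W *ᵥ Pi.single none 1
  have hwn : w none = W none none := by simp [w]
  rw [symMat_border_mulVec', dotProduct_option, dotProduct_option, dotProduct_option w w,
    hwn] at hq
  simp only [Pi.single_eq_same, Option.elim] at hq
  have hz : (fun i : κ => (Pi.single none 1 : Option κ → ℝ) (some i)) = 0 := by
    funext i; simp
  rw [hz, zero_dotProduct] at hq
  have hle := regInv_quad_le hη (symMat_transpose z) (W none none • v) (fun i => w (some i))
  rw [Matrix.mulVec_smul, smul_dotProduct, dotProduct_smul, smul_eq_mul, smul_eq_mul] at hle
  have hsq := mul_self_nonneg (d * W none none + v ⬝ᵥ fun i => w (some i))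
  set p := W none none
  set X := v ⬝ᵥ regInv η (symMat z) *ᵥ v
  have hfin : p * (p * (η ^ 2 * (1 + X))) ≤ p * 1 := by
    have e : (fun i => ((p • v + symMat z *ᵥ fun i => w (some i)) i)) =
      (p • v + symMat z *ᵥ fun i => w (some i)) := rfl
    nlinarith
  rcases hW.lt_or_eq with h | h
  · exact le_of_mul_le_mul_left hfin h
  · have : p = 0 := h.symm
    rw [this]; norm_num

/-- A one-sided interlacing bound. Eliminating `none` from the inverse leaves diagonal entries
bounded by those of the minor, and what is removed sums to `|W e|² / W_{none,none} ≤ 1 / η²`, where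
`e` is the basis vector at `none`. -/
theorem trace_regInv_border_le {η : ℝ} (hη : 0 < η) (d : ℝ) (v : κ → ℝ) (z : Sym2 κ → ℝ) :
    (regInv η (symMat (border d v z))).trace ≤ (regInv η (symMat z)).trace + 1 / η ^ 2 := by
  have hD := symMat_transpose (border d v z)
  have hpd : (regInv η (symMat (border d v z))).PosDef := (posDef_sq_add hη hD).inv
  have hpos : 0 < regInv η (symMat (border d v z)) none none := hpd.diag_pos
  have hsymm : ∀ a b, regInv η (symMat (border d v z)) a b =
      regInv η (symMat (border d v z)) b a := fun a b => by
    have := hpd.isHermitian.apply b a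
    simpa using this
  have hquad := fun x => regInv_quad hη hD x
  set W := regInv η (symMat (border d v z))
  have hdiag : ∀ i : κ, W (some i) (some i) - W none (some i) ^ 2 / W none none ≤
      regInv η (symMat z) i i := by
    intro i
    -- This makes the `none` entry of `y` vanish, so that `y` is an admissible test vector for the
    -- minor.
    set c := W none (some i) / W none none
    set y : Option κ → ℝ := W *ᵥ Pi.single (some i) 1 - c • (W *ᵥ Pi.single none 1)
    have hyv : ∀ o, y o = W o (some i) - c * W o none := fun o => by simp [y]
    have hy0 : y none = 0 := by
      rw [hyv]; simp only [c]; field_simp; ring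
    have hyW : y = W *ᵥ (Pi.single (some i) 1 - c • Pi.single none 1) := by
      simp only [y, Matrix.mulVec_sub, Matrix.mulVec_smul]
    have hval : y (some i) = W (some i) (some i) - W none (some i) ^ 2 / W none none := by
      rw [hyv, hsymm (some i) none]; simp only [c]; ring
    have hq := hquad (Pi.single (some i) 1 - c • Pi.single none 1)
    rw [← hyW, sub_dotProduct, smul_dotProduct, single_dotProduct, single_dotProduct, hy0,
      symMat_border_mulVec', dotProduct_option, dotProduct_option y y, hy0] at hq
    simp only [Option.elim, zero_smul, zero_add, mul_zero, one_mul, smul_zero, sub_zero] at hq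
    have hv := regInv_variational hη (symMat_transpose z) (Pi.single i 1) (fun k => y (some k))
    rw [single_dotProduct, single_dotProduct, Matrix.mulVec_single_one, Matrix.col_apply, one_mul,
      one_mul] at hv
    have := mul_self_nonneg (v ⬝ᵥ fun k => y (some k))
    rw [← hval]
    have e : (fun k => (symMat z *ᵥ fun k => y (some k)) k) = symMat z *ᵥ fun k => y (some k) := rfl
    rw [e] at hq
    linarith
  have hnone := hquad (Pi.single none 1)
  have h0 := dotProduct_self_nonneg' (symMat (border d v z) *ᵥ (W *ᵥ Pi.single none 1))
  rw [single_dotProduct, one_mul, Matrix.mulVec_single_one, Matrix.col_apply] at hnone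
  rw [Matrix.mulVec_single_one] at h0
  rw [dotProduct_option (W.col none) (W.col none)] at hnone
  simp only [Matrix.col_apply] at hnone
  have hs : (fun i : κ => W (some i) none) ⬝ᵥ (fun i : κ => W (some i) none)
      = ∑ i : κ, W none (some i) ^ 2 := by
    simp [dotProduct, sq, hsymm none]
  rw [hs] at hnone
  set ρ := ∑ i : κ, W none (some i) ^ 2
  have hT : W.trace = W none none + ∑ i : κ, W (some i) (some i) := by
    simp [Matrix.trace, Fintype.sum_option]
  have hT' : (regInv η (symMat z)).trace = ∑ i : κ, regInv η (symMat z) i i := rfl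
  have hsum := Finset.sum_le_sum fun i (_ : i ∈ Finset.univ) => hdiag i
  rw [Finset.sum_sub_distrib, ← Finset.sum_div] at hsum
  have hfin : W none none + ρ / W none none ≤ 1 / η ^ 2 := by
    rw [le_div_iff₀ (by positivity), ← mul_le_mul_iff_left₀ hpos]
    have : (W none none + ρ / W none none) * η ^ 2 * W none none
        = η ^ 2 * (W none none * W none none + ρ) := by
      field_simp
    rw [this]; linarith
  rw [hT, hT']
  linarith

theorem measurable_regInv_apply (η : ℝ) (i j : ι) :
    Measurable fun x : Sym2 ι → ℝ => regInv η (symMat x) i j := by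
  refine measurable_inv_apply (fun k l => ?_) i j
  simp only [Matrix.add_apply, Matrix.mul_apply, symMat_apply]
  fun_prop

theorem measurable_trace_regInv (η : ℝ) :
    Measurable fun x : Sym2 ι → ℝ => (regInv η (symMat x)).trace := by
  simp only [Matrix.trace, Matrix.diag_apply]
  exact Finset.measurable_sum _ fun i _ => measurable_regInv_apply η i i

end Regularised

section

variable {κ : Type*} [Fintype κ] [DecidableEq κ]

theorem sum_sq_border {κ : Type*} [Fintype κ] (S : Sym2 (Option κ) → ℝ) (d : ℝ) (v : κ → ℝ)
    (z : Sym2 κ → ℝ) :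
    ∑ i, ∑ j, (border d v z s(i, j) - S s(i, j)) ^ 2 =
      (d - S s(none, none)) ^ 2 + 2 * ∑ i, (v i - S s(none, some i)) ^ 2 +
        ∑ i, ∑ j, (z s(i, j) - S s(some i, some j)) ^ 2 := by
  simp only [Fintype.sum_option, border_none_none, border_none_some,
    border_some_some, Finset.sum_add_distrib, Sym2.eq_swap (a := some _) (b := none)]
  ring

/-- Small ball estimate for a quadratic form in the first row of a symmetric Gaussian matrix. -/
theorem lintegral_small_ball_row_le (S : Sym2 (Option κ) → ℝ) {β b : ℝ} (hβ : 0 < β) (hb : 0 < b)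
    (z : Sym2 κ → ℝ) (W : Matrix κ κ ℝ) (hW : W.PosSemidef) :
    ∫⁻ v : κ → ℝ, ∫⁻ d : ℝ, {v : κ → ℝ | v ⬝ᵥ W *ᵥ v ≤ b}.indicator 1 v *
        gaussWeight β S (border d v z) ≤
      ENNReal.ofReal (Real.exp 1 * (1 + W.trace / (2 * β * b)) ^ (-(1 / 2) : ℝ)) *
        ∫⁻ v : κ → ℝ, ∫⁻ d : ℝ, gaussWeight β S (border d v z) := by
  set c : ENNReal := ∫⁻ d : ℝ, ENNReal.ofReal (Real.exp (-β * ((d - S s(none, none)) ^ 2 +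
    ∑ i, ∑ j, (z s(i, j) - S s(some i, some j)) ^ 2)))
  have hint : ∀ v : κ → ℝ, ∫⁻ d : ℝ, gaussWeight β S (border d v z) =
      c * ENNReal.ofReal (Real.exp (-(2 * β) * ∑ i, (v i - S s(none, some i)) ^ 2)) := by
    intro v
    rw [← lintegral_mul_const' _ _ ENNReal.ofReal_ne_top]
    refine lintegral_congr fun d => ?_
    rw [gaussWeight, sum_sq_border, ← ENNReal.ofReal_mul (Real.exp_nonneg _), ← Real.exp_add]
    congr 2; ring
  have hind : ∀ v : κ → ℝ, ({v : κ → ℝ | v ⬝ᵥ W *ᵥ v ≤ b}.indicator 1 v : ENNReal) ≠ ⊤ := by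
    intro v
    rw [Set.indicator_apply]
    split_ifs <;> simp
  simp_rw [lintegral_const_mul' _ _ (hind _), hint]
  -- The rate doubles because each entry of the first row also occurs in the first column.
  have h := lintegral_small_ball_le W hW (γ := 2 * β) (by positivity) hb
    (fun i => S s(none, some i))
  have hq : Measurable fun v : κ → ℝ => v ⬝ᵥ W *ᵥ v :=
    measurable_dotProduct (fun j => measurable_pi_apply j)
      (measurable_mulVec (fun _ _ => measurable_const) fun j => measurable_pi_apply j)
  have hms : MeasurableSet {v : κ → ℝ | v ⬝ᵥ W *ᵥ v ≤ b} := measurableSet_le hq measurable_const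
  have hgm : Measurable fun v : κ → ℝ => ENNReal.ofReal (Real.exp (-(2 * β) *
    ∑ i, (v i - S s(none, some i)) ^ 2)) := by fun_prop
  calc ∫⁻ v : κ → ℝ, {v : κ → ℝ | v ⬝ᵥ W *ᵥ v ≤ b}.indicator 1 v * (c * ENNReal.ofReal
          (Real.exp (-(2 * β) * ∑ i, (v i - S s(none, some i)) ^ 2)))
      = c * ∫⁻ v : κ → ℝ, {v : κ → ℝ | v ⬝ᵥ W *ᵥ v ≤ b}.indicator (fun v => ENNReal.ofReal
          (Real.exp (-(2 * β) * ∑ i, (v i - S s(none, some i)) ^ 2))) v := by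
        rw [← lintegral_const_mul _ (hgm.indicator hms)]
        refine lintegral_congr fun v => ?_
        simp only [Set.indicator_apply, Pi.one_apply]
        split_ifs <;> simp
    _ ≤ c * (ENNReal.ofReal (Real.exp 1 * (1 + W.trace / (2 * β * b)) ^ (-(1 / 2) : ℝ)) *
          ∫⁻ v : κ → ℝ, ENNReal.ofReal (Real.exp (-(2 * β) *
            ∑ i, (v i - S s(none, some i)) ^ 2))) := mul_le_mul_right h _
    _ = _ := by rw [lintegral_const_mul _ hgm, mul_left_comm]

/-- If the full trace exceeds `K`, the trace of the minor exceeds `K - 1 / η²`, a condition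
independent of the first row. The row then makes its quadratic form exceed `b` except on a small
ball, and the entry at `none` is at most `1 / η²` on that ball and `1 / (η² b)` off it. -/
theorem lintegral_regInv_none_le (S : Sym2 (Option κ) → ℝ) {β η K b : ℝ} (hβ : 0 < β) (hη : 0 < η)
    (hb : 0 < b) (hK : 1 / η ^ 2 ≤ K) :
    ∫⁻ x, {x : Sym2 (Option κ) → ℝ | K < (regInv η (symMat x)).trace}.indicator
        (fun x => ENNReal.ofReal (regInv η (symMat x) none none) * gaussWeight β S x) x ≤
      ENNReal.ofReal (1 / η ^ 2 * (Real.exp 1 *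
        (1 + (K - 1 / η ^ 2) / (2 * β * b)) ^ (-(1 / 2) : ℝ) + 1 / b)) *
          ∫⁻ x, gaussWeight β S x := by
  have hgm := measurable_gaussWeight β S
  have hmeas : Measurable ({x : Sym2 (Option κ) → ℝ | K < (regInv η (symMat x)).trace}.indicator
      (fun x => ENNReal.ofReal (regInv η (symMat x) none none) * gaussWeight β S x)) :=
    (((measurable_regInv_apply η none none).ennreal_ofReal).mul hgm).indicator
      (measurableSet_lt measurable_const (measurable_trace_regInv η))
  rw [lintegral_sym2_option hmeas, lintegral_sym2_option hgm,
    ← lintegral_const_mul' _ _ ENNReal.ofReal_ne_top]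
  refine lintegral_mono fun z => ?_
  dsimp only
  set W := regInv η (symMat z)
  have hW : W.PosSemidef := regInv_posSemidef hη (symMat_transpose z)
  have hη2 : 0 < η ^ 2 := by positivity
  by_cases hz : K - 1 / η ^ 2 < W.trace
  swap
  · have h0 : ∀ v d, {x : Sym2 (Option κ) → ℝ | K < (regInv η (symMat x)).trace}.indicator
        (fun x => ENNReal.ofReal (regInv η (symMat x) none none) * gaussWeight β S x)
        (border d v z) = 0 := by
      intro v d
      refine Set.indicator_of_notMem ?_ _
      have := trace_regInv_border_le hη d v z
      simp only [Set.mem_ofPred_eq, not_lt]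
      push Not at hz
      linarith
    simp [h0]
  have hW0 : ∀ v d, regInv η (symMat (border d v z)) none none ≤
      1 / η ^ 2 * (if v ⬝ᵥ W *ᵥ v ≤ b then 1 else 0) + 1 / η ^ 2 * (1 / b) := by
    intro v d
    have h := regInv_border_none_le hη d v z
    have hnn : 0 ≤ v ⬝ᵥ W *ᵥ v := by simpa using hW.dotProduct_mulVec_nonneg v
    have h2 : regInv η (symMat (border d v z)) none none ≤
        1 / (η ^ 2 * (1 + v ⬝ᵥ W *ᵥ v)) := by
      rwa [le_div_iff₀ (by positivity)]
    refine h2.trans ?_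
    split_ifs with hv
    · have : 1 / (η ^ 2 * (1 + v ⬝ᵥ W *ᵥ v)) ≤ 1 / η ^ 2 := by
        gcongr; nlinarith
      have : 0 ≤ 1 / η ^ 2 * (1 / b) := by positivity
      linarith
    · push Not at hv
      rw [mul_zero, zero_add, one_div_mul_one_div]
      gcongr
      linarith
  have hsb := lintegral_small_ball_row_le S hβ hb z W hW
  have hmb : ∀ v : κ → ℝ, Measurable fun d : ℝ => gaussWeight β S (border d v z) := fun v =>
    measurable_comp_border hgm measurable_id measurable_const measurable_const
  have hmb2 : Measurable fun v : κ → ℝ => ∫⁻ d : ℝ, gaussWeight β S (border d v z) :=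
    Measurable.lintegral_prod_right' (f := fun p : (κ → ℝ) × ℝ => gaussWeight β S (border p.2 p.1 z))
      (measurable_comp_border hgm measurable_snd measurable_fst measurable_const)
  set I := ∫⁻ v : κ → ℝ, ∫⁻ d : ℝ, gaussWeight β S (border d v z)
  calc _ ≤ ∫⁻ v : κ → ℝ, ∫⁻ d : ℝ, (ENNReal.ofReal (1 / η ^ 2) *
          ({v : κ → ℝ | v ⬝ᵥ W *ᵥ v ≤ b}.indicator 1 v * gaussWeight β S (border d v z)) +
          ENNReal.ofReal (1 / η ^ 2 * (1 / b)) * gaussWeight β S (border d v z)) := by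
        refine lintegral_mono fun v => lintegral_mono fun d => ?_
        refine Set.indicator_apply_le' (fun _ => ?_) (fun _ => zero_le)
        rw [← mul_assoc, ← add_mul]
        refine mul_le_mul_left ((ENNReal.ofReal_le_ofReal (hW0 v d)).trans ?_) _
        rw [ENNReal.ofReal_add (by positivity) (by positivity), ENNReal.ofReal_mul (by positivity)]
        refine add_le_add_left (le_of_eq ?_) _
        congr 1
        simp only [Set.indicator_apply, Set.mem_ofPred_eq, Pi.one_apply]
        split_ifs <;> simp
    _ = ENNReal.ofReal (1 / η ^ 2) * (∫⁻ v : κ → ℝ, ∫⁻ d : ℝ,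
          {v : κ → ℝ | v ⬝ᵥ W *ᵥ v ≤ b}.indicator 1 v * gaussWeight β S (border d v z)) +
          ENNReal.ofReal (1 / η ^ 2 * (1 / b)) * I := by
        rw [← lintegral_const_mul' _ _ ENNReal.ofReal_ne_top,
          ← lintegral_const_mul' _ _ ENNReal.ofReal_ne_top, ← lintegral_add_right _
            (hmb2.const_mul _)]
        refine lintegral_congr fun v => ?_
        rw [lintegral_add_right _ ((hmb v).const_mul _), lintegral_const_mul' _ _ ENNReal.ofReal_ne_top,
          lintegral_const_mul' _ _ ENNReal.ofReal_ne_top]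
    _ ≤ ENNReal.ofReal (1 / η ^ 2) * (ENNReal.ofReal (Real.exp 1 *
          (1 + W.trace / (2 * β * b)) ^ (-(1 / 2) : ℝ)) * I) +
          ENNReal.ofReal (1 / η ^ 2 * (1 / b)) * I := by gcongr
    _ = ENNReal.ofReal (1 / η ^ 2 * (Real.exp 1 *
        (1 + W.trace / (2 * β * b)) ^ (-(1 / 2) : ℝ) + 1 / b)) * I := by
        have hp : 0 ≤ Real.exp 1 * (1 + W.trace / (2 * β * b)) ^ (-(1 / 2) : ℝ) := by
          have : 0 ≤ W.trace / (2 * β * b) := div_nonneg hW.trace_nonneg (by positivity)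
          exact mul_nonneg (Real.exp_nonneg _) (Real.rpow_nonneg (by linarith) _)
        rw [← mul_assoc, ← ENNReal.ofReal_mul (by positivity), ← add_mul,
          ← ENNReal.ofReal_add (by positivity) (by positivity), ← mul_add]
    _ ≤ _ := by
        refine mul_le_mul_left (ENNReal.ofReal_le_ofReal ?_) _
        refine mul_le_mul_of_nonneg_left (add_le_add_left ?_ _) (by positivity)
        refine mul_le_mul_of_nonneg_left ?_ (Real.exp_nonneg _)
        have h1 : 0 ≤ (K - 1 / η ^ 2) / (2 * β * b) := div_nonneg (by linarith) (by positivity)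
        refine Real.rpow_le_rpow_of_nonpos (by linarith) ?_ (by norm_num)
        gcongr

end

variable {ι : Type*} [Fintype ι] [DecidableEq ι]

theorem regInv_orthogonal_conj {κ : Type*} [Fintype κ] [DecidableEq κ] (η : ℝ) (O : Matrix ι κ ℝ)
    (h1 : O * Oᵀ = 1) (h2 : Oᵀ * O = 1) (X : Matrix κ κ ℝ) :
    regInv η (O * X * Oᵀ) = O * regInv η X * Oᵀ := by
  rw [regInv, regInv, ← inv_orthogonal_conj O h1 h2]
  congr 1
  have : O * X * Oᵀ * (O * X * Oᵀ) = O * (X * (Oᵀ * O) * X) * Oᵀ := by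
    simp only [Matrix.mul_assoc]
  rw [this, h2, Matrix.mul_one, Matrix.mul_add, Matrix.add_mul, Matrix.mul_smul, Matrix.smul_mul,
    Matrix.mul_one, h1]

/-- An orthogonal change of basis moves the index `j` to `none` and preserves the trace. -/
theorem lintegral_regInv_diag_le (S : Sym2 ι → ℝ) {β η K b : ℝ} (hβ : 0 < β) (hη : 0 < η)
    (hb : 0 < b) (hK : 1 / η ^ 2 ≤ K) (j : ι) :
    ∫⁻ x, {x : Sym2 ι → ℝ | K < (regInv η (symMat x)).trace}.indicator
        (fun x => ENNReal.ofReal (regInv η (symMat x) j j) * gaussWeight β S x) x ≤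
      ENNReal.ofReal (1 / η ^ 2 * (Real.exp 1 *
        (1 + (K - 1 / η ^ 2) / (2 * β * b)) ^ (-(1 / 2) : ℝ) + 1 / b)) *
          ∫⁻ x, gaussWeight β S x := by
  obtain ⟨O, h1, h2, hO⟩ := exists_orthogonal_col j (Pi.single j 1) (by simp)
  have hu : Oᵀ *ᵥ Pi.single j 1 = Pi.single none 1 := by
    have : Pi.single j 1 = O *ᵥ Pi.single none 1 := by
      funext i; rw [Matrix.mulVec_single_one, Matrix.col_apply, hO]
    rw [this, Matrix.mulVec_mulVec, h2, Matrix.one_mulVec]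
  have hgm := measurable_gaussWeight β S
  rw [← lintegral_const_mul' _ _ ENNReal.ofReal_ne_top]
  refine lintegral_le_of_linearEquiv (orthConj O h1 h2)
    ((((measurable_regInv_apply η j j).ennreal_ofReal).mul hgm).indicator
      (measurableSet_lt measurable_const (measurable_trace_regInv η))) (hgm.const_mul _) ?_
  simp only [gaussWeight_orthConj]
  rw [lintegral_const_mul' _ _ ENNReal.ofReal_ne_top]
  refine le_trans (le_of_eq ?_) (lintegral_regInv_none_le _ hβ hη hb hK)
  refine lintegral_congr fun x => ?_
  have htr : (O * regInv η (symMat x) * Oᵀ).trace = (regInv η (symMat x)).trace := by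
    rw [Matrix.trace_mul_comm, ← Matrix.mul_assoc, h2, Matrix.one_mul]
  have hjj : (O * regInv η (symMat x) * Oᵀ) j j = regInv η (symMat x) none none := by
    have e1 : (O * regInv η (symMat x) * Oᵀ) j j = Pi.single j 1 ⬝ᵥ
        (O * regInv η (symMat x) * Oᵀ) *ᵥ Pi.single j 1 := by simp
    have e2 : regInv η (symMat x) none none = Pi.single none 1 ⬝ᵥ
        regInv η (symMat x) *ᵥ Pi.single none 1 := by simp
    rw [e1, e2, ← hu, ← Matrix.mulVec_mulVec, ← Matrix.mulVec_mulVec,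
      Matrix.dotProduct_mulVec, ← Matrix.mulVec_transpose]
  simp only [Set.indicator_apply, Set.mem_ofPred_eq, symMat_orthConj,
    regInv_orthogonal_conj η O h1 h2, htr, hjj, gaussWeight_orthConj]

/-- With high probability a symmetric Gaussian matrix with an arbitrary shift has few eigenvalues
of size at most `η`. -/
theorem lintegral_trace_regInv_le (S : Sym2 ι → ℝ) {η : ℝ} (hη : 0 < η) (hη1 : η ≤ 1)
    (hm : 8 ≤ Fintype.card ι) :
    ∫⁻ x, {x : Sym2 ι → ℝ | Fintype.card ι / (4 * η ^ 2) < (regInv η (symMat x)).trace}.indicator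
        (gaussWeight (Fintype.card ι / 4) S) x ≤
      ENNReal.ofReal (28 * Real.sqrt η) * ∫⁻ x, gaussWeight (Fintype.card ι / 4) S x := by
  have hm' : (8 : ℝ) ≤ Fintype.card ι := by exact_mod_cast hm
  set m : ℝ := (Fintype.card ι : ℝ)
  set β := m / 4
  have hβ : 0 < β := by simp only [β]; linarith
  set K := m / (4 * η ^ 2)
  have hη2 : 0 < η ^ 2 := by positivity
  have hK0 : 0 < K := by positivity
  -- Dimension at least eight makes the loss `1 / η²` from passing to the minor at most `K / 2`.
  have hK : 2 * (1 / η ^ 2) ≤ K := by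
    simp only [K]; rw [mul_one_div, div_le_div_iff₀ hη2 (by positivity)]; nlinarith
  have hK1 : 1 / η ^ 2 ≤ K := by
    have : 0 < 1 / η ^ 2 := by positivity
    linarith
  have hgm := measurable_gaussWeight β S
  set A := {x : Sym2 ι → ℝ | K < (regInv η (symMat x)).trace}
  -- The choice `b = 1 / η` makes the small ball term of order `√η` and the remaining term `η`.
  -- Since `m / (K η²) = 4`, the total is at most `4 (2 e + 1) √η`.
  set c := 1 / η ^ 2 * (Real.exp 1 *
        (1 + (K - 1 / η ^ 2) / (2 * β * (1 / η))) ^ (-(1 / 2) : ℝ) + 1 / (1 / η))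
  have hc : m / K * c ≤ 28 * Real.sqrt η := by
    have h1 : m / K * (1 / η ^ 2) = 4 := by simp only [K]; field_simp
    have h2 : (1 + (K - 1 / η ^ 2) / (2 * β * (1 / η))) ^ (-(1 / 2) : ℝ) ≤ 2 * Real.sqrt η := by
      have h3 : 1 / (4 * η) ≤ 1 + (K - 1 / η ^ 2) / (2 * β * (1 / η)) := by
        have h4 : K / 2 / (2 * β * (1 / η)) = 1 / (4 * η) := by
          simp only [K, β]; field_simp; norm_num
        have h5 : K / 2 / (2 * β * (1 / η)) ≤ (K - 1 / η ^ 2) / (2 * β * (1 / η)) := by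
          gcongr; linarith
        linarith
      refine (Real.rpow_le_rpow_of_nonpos (by positivity) h3 (by norm_num)).trans (le_of_eq ?_)
      rw [Real.rpow_neg (by positivity), ← Real.sqrt_eq_rpow, one_div, Real.sqrt_inv, inv_inv,
        Real.sqrt_mul (by norm_num), show (4 : ℝ) = 2 ^ 2 by norm_num, Real.sqrt_sq (by norm_num)]
    have h6 : η ≤ Real.sqrt η := by
      refine Real.le_sqrt_of_sq_le ?_
      nlinarith
    have h7 := Real.exp_one_lt_d9
    have h8 : Real.exp 1 * (1 + (K - 1 / η ^ 2) / (2 * β * (1 / η))) ^ (-(1 / 2) : ℝ) ≤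
        Real.exp 1 * (2 * Real.sqrt η) := mul_le_mul_of_nonneg_left h2 (Real.exp_nonneg _)
    simp only [c]
    rw [← mul_assoc, h1, one_div_one_div]
    nlinarith [Real.sqrt_nonneg η]
  -- Markov's inequality: on the event `K` is less than the trace, which is the sum of the diagonal
  -- entries just estimated.
  have hle : ENNReal.ofReal K * ∫⁻ x, A.indicator (gaussWeight β S) x ≤
      ENNReal.ofReal (m * c) * ∫⁻ x, gaussWeight β S x := by
    calc ENNReal.ofReal K * ∫⁻ x, A.indicator (gaussWeight β S) x
        ≤ ∫⁻ x, ∑ j, A.indicator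
            (fun x => ENNReal.ofReal (regInv η (symMat x) j j) * gaussWeight β S x) x := by
          rw [← lintegral_const_mul' _ _ ENNReal.ofReal_ne_top]
          refine lintegral_mono fun x => ?_
          by_cases hx : x ∈ A
          · simp only [Set.indicator_of_mem hx]
            rw [← Finset.sum_mul, ← ENNReal.ofReal_sum_of_nonneg fun j _ =>
              (regInv_posSemidef hη (symMat_transpose x)).diag_nonneg]
            exact mul_le_mul_left (ENNReal.ofReal_le_ofReal (le_of_lt hx)) _
          · simp [Set.indicator_of_notMem hx]
      _ = ∑ j, ∫⁻ x, A.indicator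
            (fun x => ENNReal.ofReal (regInv η (symMat x) j j) * gaussWeight β S x) x := by
          refine lintegral_finsetSum _ fun j _ => ?_
          exact (((measurable_regInv_apply η j j).ennreal_ofReal).mul hgm).indicator
            (measurableSet_lt measurable_const (measurable_trace_regInv η))
      _ ≤ ∑ j : ι, ENNReal.ofReal c * ∫⁻ x, gaussWeight β S x :=
          Finset.sum_le_sum fun j _ => lintegral_regInv_diag_le S hβ hη (by positivity) hK1 j
      _ = _ := by
          rw [Finset.sum_const, nsmul_eq_mul, Finset.card_univ, ← mul_assoc,
            ENNReal.ofReal_mul (p := m) (by linarith), ENNReal.ofReal_natCast]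
  have hKi : ENNReal.ofReal K⁻¹ * ENNReal.ofReal K = 1 := by
    rw [← ENNReal.ofReal_mul (by positivity), inv_mul_cancel₀ hK0.ne', ENNReal.ofReal_one]
  calc ∫⁻ x, A.indicator (gaussWeight β S) x
      = ENNReal.ofReal K⁻¹ * (ENNReal.ofReal K * ∫⁻ x, A.indicator (gaussWeight β S) x) := by
        rw [← mul_assoc, hKi, one_mul]
    _ ≤ ENNReal.ofReal K⁻¹ * (ENNReal.ofReal (m * c) * ∫⁻ x, gaussWeight β S x) :=
        mul_le_mul_right hle _
    _ = ENNReal.ofReal (m / K * c) * ∫⁻ x, gaussWeight β S x := by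
        rw [← mul_assoc, ← ENNReal.ofReal_mul (by positivity)]
        congr 2
        field_simp
    _ ≤ _ := mul_le_mul_left (ENNReal.ofReal_le_ofReal hc) _

/-! ### Deterministic bounds for inverses and conjugations -/

variable {ι : Type*} [Fintype ι] [DecidableEq ι]

/-- `X` has Euclidean operator norm at most `τ`. -/
def OpBound {ι : Type*} [Fintype ι] (X : Matrix ι ι ℝ) (τ : ℝ) : Prop :=
  ∀ x, (X *ᵥ x) ⬝ᵥ (X *ᵥ x) ≤ τ ^ 2 * (x ⬝ᵥ x)

theorem OpBound.transpose {ι : Type*} [Fintype ι] {X : Matrix ι ι ℝ} {τ : ℝ} (h : OpBound X τ) :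
    OpBound Xᵀ τ := by
  intro x
  have h1 : (Xᵀ *ᵥ x) ⬝ᵥ (Xᵀ *ᵥ x) = x ⬝ᵥ (X *ᵥ (Xᵀ *ᵥ x)) := by
    rw [Matrix.dotProduct_mulVec x, ← Matrix.mulVec_transpose]
  have h2 := dotProduct_sq_le x (X *ᵥ (Xᵀ *ᵥ x))
  rw [← h1] at h2
  have h3 := h2.trans (mul_le_mul_of_nonneg_left (h (Xᵀ *ᵥ x)) (dotProduct_self_nonneg' x))
  have h4 := dotProduct_self_nonneg' (Xᵀ *ᵥ x)
  set p := (Xᵀ *ᵥ x) ⬝ᵥ (Xᵀ *ᵥ x)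
  rcases h4.lt_or_eq with h5 | h5
  · refine le_of_mul_le_mul_left ?_ h5
    nlinarith
  · rw [← h5]; exact mul_nonneg (sq_nonneg _) (dotProduct_self_nonneg' x)

theorem OpBound.mul {ι : Type*} [Fintype ι] {X Y : Matrix ι ι ℝ} {σ τ : ℝ} (hX : OpBound X σ)
    (hY : OpBound Y τ) : OpBound (X * Y) (σ * τ) := by
  intro x
  rw [← Matrix.mulVec_mulVec]
  refine (hX _).trans ?_
  rw [mul_pow, mul_assoc]
  exact mul_le_mul_of_nonneg_left (hY x) (sq_nonneg _)

theorem frobSq_transpose {ι : Type*} [Fintype ι] (X : Matrix ι ι ℝ) : frobSq Xᵀ = frobSq X := by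
  unfold frobSq; rw [Finset.sum_comm]; rfl

theorem frobSq_eq_sum_col {ι : Type*} [Fintype ι] (X : Matrix ι ι ℝ) :
    frobSq X = ∑ j, (X.col j) ⬝ᵥ (X.col j) := by
  unfold frobSq; rw [Finset.sum_comm]; simp [dotProduct, sq]

theorem OpBound.frobSq_mul_le {ι : Type*} [Fintype ι] {X : Matrix ι ι ℝ} {τ : ℝ} (h : OpBound X τ)
    (Y : Matrix ι ι ℝ) : frobSq (X * Y) ≤ τ ^ 2 * frobSq Y := by
  rw [frobSq_eq_sum_col, frobSq_eq_sum_col, Finset.mul_sum]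
  refine Finset.sum_le_sum fun j _ => ?_
  have : (X * Y).col j = X *ᵥ Y.col j := by
    funext i; simp [Matrix.mul_apply, Matrix.mulVec, dotProduct]
  rw [this]
  exact h _

theorem OpBound.frobSq_mul_le_right {ι : Type*} [Fintype ι] {X : Matrix ι ι ℝ} {τ : ℝ}
    (h : OpBound X τ) (Y : Matrix ι ι ℝ) : frobSq (Y * X) ≤ τ ^ 2 * frobSq Y := by
  rw [← frobSq_transpose, Matrix.transpose_mul, ← frobSq_transpose Y]
  exact h.transpose.frobSq_mul_le _

theorem trace_mul_sq_le {ι : Type*} [Fintype ι] (X Y : Matrix ι ι ℝ) :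
    (X * Y).trace ^ 2 ≤ frobSq X * frobSq Y := by
  have h := Finset.sum_mul_sq_le_sq_mul_sq (Finset.univ : Finset (ι × ι))
    (fun p => X p.1 p.2) (fun p => Y p.2 p.1)
  rw [← frobSq_transpose Y]
  simpa only [Fintype.sum_prod_type, frobSq, Matrix.trace, Matrix.diag_apply, Matrix.mul_apply,
    Matrix.transpose_apply] using h

theorem frobSq_eq_trace {ι : Type*} [Fintype ι] (X : Matrix ι ι ℝ) :
    frobSq X = (Xᵀ * X).trace := sum_sq_eq_trace X

theorem dotProduct_orthogonal_mulVec {U : Matrix ι ι ℝ} (h2 : Uᵀ * U = 1) (x : ι → ℝ) :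
    (U *ᵥ x) ⬝ᵥ (U *ᵥ x) = x ⬝ᵥ x := by
  rw [Matrix.dotProduct_mulVec, ← Matrix.mulVec_transpose, Matrix.mulVec_mulVec, h2,
    Matrix.one_mulVec]

theorem opBound_conj_diagonal {U : Matrix ι ι ℝ} (h1 : U * Uᵀ = 1) (h2 : Uᵀ * U = 1) {d : ι → ℝ}
    {τ : ℝ} (hd : ∀ i, d i ^ 2 ≤ τ ^ 2) : OpBound (U * Matrix.diagonal d * Uᵀ) τ := by
  intro x
  rw [← Matrix.mulVec_mulVec, ← Matrix.mulVec_mulVec, dotProduct_orthogonal_mulVec h2,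
    ← dotProduct_orthogonal_mulVec (U := Uᵀ) (by simpa using h1) x]
  set y := Uᵀ *ᵥ x
  simp only [dotProduct, Matrix.mulVec_diagonal, Finset.mul_sum]
  refine Finset.sum_le_sum fun i _ => ?_
  have := mul_le_mul_of_nonneg_right (hd i) (mul_self_nonneg (y i))
  linarith

theorem rank_conj_diagonal_le (U V : Matrix ι ι ℝ) (d : ι → ℝ) :
    (U * Matrix.diagonal d * V).rank ≤ (Finset.univ.filter fun i => d i ≠ 0).card := by
  refine (Matrix.rank_mul_le_left _ _).trans ((Matrix.rank_mul_le_right _ _).trans ?_)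
  rw [Matrix.rank_diagonal, Fintype.card_subtype]

theorem regInv_diagonal {η : ℝ} (hη : 0 < η) (d : ι → ℝ) :
    regInv η (Matrix.diagonal d) = Matrix.diagonal fun i => 1 / (d i ^ 2 + η ^ 2) := by
  refine Matrix.inv_eq_right_inv ?_
  rw [Matrix.diagonal_mul_diagonal, Matrix.smul_one_eq_diagonal, Matrix.diagonal_add,
    Matrix.diagonal_mul_diagonal, ← Matrix.diagonal_one]
  congr 1
  funext i
  have : 0 < d i ^ 2 + η ^ 2 := by positivity
  field_simp

/-- A bound on the regularised trace limits the number of small eigenvalues. -/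
theorem exists_diagonalization_few_small {η : ℝ} (hη : 0 < η) {D : Matrix ι ι ℝ} (hD : Dᵀ = D)
    (hT : (regInv η D).trace ≤ Fintype.card ι / (4 * η ^ 2)) :
    ∃ (U : Matrix ι ι ℝ) (d : ι → ℝ), U * Uᵀ = 1 ∧ Uᵀ * U = 1 ∧ D = U * Matrix.diagonal d * Uᵀ ∧
      (2 * (Finset.univ.filter fun i => |d i| < η).card : ℝ) ≤ Fintype.card ι := by
  have hH : D.IsHermitian := by
    rw [Matrix.IsHermitian, Matrix.conjTranspose_eq_transpose_of_trivial, hD]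
  obtain ⟨U, h1, h2, hU⟩ := exists_orthogonal_diagonalization D hH
  refine ⟨U, hH.eigenvalues, h1, h2, hU, ?_⟩
  set d := hH.eigenvalues
  have htr : (regInv η D).trace = ∑ i, 1 / (d i ^ 2 + η ^ 2) := by
    rw [hU, regInv_orthogonal_conj η U h1 h2, Matrix.trace_mul_comm, ← Matrix.mul_assoc, h2,
      Matrix.one_mul, regInv_diagonal hη, Matrix.trace_diagonal]
  rw [htr] at hT
  have hη2 : 0 < η ^ 2 := by positivity
  -- Each eigenvalue of modulus below `η` contributes at least `1 / (2 η²)` to the trace.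
  have h3 : ((Finset.univ.filter fun i => |d i| < η).card : ℝ) * (1 / (2 * η ^ 2)) ≤
      ∑ i, 1 / (d i ^ 2 + η ^ 2) := by
    rw [← nsmul_eq_mul, ← Finset.sum_const]
    refine (Finset.sum_le_sum fun i hi => ?_).trans
      (Finset.sum_le_sum_of_subset_of_nonneg (Finset.filter_subset _ _) fun i _ _ => by positivity)
    have : |d i| < η := (Finset.mem_filter.mp hi).2
    have : d i ^ 2 ≤ η ^ 2 := by
      rw [← sq_abs]; exact pow_le_pow_left₀ (abs_nonneg _) this.le 2
    exact one_div_le_one_div_of_le (by positivity) (by linarith)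
  have h4 := h3.trans hT
  rw [mul_one_div, div_le_div_iff₀ (by positivity) (by positivity)] at h4
  have : (2 * η ^ 2) * (2 * ((Finset.univ.filter fun i => |d i| < η).card : ℝ)) ≤
      (2 * η ^ 2) * Fintype.card ι := by linarith
  exact le_of_mul_le_mul_left this (by positivity)

/-- At least half of the eigenvalues have modulus at least `η`. -/
theorem frobSq_ge_of_trace_regInv_le {η : ℝ} (hη : 0 < η) {D : Matrix ι ι ℝ} (hD : Dᵀ = D)
    (hT : (regInv η D).trace ≤ Fintype.card ι / (4 * η ^ 2)) :
    Fintype.card ι / 2 * η ^ 2 ≤ frobSq D := by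
  obtain ⟨U, d, h1, h2, hU, hcard⟩ := exists_diagonalization_few_small hη hD hT
  have hf : frobSq D = ∑ i, d i ^ 2 := by
    have e : (U * Matrix.diagonal d * Uᵀ)ᵀ * (U * Matrix.diagonal d * Uᵀ) =
        U * (Matrix.diagonal d * (Uᵀ * U) * Matrix.diagonal d * Uᵀ) := by
      simp only [Matrix.transpose_mul, Matrix.transpose_transpose, Matrix.diagonal_transpose,
        Matrix.mul_assoc]
    rw [frobSq_eq_trace, hU, e, Matrix.trace_mul_comm, h2, Matrix.mul_one,
      Matrix.diagonal_mul_diagonal, Matrix.mul_assoc, h2, Matrix.mul_one, Matrix.trace_diagonal]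
    simp [sq]
  have hsplit := Finset.card_filter_add_card_filter_not (s := (Finset.univ : Finset ι))
    (fun i => |d i| < η)
  rw [Finset.card_univ] at hsplit
  have hsplit' : ((Finset.univ.filter fun i => |d i| < η).card : ℝ) +
    (Finset.univ.filter fun i => ¬ |d i| < η).card = Fintype.card ι := by exact_mod_cast hsplit
  have h3 : ((Finset.univ.filter fun i => ¬ |d i| < η).card : ℝ) * η ^ 2 ≤ ∑ i, d i ^ 2 := by
    rw [← nsmul_eq_mul, ← Finset.sum_const]
    refine (Finset.sum_le_sum fun i hi => ?_).trans
      (Finset.sum_le_sum_of_subset_of_nonneg (Finset.filter_subset _ _) fun i _ _ => sq_nonneg _)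
    have : η ≤ |d i| := not_lt.mp (Finset.mem_filter.mp hi).2
    rw [← sq_abs (d i)]
    exact pow_le_pow_left₀ hη.le this 2
  rw [hf]
  refine le_trans ?_ h3
  refine mul_le_mul_of_nonneg_right ?_ (sq_nonneg _)
  linarith

/-- The inverse splits into a bounded part and a part of rank at most half the dimension. -/
theorem exists_inv_split {η : ℝ} (hη : 0 < η) {D : Matrix ι ι ℝ} (hD : Dᵀ = D) (hu : IsUnit D.det)
    (hT : (regInv η D).trace ≤ Fintype.card ι / (4 * η ^ 2)) :
    ∃ Xs Xb : Matrix ι ι ℝ, D⁻¹ = Xs + Xb ∧ OpBound Xs η⁻¹ ∧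
      (2 * Xb.rank : ℝ) ≤ Fintype.card ι := by
  obtain ⟨U, d, h1, h2, hU, hcard⟩ := exists_diagonalization_few_small hη hD hT
  have hd : ∀ i, d i ≠ 0 := by
    have hdet : D.det = ∏ i, d i := by
      rw [hU, Matrix.det_mul_right_comm, h1, Matrix.one_mul, Matrix.det_diagonal]
    intro i hi
    rw [hdet] at hu
    exact hu.ne_zero (Finset.prod_eq_zero (Finset.mem_univ i) hi)
  refine ⟨U * Matrix.diagonal (fun i => if |d i| < η then 0 else (d i)⁻¹) * Uᵀ,
    U * Matrix.diagonal (fun i => if |d i| < η then (d i)⁻¹ else 0) * Uᵀ, ?_, ?_, ?_⟩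
  · rw [← Matrix.add_mul, ← Matrix.mul_add, Matrix.diagonal_add]
    conv_lhs => rw [hU, inv_orthogonal_conj U h1 h2]
    congr 2
    refine Matrix.inv_eq_right_inv ?_
    rw [Matrix.diagonal_mul_diagonal, ← Matrix.diagonal_one]
    congr 1
    funext i
    split_ifs <;> simp [hd i]
  · refine opBound_conj_diagonal h1 h2 fun i => ?_
    split_ifs with h
    · rw [zero_pow two_ne_zero]; positivity
    · rw [inv_pow, inv_pow, ← sq_abs (d i)]
      push Not at h
      exact inv_anti₀ (by positivity) (pow_le_pow_left₀ hη.le h 2)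
  · refine le_trans ?_ hcard
    have := (rank_conj_diagonal_le U Uᵀ (fun i => if |d i| < η then (d i)⁻¹ else 0)).trans
      (Finset.card_le_card (t := Finset.univ.filter fun i => |d i| < η) fun i hi => by
        rw [Finset.mem_filter] at hi ⊢
        refine ⟨hi.1, ?_⟩
        by_contra h
        exact hi.2 (if_neg h))
    have : ((U * Matrix.diagonal (fun i => if |d i| < η then (d i)⁻¹ else 0) * Uᵀ).rank : ℝ) ≤
      (Finset.univ.filter fun i => |d i| < η).card := by exact_mod_cast this
    linarith

/-- Diagonalisation of the Gram matrix. -/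
theorem exists_gram_diagonalization (B : Matrix ι ι ℝ) :
    ∃ (U : Matrix ι ι ℝ) (h : ι → ℝ), U * Uᵀ = 1 ∧ Uᵀ * U = 1 ∧ (∀ i, 0 ≤ h i) ∧
      Bᵀ * B = U * Matrix.diagonal h * Uᵀ ∧ ∑ i, h i = frobSq B ∧
      (Finset.univ.filter fun i => h i ≠ 0).card = B.rank := by
  have hps := Matrix.posSemidef_conjTranspose_mul_self B
  rw [Matrix.conjTranspose_eq_transpose_of_trivial] at hps
  obtain ⟨U, h1, h2, hU⟩ := exists_orthogonal_diagonalization _ hps.isHermitian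
  refine ⟨U, _, h1, h2, hps.eigenvalues_nonneg, hU, ?_, ?_⟩
  · rw [frobSq_eq_trace, hps.isHermitian.trace_eq_sum_eigenvalues]; simp
  · rw [← Matrix.rank_transpose_mul_self, hps.isHermitian.rank_eq_card_non_zero_eigs,
      Fintype.card_subtype]

theorem gram_mulVec (B P : Matrix ι ι ℝ) {U : Matrix ι ι ℝ} {h : ι → ℝ} (h2 : Uᵀ * U = 1)
    (hB : Bᵀ * B = U * Matrix.diagonal h * Uᵀ) {p : ι → ℝ} (hP : P = U * Matrix.diagonal p * Uᵀ) :
    (B * P)ᵀ * (B * P) = U * Matrix.diagonal (fun i => p i * h i * p i) * Uᵀ := by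
  have e : (B * P)ᵀ * (B * P) = Pᵀ * (Bᵀ * B) * P := by
    simp only [Matrix.transpose_mul, Matrix.mul_assoc]
  have e2 : U * Matrix.diagonal p * Uᵀ * (U * Matrix.diagonal h * Uᵀ) * (U * Matrix.diagonal p * Uᵀ)
      = U * (Matrix.diagonal p * (Uᵀ * U) * Matrix.diagonal h * (Uᵀ * U) * Matrix.diagonal p) * Uᵀ := by
    simp only [Matrix.mul_assoc]
  have e3 : Pᵀ = P := by
    rw [hP]; simp only [Matrix.transpose_mul, Matrix.transpose_transpose, Matrix.diagonal_transpose,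
        Matrix.mul_assoc]
  rw [e, hB, e3, hP, e2, h2, Matrix.mul_one, Matrix.mul_one, Matrix.diagonal_mul_diagonal,
    Matrix.diagonal_mul_diagonal]

/-- A matrix splits into a part of bounded operator norm and a part of small rank. -/
theorem exists_split_of_frobSq (B : Matrix ι ι ℝ) {τ : ℝ} (hτ : 0 < τ) :
    ∃ Bs Bb : Matrix ι ι ℝ, B = Bs + Bb ∧ OpBound Bs τ ∧ Bb.rank * τ ^ 2 ≤ frobSq B := by
  obtain ⟨U, h, h1, h2, hnn, hU, hsum, -⟩ := exists_gram_diagonalization B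
  -- Spectral cut-off of `BᵀB` at `τ²`: each eigenvalue placed in the low rank part uses more than
  -- `τ²` of `frobSq B`.
  set p : ι → ℝ := fun i => if h i ≤ τ ^ 2 then 1 else 0
  set q : ι → ℝ := fun i => if h i ≤ τ ^ 2 then 0 else 1
  refine ⟨B * (U * Matrix.diagonal p * Uᵀ), B * (U * Matrix.diagonal q * Uᵀ), ?_, ?_, ?_⟩
  · rw [← Matrix.mul_add, ← Matrix.add_mul, ← Matrix.mul_add, Matrix.diagonal_add]
    have : (fun i => p i + q i) = fun _ => 1 := by
      funext i; simp only [p, q]; split_ifs <;> simp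
    rw [this, Matrix.diagonal_one, Matrix.mul_one, h1, Matrix.mul_one]
  · intro x
    have hg := gram_mulVec B _ h2 hU (p := p) rfl
    rw [Matrix.dotProduct_mulVec, ← Matrix.mulVec_transpose, Matrix.mulVec_mulVec, hg,
      dotProduct_comm, ← Matrix.mulVec_mulVec, ← Matrix.mulVec_mulVec, Matrix.dotProduct_mulVec,
      ← Matrix.mulVec_transpose,
      ← dotProduct_orthogonal_mulVec (U := Uᵀ) (by simpa using h1) x]
    set y := Uᵀ *ᵥ x
    simp only [dotProduct, Matrix.mulVec_diagonal, Finset.mul_sum]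
    refine Finset.sum_le_sum fun i _ => ?_
    simp only [p]
    split_ifs with hi
    · nlinarith [mul_self_nonneg (y i)]
    · have := mul_self_nonneg (y i)
      have : 0 ≤ τ ^ 2 * (y i * y i) := by positivity
      linarith
  · have hr : (B * (U * Matrix.diagonal q * Uᵀ)).rank ≤
        (Finset.univ.filter fun i => q i ≠ 0).card :=
      (Matrix.rank_mul_le_right _ _).trans (rank_conj_diagonal_le U Uᵀ q)
    have hr' : ((B * (U * Matrix.diagonal q * Uᵀ)).rank : ℝ) ≤
        (Finset.univ.filter fun i => q i ≠ 0).card := by exact_mod_cast hr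
    refine (mul_le_mul_of_nonneg_right hr' (sq_nonneg τ)).trans ?_
    rw [← hsum, ← nsmul_eq_mul, ← Finset.sum_const]
    refine (Finset.sum_le_sum fun i hi => ?_).trans
      (Finset.sum_le_sum_of_subset_of_nonneg (Finset.filter_subset _ _) fun i _ _ => hnn i)
    by_contra hlt
    exact (Finset.mem_filter.mp hi).2 (if_pos (not_le.mp hlt).le)

/-- The orthogonal projection onto the kernel. -/
theorem exists_kernel_projection (R : Matrix ι ι ℝ) :
    ∃ T : Matrix ι ι ℝ, R * T = 0 ∧ OpBound T 1 ∧ (Fintype.card ι : ℝ) - R.rank ≤ T.trace := by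
  obtain ⟨U, h, h1, h2, hnn, hU, -, hrank⟩ := exists_gram_diagonalization R
  set p : ι → ℝ := fun i => if h i ≠ 0 then 0 else 1
  refine ⟨U * Matrix.diagonal p * Uᵀ, ?_, ?_, ?_⟩
  · have hg := gram_mulVec R _ h2 hU (p := p) rfl
    have hz : (fun i => p i * h i * p i) = 0 := by
      funext i; simp only [p]; split_ifs with hi
      · simp
      · push Not at hi; simp [hi]
    rw [hz, Matrix.diagonal_zero', Matrix.mul_zero, Matrix.zero_mul] at hg
    rw [← Matrix.conjTranspose_eq_transpose_of_trivial] at hg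
    exact Matrix.conjTranspose_mul_self_eq_zero.mp hg
  · refine opBound_conj_diagonal h1 h2 fun i => ?_
    simp only [p]; split_ifs <;> norm_num
  · rw [Matrix.trace_mul_comm, ← Matrix.mul_assoc, h2, Matrix.one_mul, Matrix.trace_diagonal,
      ← hrank]
    have hp : ∀ i, p i = 1 - if h i ≠ 0 then 1 else 0 := by
      intro i; simp only [p]; split_ifs <;> simp
    simp only [hp, Finset.sum_sub_distrib, Finset.sum_const, Finset.card_univ, nsmul_eq_mul,
      mul_one, Finset.sum_boole]
    exact le_refl _

/-- Lower bound for the inverse of a low rank perturbation. -/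
theorem frobSq_inv_ge {K R : Matrix ι ι ℝ} (hu : IsUnit (K + R).det)
    (hR : (R.rank : ℝ) ≤ 3 / 4 * Fintype.card ι) :
    (Fintype.card ι / 4 : ℝ) ^ 2 ≤ frobSq (K + R)⁻¹ * frobSq K := by
  obtain ⟨T, h0, hop, htr⟩ := exists_kernel_projection R
  -- On the kernel of `R` the perturbation is invisible. Taking traces, `tr T ≥ m / 4` by the rank
  -- bound, where `m` is the dimension, while Cauchy–Schwarz bounds `tr T` by the two Frobenius
  -- norms.
  have e : T = (K + R)⁻¹ * (K * T) := by
    have : (K + R) * T = K * T := by rw [Matrix.add_mul, h0, add_zero]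
    rw [← this, ← Matrix.mul_assoc, Matrix.nonsing_inv_mul _ hu, Matrix.one_mul]
  have h1 := trace_mul_sq_le (K + R)⁻¹ (K * T)
  rw [← e] at h1
  have h2 := hop.frobSq_mul_le_right K
  rw [one_pow, one_mul] at h2
  have h3 : (Fintype.card ι / 4 : ℝ) ≤ T.trace := by linarith
  exact (pow_le_pow_left₀ (by positivity) h3 2).trans
    (h1.trans (mul_le_mul_of_nonneg_left h2 (frobSq_nonneg _)))

theorem frobSq_sub_sub_le {ι : Type*} [Fintype ι] (X Y Z : Matrix ι ι ℝ) :
    frobSq (X - Y - Z) ≤ 3 * (frobSq X + frobSq Y + frobSq Z) := by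
  simp only [frobSq, ← Finset.sum_add_distrib, Finset.mul_sum]
  refine Finset.sum_le_sum fun i _ => Finset.sum_le_sum fun j _ => ?_
  simp only [Matrix.sub_apply]
  nlinarith [sq_nonneg (X i j + Y i j), sq_nonneg (X i j + Z i j), sq_nonneg (Y i j - Z i j)]

theorem frobSq_smul_one (r : ℝ) :
    frobSq (r • (1 : Matrix ι ι ℝ)) = r ^ 2 * Fintype.card ι := by
  simp [frobSq, Matrix.one_apply, mul_comm]

theorem rank_add_le {ι : Type*} [Fintype ι] (X Y : Matrix ι ι ℝ) : (X + Y).rank ≤ X.rank + Y.rank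
    := by
  rw [Matrix.rank, Matrix.rank, Matrix.rank, Matrix.mulVecLin_add]
  refine le_trans (Submodule.finrank_mono ?_) (Submodule.finrank_add_le_finrank_add_finrank _ _)
  rintro _ ⟨x, rfl⟩
  exact Submodule.add_mem_sup ⟨x, rfl⟩ ⟨x, rfl⟩

/-- One step of the chain: a lower bound for `(A - r - Bᵀ D⁻¹ B)⁻¹`. -/
theorem frobSq_schur_inv_ge {η τ r : ℝ} (hη : 0 < η) (hτ : 0 < τ) {D A B : Matrix ι ι ℝ}
    (hD : Dᵀ = D) (hu : IsUnit D.det)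
    (hT : (regInv η D).trace ≤ Fintype.card ι / (4 * η ^ 2))
    (hB : frobSq B ≤ τ ^ 2 * (Fintype.card ι / 4))
    (hu' : IsUnit (A - r • 1 - Bᵀ * D⁻¹ * B).det) :
    (Fintype.card ι / 4 : ℝ) ^ 2 ≤ frobSq (A - r • 1 - Bᵀ * D⁻¹ * B)⁻¹ *
      (3 * (frobSq A + r ^ 2 * Fintype.card ι + (η⁻¹ * τ) ^ 2 * frobSq B)) := by
  obtain ⟨Xs, Xb, hX, hXs, hXb⟩ := exists_inv_split hη hD hu hT
  obtain ⟨Bs, Bb, hBB, hBs, hBb⟩ := exists_split_of_frobSq B hτ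
  -- `K` keeps the factors of bounded operator norm, next to a single factor `Bᵀ` measured in
  -- Frobenius norm. Every other term contains `Xb` or `Bb` and so has low rank.
  set K := A - r • 1 - Bᵀ * (Xs * Bs)
  set R := (-Bᵀ) * Xs * Bb + (-Bᵀ) * Xb * B
  have hKR : A - r • 1 - Bᵀ * D⁻¹ * B = K + R := by
    have : Bᵀ * D⁻¹ * B = Bᵀ * (Xs * Bs) + Bᵀ * Xs * Bb + Bᵀ * Xb * B := by
      rw [hX, Matrix.mul_add, Matrix.add_mul]
      congr 1
      conv_lhs => rw [hBB]
      rw [Matrix.mul_add, Matrix.mul_assoc, ← hBB]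
    rw [this]; simp only [K, R, Matrix.neg_mul]; abel
  -- One half of the dimension comes from `Xb` and one quarter from `Bb`.
  have hrank : (R.rank : ℝ) ≤ 3 / 4 * Fintype.card ι := by
    have h1 : R.rank ≤ Bb.rank + Xb.rank := by
      refine (rank_add_le _ _).trans (add_le_add (Matrix.rank_mul_le_right _ _) ?_)
      exact (Matrix.rank_mul_le_left _ _).trans (Matrix.rank_mul_le_right _ _)
    have h2 : (R.rank : ℝ) ≤ Bb.rank + Xb.rank := by exact_mod_cast h1
    have h3 : τ ^ 2 * (Bb.rank : ℝ) ≤ τ ^ 2 * (Fintype.card ι / 4) := by linarith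
    have h4 := le_of_mul_le_mul_left h3 (by positivity)
    linarith
  rw [hKR] at hu' ⊢
  refine (frobSq_inv_ge hu' hrank).trans (mul_le_mul_of_nonneg_left ?_ (frobSq_nonneg _))
  refine (frobSq_sub_sub_le _ _ _).trans ?_
  have h5 := (hXs.mul hBs).frobSq_mul_le_right Bᵀ
  rw [frobSq_transpose] at h5
  rw [frobSq_smul_one]
  linarith

/-- Upper bound for `Bᵀ X B` from entrywise bounds. -/
theorem frobSq_conj_le {ι : Type*} [Fintype ι] {X B : Matrix ι ι ℝ} {a : ℝ}
    (h1 : ∀ i j, B i j ^ 2 ≤ a ^ 2) (h2 : ∀ i j, (X * B) i j ^ 2 ≤ a ^ 2 * ∑ l, X i l ^ 2)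
    (h3 : ∀ i j, i ≠ j → (Bᵀ * X * B) i j ^ 2 ≤ a ^ 2 * ∑ l, (X * B) l j ^ 2) :
    frobSq (Bᵀ * X * B) ≤ 2 * (Fintype.card ι * a ^ 2) ^ 2 * frobSq X := by
  classical
  set m : ℝ := (Fintype.card ι : ℝ)
  have hm : 0 ≤ m := Nat.cast_nonneg _
  have hF := frobSq_nonneg X
  have hcol : ∀ j, ∑ l, (X * B) l j ^ 2 ≤ a ^ 2 * frobSq X := by
    intro j
    rw [frobSq, Finset.mul_sum]
    exact Finset.sum_le_sum fun l _ => h2 l j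
  -- A diagonal entry uses the same column of `B` twice, so only Cauchy–Schwarz is available. It
  -- loses a factor `m`, which is affordable because there are only `m` such entries.
  have hdiag : ∀ j, (Bᵀ * X * B) j j ^ 2 ≤ m * a ^ 2 * (a ^ 2 * frobSq X) := by
    intro j
    have e : (Bᵀ * X * B) j j = ∑ l, B l j * (X * B) l j := by
      rw [Matrix.mul_assoc, Matrix.mul_apply]; rfl
    rw [e]
    refine (Finset.sum_mul_sq_le_sq_mul_sq Finset.univ (fun l => B l j)
      (fun l => (X * B) l j)).trans ?_
    refine mul_le_mul ?_ (hcol j) (Finset.sum_nonneg fun _ _ => sq_nonneg _) (by positivity)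
    refine (Finset.sum_le_sum fun l _ => h1 l j).trans ?_
    simp [m]
  have hall : ∀ i j, (Bᵀ * X * B) i j ^ 2 ≤
      a ^ 2 * (a ^ 2 * frobSq X) + if i = j then m * a ^ 2 * (a ^ 2 * frobSq X) else 0 := by
    intro i j
    split_ifs with hij
    · subst hij
      have : 0 ≤ a ^ 2 * (a ^ 2 * frobSq X) := by positivity
      linarith [hdiag i]
    · rw [add_zero]
      exact (h3 i j hij).trans (mul_le_mul_of_nonneg_left (hcol j) (sq_nonneg _))
  calc frobSq (Bᵀ * X * B) ≤ ∑ i : ι, ∑ j : ι, (a ^ 2 * (a ^ 2 * frobSq X) +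
        if i = j then m * a ^ 2 * (a ^ 2 * frobSq X) else 0) :=
        Finset.sum_le_sum fun i _ => Finset.sum_le_sum fun j _ => hall i j
    _ = 2 * (m * a ^ 2) ^ 2 * frobSq X := by
        simp only [Finset.sum_add_distrib, Finset.sum_const, Finset.card_univ, nsmul_eq_mul,
          Finset.sum_ite_eq, Finset.mem_univ, if_true]
        ring

/-- Lower bound for `Bᵀ X B` if few columns are exceptional. -/
theorem frobSq_conj_ge {ι : Type*} [Fintype ι] [DecidableEq ι] {X B : Matrix ι ι ℝ} {s : ℝ}
    (hs : 0 ≤ s)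
    (hm : 4 ≤ Fintype.card ι)
    (h1 : (4 * (Finset.univ.filter fun j =>
      ∑ l, (X * B) l j ^ 2 ≤ s * frobSq X / Fintype.card ι).card : ℝ) ≤ Fintype.card ι)
    (h2 : (4 * (Finset.univ.filter fun j => ∑ i, (if i = j then 0 else (Bᵀ * X * B) j i ^ 2) ≤
      s * (∑ i, if i = j then 0 else ∑ l, (X * B) l i ^ 2) / Fintype.card ι).card : ℝ) ≤
        Fintype.card ι) :
    3 / 8 * s ^ 2 * frobSq X ≤ frobSq (Bᵀ * X * B) := by
  have hm' : (4 : ℝ) ≤ Fintype.card ι := by exact_mod_cast hm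
  set m : ℝ := (Fintype.card ι : ℝ)
  have hF := frobSq_nonneg X
  set p : ι → ℝ := fun j => ∑ l, (X * B) l j ^ 2
  have hp : ∀ j, 0 ≤ p j := fun j => Finset.sum_nonneg fun _ _ => sq_nonneg _
  have good : ∀ (q : ι → Prop) [DecidablePred q], (4 * (Finset.univ.filter q).card : ℝ) ≤ m →
      3 / 4 * m ≤ ((Finset.univ.filter fun i => ¬ q i).card : ℝ) := by
    intro q _ hq
    have hsplit := Finset.card_filter_add_card_filter_not (s := (Finset.univ : Finset ι)) q
    rw [Finset.card_univ] at hsplit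
    have : ((Finset.univ.filter q).card : ℝ) + (Finset.univ.filter fun i => ¬ q i).card =
        (Fintype.card ι : ℝ) := by exact_mod_cast hsplit
    change _ = m at this
    linarith
  -- Three quarters of the columns of `X * B` carry at least `s frobSq X / m` each. The same
  -- argument is repeated below for the rows of `Bᵀ X B` with their diagonal entries removed.
  have hP : 3 / 4 * s * frobSq X ≤ ∑ j, p j := by
    have hc := good _ h1
    calc 3 / 4 * s * frobSq X = (3 / 4 * m) * (s * frobSq X / m) := by field_simp
      _ ≤ ((Finset.univ.filter fun j => ¬ p j ≤ s * frobSq X / m).card : ℝ) *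
          (s * frobSq X / m) := mul_le_mul_of_nonneg_right hc (by positivity)
      _ ≤ ∑ j, p j := by
        rw [← nsmul_eq_mul, ← Finset.sum_const]
        refine (Finset.sum_le_sum fun j hj => ?_).trans
          (Finset.sum_le_sum_of_subset_of_nonneg (Finset.filter_subset _ _) fun i _ _ => hp i)
        exact (not_le.mp (Finset.mem_filter.mp hj).2).le
  have hoff : ∀ j, (∑ i, if i = j then 0 else p i) = (∑ i, p i) - p j := by
    intro j
    have : ∀ i, (if i = j then 0 else p i) = p i - if i = j then p i else 0 := by
      intro i; split_ifs <;> simp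
    simp [this, Finset.sum_sub_distrib]
  set S := ∑ i, p i
  have hS : 0 ≤ S := Finset.sum_nonneg fun i _ => hp i
  have hc := good _ h2
  set J := Finset.univ.filter fun j => ¬ ∑ i, (if i = j then 0 else (Bᵀ * X * B) j i ^ 2) ≤
      s * (∑ i, if i = j then 0 else p i) / m
  have hQ : s / m * (J.card * S - S) ≤ frobSq (Bᵀ * X * B) := by
    have e1 : J.card * S - S ≤ ∑ j ∈ J, (S - p j) := by
      rw [Finset.sum_sub_distrib, Finset.sum_const, nsmul_eq_mul]
      have : ∑ j ∈ J, p j ≤ S :=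
        Finset.sum_le_sum_of_subset_of_nonneg (Finset.filter_subset _ _) fun i _ _ => hp i
      linarith
    calc s / m * (J.card * S - S) ≤ s / m * ∑ j ∈ J, (S - p j) :=
          mul_le_mul_of_nonneg_left e1 (by positivity)
      _ ≤ ∑ j ∈ J, ∑ i, (Bᵀ * X * B) j i ^ 2 := by
          rw [Finset.mul_sum]
          refine Finset.sum_le_sum fun j hj => ?_
          have := (not_le.mp (Finset.mem_filter.mp hj).2).le
          rw [hoff] at this
          calc s / m * (S - p j) = s * (S - p j) / m := by ring
            _ ≤ _ := this
            _ ≤ _ := Finset.sum_le_sum fun i _ => by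
                split_ifs
                · exact sq_nonneg _
                · exact le_refl _
      _ ≤ frobSq (Bᵀ * X * B) :=
          Finset.sum_le_sum_of_subset_of_nonneg (Finset.filter_subset _ _)
            fun i _ _ => Finset.sum_nonneg fun _ _ => sq_nonneg _
  refine le_trans ?_ hQ
  -- The omitted diagonal costs at most one `S`, and `3 m / 4 - 1 ≥ m / 2` because `m ≥ 4`.
  have h5 : m / 2 * S ≤ J.card * S - S := by nlinarith
  calc 3 / 8 * s ^ 2 * frobSq X = s / 2 * (3 / 4 * s * frobSq X) := by ring
    _ ≤ s / 2 * S := mul_le_mul_of_nonneg_left hP (by positivity)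
    _ = s / m * (m / 2 * S) := by field_simp
    _ ≤ _ := mul_le_mul_of_nonneg_left h5 (by positivity)

/-! ### The law and its coordinate subspaces -/

section Tridiagonal

variable {N M : ℕ}

theorem mem_tridiagonal {a : BlockMatrix N M} : a ∈ tridiagonal N M ↔
    (∀ i j, (a j i)ᵀ = a i j) ∧ ∀ i j : Fin N, 1 < |(i : ℤ) - (j : ℤ)| → a i j = 0 := by
  refine and_congr_left fun _ => ?_
  rw [← Matrix.ext_iff]
  simp only [Matrix.conjTranspose_apply, Matrix.star_eq_conjTranspose,
    Matrix.conjTranspose_eq_transpose_of_trivial]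

theorem transpose_apply_of_mem (a : tridiagonal N M) (i j : Fin N) : (a.1 j i)ᵀ = a.1 i j :=
  (mem_tridiagonal.mp a.2).1 i j

theorem energy_eq_sum (a : BlockMatrix N M) : energy a = ∑ i, ∑ j, frobSq (a i j) := by
  have h : ∀ i j : Fin N, ((a i j)ᴴ * a i j).trace = frobSq (a i j) := by
    intro i j
    rw [frobSq_eq_trace, Matrix.conjTranspose_eq_transpose_of_trivial]
  have e : (aᴴ * a).trace = ∑ j, ∑ i, (a i j)ᴴ * a i j := rfl
  rw [energy, e, Finset.sum_comm]
  simp only [Matrix.trace_sum, h]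

theorem energy_add {a b : BlockMatrix N M} (h : ∀ i j p q, a i j p q * b i j p q = 0) :
    energy (a + b) = energy a + energy b := by
  simp only [energy_eq_sum, frobSq, ← Finset.sum_add_distrib]
  refine Finset.sum_congr rfl fun i _ => Finset.sum_congr rfl fun j _ =>
    Finset.sum_congr rfl fun p _ => Finset.sum_congr rfl fun q _ => ?_
  have : (a + b) i j p q = a i j p q + b i j p q := rfl
  rw [this]
  linear_combination 2 * h i j p q

theorem measurable_entry (i j : Fin N) (p q : Fin M) :
    Measurable fun a : tridiagonal N M => a.1 i j p q :=
  (measurable_pi_apply q).comp ((measurable_pi_apply p).comp ((measurable_pi_apply j).comp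
    ((measurable_pi_apply i).comp measurable_subtype_coe)))

theorem measurable_to_tridiagonal {E : Type*} [MeasurableSpace E] {f : E → tridiagonal N M}
    (h : ∀ i j p q, Measurable fun x => (f x).1 i j p q) : Measurable f :=
  Measurable.subtype_mk (f := fun x => (f x).1) (h := fun x => (f x).2)
    (measurable_pi_lambda _ fun i => measurable_pi_lambda _ fun j =>
      measurable_pi_lambda _ fun p => measurable_pi_lambda _ fun q => h i j p q)

theorem measurable_energy : Measurable fun a : tridiagonal N M => energy a.1 := by
  simp only [energy_eq_sum, frobSq]
  exact Finset.measurable_sum _ fun i _ => Finset.measurable_sum _ fun j _ =>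
    Finset.measurable_sum _ fun p _ => Finset.measurable_sum _ fun q _ =>
      (measurable_entry i j p q).pow_const 2

/-- The unnormalised density. -/
noncomputable def weight (a : tridiagonal N M) : ENNReal :=
  ENNReal.ofReal (Real.exp (-((M : ℝ) / 4) * energy a.1))

theorem measurable_weight : Measurable (weight : tridiagonal N M → ENNReal) :=
  (measurable_energy.const_mul _).exp.ennreal_ofReal

theorem law_apply {S : Set (tridiagonal N M)} (hS : MeasurableSet S) :
    law N M S = ENNReal.ofReal (∫ a : tridiagonal N M,
      Real.exp (-((M : ℝ) / 4) * energy a.1) ∂Measure.addHaar)⁻¹ *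
        ∫⁻ a, S.indicator weight a ∂Measure.addHaar := by
  rw [law, tilted_apply' _ _ hS, lintegral_indicator hS, ← lintegral_const_mul _ measurable_weight]
  refine lintegral_congr fun a => ?_
  rw [weight, div_eq_inv_mul, ENNReal.ofReal_mul]
  exact inv_nonneg.mpr (integral_nonneg fun _ => (Real.exp_pos _).le)

/-- The normalising constant is eliminated through the total mass one, so no Gaussian integral is
evaluated. -/
theorem law_le_of_lintegral_le [IsProbabilityMeasure (law N M)] {S : Set (tridiagonal N M)}
    (hS : MeasurableSet S) {δ : ENNReal}
    (h : ∫⁻ a, S.indicator weight a ∂Measure.addHaar ≤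
      δ * ∫⁻ a : tridiagonal N M, weight a ∂Measure.addHaar) : law N M S ≤ δ := by
  have h1 : law N M Set.univ = 1 := measure_univ
  rw [law_apply MeasurableSet.univ] at h1
  simp only [Set.indicator_univ] at h1
  rw [law_apply hS, ← mul_one δ, ← h1, mul_left_comm]
  exact mul_le_mul_right h _

instance : MeasurableAdd₂ (tridiagonal N M) :=
  ⟨measurable_to_tridiagonal fun i j p q =>
    ((measurable_entry i j p q).comp measurable_fst).add
      ((measurable_entry i j p q).comp measurable_snd)⟩

instance : MeasurableNeg (tridiagonal N M) :=
  ⟨measurable_to_tridiagonal fun i j p q => (measurable_entry i j p q).neg⟩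

instance : MeasurableSub₂ (tridiagonal N M) :=
  ⟨measurable_to_tridiagonal fun i j p q =>
    ((measurable_entry i j p q).comp measurable_fst).sub
      ((measurable_entry i j p q).comp measurable_snd)⟩

instance : SecondCountableTopology (tridiagonal N M) :=
  have : SecondCountableTopology (BlockMatrix N M) :=
    inferInstanceAs (SecondCountableTopology (Fin N → Fin N → Fin M → Fin M → ℝ))
  inferInstanceAs (SecondCountableTopology ((tridiagonal N M : Set (BlockMatrix N M))))

/-- Conditional estimates on a coordinate subspace integrate to estimates for the law. -/
theorem law_le_of_fiber [IsProbabilityMeasure (law N M)] {ι : Type*} [Fintype ι]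
    (L : (ι → ℝ) →+ tridiagonal N M) (π : tridiagonal N M →+ (ι → ℝ)) (hL : Measurable L)
    (hπ : Measurable π) (hπL : ∀ x, π (L x) = x)
    (hdisj : ∀ a, π a = 0 → ∀ x i j p q, a.1 i j p q * (L x).1 i j p q = 0)
    {S : Set (tridiagonal N M)} (hS : MeasurableSet S) {δ : ENNReal} (hδ : δ ≠ ⊤)
    (h : ∀ a, π a = 0 → ∫⁻ x, {x | a + L x ∈ S}.indicator (fun x => weight (L x)) x ≤
      δ * ∫⁻ x, weight (L x)) : law N M S ≤ δ := by
  refine law_le_of_lintegral_le hS ?_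
  rw [← lintegral_const_mul' _ _ hδ]
  refine lintegral_le_of_fiber Measure.addHaar volume L π hL hπ hπL (Set.Icc 0 1)
    measurableSet_Icc (by simp [Real.volume_Icc_pi]) (measurable_weight.indicator hS)
    (measurable_weight.const_mul _) fun a ha => ?_
  -- Disjoint supports make the energy additive, so the density factorises. This is the independence
  -- of the coordinate subspace from the rest.
  have hw : ∀ x, weight (a + L x) = weight a * weight (L x) := by
    intro x
    rw [weight, weight, weight, Submodule.coe_add, energy_add (hdisj a ha x), mul_add,
      Real.exp_add, ENNReal.ofReal_mul (Real.exp_pos _).le]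
  have hw' : ∀ x, S.indicator weight (a + L x) =
      weight a * {x | a + L x ∈ S}.indicator (fun x => weight (L x)) x := by
    intro x
    by_cases hx : a + L x ∈ S
    · rw [Set.indicator_of_mem hx, Set.indicator_of_mem (by exact hx), hw]
    · rw [Set.indicator_of_notMem hx, Set.indicator_of_notMem (by exact hx), mul_zero]
  simp only [hw', hw]
  have hne : weight a ≠ ⊤ := ENNReal.ofReal_ne_top
  rw [lintegral_const_mul' _ _ hne]
  simp only [mul_left_comm δ]
  rw [lintegral_const_mul' _ _ hne, lintegral_const_mul' _ _ hδ]
  exact mul_le_mul_right (h a ha) _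

/-- The symmetric block at position `(p, p)`. -/
noncomputable def diagBlock (p : Fin N) : (Sym2 (Fin M) → ℝ) →+ tridiagonal N M where
  toFun x := ⟨fun i j => if i = p ∧ j = p then symMat x else 0, mem_tridiagonal.mpr ⟨by
    intro i j
    by_cases h : i = p ∧ j = p
    · rw [if_pos h, if_pos h.symm, symMat_transpose]
    · rw [if_neg h, if_neg fun h' => h h'.symm, Matrix.transpose_zero], by
    intro i j hij
    refine if_neg ?_
    rintro ⟨rfl, rfl⟩
    simp at hij⟩⟩
  map_zero' := by
    ext i j u v
    change (if i = p ∧ j = p then symMat 0 else 0) u v = (0 : ℝ)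
    split_ifs <;> simp [symMat_apply]
  map_add' x y := by
    ext i j u v
    change (if i = p ∧ j = p then symMat (x + y) else 0) u v =
      (if i = p ∧ j = p then symMat x else 0) u v + (if i = p ∧ j = p then symMat y else 0) u v
    split_ifs <;> simp [symMat_apply]

theorem diagBlock_self (p : Fin N) (x : Sym2 (Fin M) → ℝ) :
    (diagBlock p x).1 p p = symMat x := if_pos ⟨rfl, rfl⟩

theorem diagBlock_of_ne {p i j : Fin N} (h : ¬ (i = p ∧ j = p)) (x : Sym2 (Fin M) → ℝ) :
    (diagBlock p x).1 i j = 0 := if_neg h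

/-- The matrix whose only nonzero column is the `j`-th one. -/
def colMat (j : Fin M) (x : Fin M → ℝ) : Matrix (Fin M) (Fin M) ℝ :=
  fun u v => if v = j then x u else 0

/-- The `j`-th column of the block at position `(k, k + 1)`. -/
def colBlock (k : ℕ) (j : Fin M) : (Fin M → ℝ) →+ tridiagonal N M where
  toFun x := ⟨fun i i' => if i.1 = k ∧ i'.1 = k + 1 then colMat j x else
      if i'.1 = k ∧ i.1 = k + 1 then (colMat j x)ᵀ else 0, mem_tridiagonal.mpr ⟨by
    intro i i'
    by_cases h : i.1 = k ∧ i'.1 = k + 1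
    · rw [if_pos h, if_neg (by omega), if_pos h, Matrix.transpose_transpose]
    · rw [if_neg h]
      by_cases h' : i'.1 = k ∧ i.1 = k + 1
      · rw [if_pos h', if_neg h, if_pos h']
      · rw [if_neg h', if_neg h', if_neg h, Matrix.transpose_zero], by
    intro i i' hij
    have h1 : ¬ (i.1 = k ∧ i'.1 = k + 1) := by
      rintro ⟨h, h'⟩; rw [h, h'] at hij; push_cast at hij; norm_num at hij
    have h2 : ¬ (i'.1 = k ∧ i.1 = k + 1) := by
      rintro ⟨h, h'⟩; rw [h, h'] at hij; push_cast at hij; norm_num at hij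
    rw [if_neg h1, if_neg h2]⟩⟩
  map_zero' := by
    ext i i' u v
    change (if i.1 = k ∧ i'.1 = k + 1 then colMat j 0 else
      if i'.1 = k ∧ i.1 = k + 1 then (colMat j 0)ᵀ else 0) u v = (0 : ℝ)
    split_ifs <;> simp [colMat]
  map_add' x y := by
    ext i i' u v
    change (if i.1 = k ∧ i'.1 = k + 1 then colMat j (x + y) else
      if i'.1 = k ∧ i.1 = k + 1 then (colMat j (x + y))ᵀ else 0) u v =
      (if i.1 = k ∧ i'.1 = k + 1 then colMat j x else
        if i'.1 = k ∧ i.1 = k + 1 then (colMat j x)ᵀ else 0) u v +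
      (if i.1 = k ∧ i'.1 = k + 1 then colMat j y else
        if i'.1 = k ∧ i.1 = k + 1 then (colMat j y)ᵀ else 0) u v
    split_ifs
    · simp only [colMat, Pi.add_apply]; split_ifs <;> simp
    · simp only [colMat, Matrix.transpose_apply, Pi.add_apply]; split_ifs <;> simp
    · exact (add_zero (0 : ℝ)).symm

theorem colBlock_apply (k : ℕ) (j : Fin M) (x : Fin M → ℝ) (i i' : Fin N) :
    (colBlock k j x : tridiagonal N M).1 i i' = if i.1 = k ∧ i'.1 = k + 1 then colMat j x else
      if i'.1 = k ∧ i.1 = k + 1 then (colMat j x)ᵀ else 0 := rfl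

theorem energy_diagBlock (p : Fin N) (x : Sym2 (Fin M) → ℝ) :
    energy (diagBlock p x).1 = frobSq (symMat x) := by
  rw [energy_eq_sum, Finset.sum_eq_single p, Finset.sum_eq_single p, diagBlock_self]
  · intro j _ hj
    rw [diagBlock_of_ne (fun h => hj h.2)]; simp [frobSq]
  · simp
  · intro i _ hi
    refine Finset.sum_eq_zero fun j _ => ?_
    rw [diagBlock_of_ne (fun h => hi h.1)]; simp [frobSq]
  · simp

theorem frobSq_colMat (j : Fin M) (x : Fin M → ℝ) : frobSq (colMat j x) = ∑ i, x i ^ 2 := by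
  simp [frobSq, colMat, ite_pow]

/-- The factor two comes from the transposed copy in the mirrored block, so off-diagonal columns
have Gaussian rate `M / 2`. -/
theorem energy_colBlock (k : ℕ) (hk : k + 1 < N) (j : Fin M) (x : Fin M → ℝ) :
    energy (colBlock k j x : tridiagonal N M).1 = 2 * ∑ i, x i ^ 2 := by
  have h : ∀ i i' : Fin N, frobSq ((colBlock k j x).1 i i') =
      (if i = ⟨k, by omega⟩ then if i' = ⟨k + 1, hk⟩ then ∑ i, x i ^ 2 else 0 else 0) +
      if i = ⟨k + 1, hk⟩ then if i' = ⟨k, by omega⟩ then ∑ i, x i ^ 2 else 0 else 0 := by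
    intro i i'
    rw [colBlock_apply]
    simp only [Fin.ext_iff]
    by_cases h1 : i.1 = k
    · by_cases h2 : i'.1 = k + 1
      · simp [h1, h2, frobSq_colMat]
      · simp [h1, h2, frobSq]
    · by_cases h2 : i'.1 = k
      · by_cases h3 : i.1 = k + 1
        · simp [h2, h3, frobSq_transpose, frobSq_colMat]
        · simp [h1, h2, h3, frobSq]
      · simp [h1, h2, frobSq]
  rw [energy_eq_sum]
  simp only [h, Finset.sum_add_distrib, Finset.sum_ite_eq', Finset.mem_univ, if_true,
    Finset.sum_const_zero, Finset.sum_ite_irrel]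
  ring

theorem weight_diagBlock (p : Fin N) (x : Sym2 (Fin M) → ℝ) :
    weight (diagBlock p x) = gaussWeight (M / 4) 0 x := by
  rw [weight, energy_diagBlock, gaussWeight]
  simp [frobSq, symMat_apply]

theorem weight_colBlock (k : ℕ) (hk : k + 1 < N) (j : Fin M) (x : Fin M → ℝ) :
    weight (colBlock k j x : tridiagonal N M) = ENNReal.ofReal
      (Real.exp (-((M : ℝ) / 2) * ∑ i, x i ^ 2)) := by
  rw [weight, energy_colBlock k hk]; congr 2; ring

/-- The base point has a vanishing block, so `x` parametrises the block itself; conditionally on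
everything else it is a centred Gaussian. -/
theorem law_le_of_diagBlock [IsProbabilityMeasure (law N M)] (p : Fin N)
    {S : Set (tridiagonal N M)} (hS : MeasurableSet S) {δ : ENNReal} (hδ : δ ≠ ⊤)
    (h : ∀ a : tridiagonal N M, a.1 p p = 0 →
      ∫⁻ x, {x | a + diagBlock p x ∈ S}.indicator (gaussWeight ((M : ℝ) / 4) 0) x ≤
      δ * ∫⁻ x, gaussWeight ((M : ℝ) / 4) (0 : Sym2 (Fin M) → ℝ) x) : law N M S ≤ δ := by
  have hsym : ∀ a : tridiagonal N M, symCoord (a.1 p p) = 0 → a.1 p p = 0 := by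
    intro a ha
    rw [← symMat_symCoord (transpose_apply_of_mem a p p), ha]
    ext u v; simp [symMat_apply]
  refine law_le_of_fiber (diagBlock p)
    ⟨⟨fun a => symCoord (a.1 p p), ?_⟩, ?_⟩ ?_ ?_ ?_ ?_ hS hδ ?_
  · funext z
    induction z using Sym2.ind with
    | _ i j => simp
  · intro a b
    funext z
    induction z using Sym2.ind with
    | _ i j =>
      simp only [Submodule.coe_add, Matrix.add_apply, symCoord_mk, Pi.add_apply]
      ring
  · refine measurable_to_tridiagonal fun i j u v => ?_
    by_cases hij : i = p ∧ j = p
    · obtain ⟨rfl, rfl⟩ := hij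
      simp only [diagBlock_self, symMat_apply]
      exact measurable_pi_apply _
    · simp only [diagBlock_of_ne hij]
      exact measurable_const
  · refine measurable_pi_lambda _ fun z => ?_
    induction z using Sym2.ind with
    | _ i j => exact ((measurable_entry p p i j).add (measurable_entry p p j i)).div_const 2
  · intro x
    change symCoord ((diagBlock p x).1 p p) = x
    rw [diagBlock_self, symCoord_symMat]
  · intro a ha x i j u v
    by_cases hij : i = p ∧ j = p
    · obtain ⟨rfl, rfl⟩ := hij
      rw [hsym a ha]; simp
    · rw [diagBlock_of_ne hij]; simp
  · intro a ha
    simp only [weight_diagBlock]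
    exact h a (hsym a ha)

theorem law_le_of_colBlock [IsProbabilityMeasure (law N M)] (k : ℕ) (hk : k + 1 < N) (j : Fin M)
    {S : Set (tridiagonal N M)} (hS : MeasurableSet S) {δ : ENNReal} (hδ : δ ≠ ⊤)
    (h : ∀ a : tridiagonal N M, (∀ i, a.1 ⟨k, by omega⟩ ⟨k + 1, hk⟩ i j = 0) →
      ∫⁻ x, {x | a + colBlock k j x ∈ S}.indicator
        (fun x => ENNReal.ofReal (Real.exp (-((M : ℝ) / 2) * ∑ i, x i ^ 2))) x ≤
      δ * ∫⁻ x : Fin M → ℝ, ENNReal.ofReal (Real.exp (-((M : ℝ) / 2) * ∑ i, x i ^ 2))) :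
    law N M S ≤ δ := by
  refine law_le_of_fiber (colBlock k j)
    ⟨⟨fun a i => a.1 ⟨k, by omega⟩ ⟨k + 1, hk⟩ i j, rfl⟩, fun _ _ => rfl⟩ ?_ ?_ ?_ ?_ hS hδ ?_
  · refine measurable_to_tridiagonal fun i i' u v => ?_
    simp only [colBlock_apply]
    split_ifs
    · simp only [colMat]
      split_ifs
      · exact measurable_pi_apply _
      · exact measurable_const
    · simp only [colMat, Matrix.transpose_apply]
      split_ifs
      · exact measurable_pi_apply _
      · exact measurable_const
    · exact measurable_const
  · exact measurable_pi_lambda _ fun i => measurable_entry _ _ _ _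
  · intro x
    funext i
    change (colBlock k j x).1 ⟨k, by omega⟩ ⟨k + 1, hk⟩ i j = x i
    simp [colBlock_apply, colMat]
  · intro a ha x i i' u v
    have ha' : ∀ i, a.1 ⟨k, by omega⟩ ⟨k + 1, hk⟩ i j = 0 := fun i => congrFun ha i
    rw [colBlock_apply]
    by_cases h1 : i.1 = k ∧ i'.1 = k + 1
    · rw [if_pos h1]
      obtain ⟨i, hi⟩ := i
      obtain ⟨i', hi'⟩ := i'
      obtain ⟨h1, h2⟩ := h1
      dsimp only at h1 h2
      subst h1 h2
      by_cases hv : v = j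
      · rw [hv, ha', zero_mul]
      · simp [colMat, hv]
    · rw [if_neg h1]
      by_cases h2 : i'.1 = k ∧ i.1 = k + 1
      · rw [if_pos h2, ← transpose_apply_of_mem]
        obtain ⟨i, hi⟩ := i
        obtain ⟨i', hi'⟩ := i'
        obtain ⟨h1, h2⟩ := h2
        dsimp only at h1 h2
        subst h1 h2
        by_cases hv : u = j
        · rw [hv, Matrix.transpose_apply, ha', zero_mul]
        · simp [colMat, hv]
      · rw [if_neg h2]; simp
  · intro a ha
    simp only [weight_colBlock k hk]
    exact h a fun i => congrFun ha i

end Tridiagonal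

/-! ### Exponential tails of Gaussian linear forms -/

section Tail

theorem lintegral_abs_tail_le {E : Type*} [MeasurableSpace E] [AddCommGroup E] [MeasurableAdd E]
    [MeasurableNeg E] [MeasurableSub E] (ν : Measure E) [ν.IsAddRightInvariant] {w : E → ENNReal}
    (hw : Measurable w) {ℓ : E → ℝ}
    (hℓ : Measurable ℓ) (h : E) (c r : ℝ)
    (H₁ : ∀ x, ENNReal.ofReal (Real.exp (ℓ x)) * w x ≤ ENNReal.ofReal (Real.exp c) * w (x - h))
    (H₂ : ∀ x, ENNReal.ofReal (Real.exp (-ℓ x)) * w x ≤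
      ENNReal.ofReal (Real.exp c) * w (x - -h)) :
    ∫⁻ x, {x | r < |ℓ x|}.indicator w x ∂ν ≤
      ENNReal.ofReal (2 * Real.exp (c - r)) * ∫⁻ x, w x ∂ν := by
  have h1 := lintegral_tail_le ν hw ℓ h c r H₁
  have h2 := lintegral_tail_le ν hw (fun x => -ℓ x) (-h) c r H₂
  calc ∫⁻ x, {x | r < |ℓ x|}.indicator w x ∂ν
      ≤ ∫⁻ x, ({x | r < ℓ x}.indicator w x + {x | r < -ℓ x}.indicator w x) ∂ν := by
        refine lintegral_mono fun x => ?_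
        refine Set.indicator_apply_le' (fun hx => ?_) fun _ => zero_le
        rw [Set.mem_ofPred_eq] at hx
        rcases lt_abs.mp hx with h | h
        · rw [Set.indicator_of_mem (by exact h)]; exact le_self_add
        · rw [Set.indicator_of_mem (s := {x | r < -ℓ x}) (by exact h)]; exact le_add_self
    _ ≤ _ := by
        rw [lintegral_add_left (hw.indicator (measurableSet_lt measurable_const hℓ)), two_mul,
          ENNReal.ofReal_add (Real.exp_pos _).le (Real.exp_pos _).le, add_mul]
        exact add_le_add h1 h2

/-- Linear functionals of a Gaussian vector have exponential tails. -/
theorem lintegral_linear_tail {κ α : Type*} [Fintype κ] [Fintype α] (φ : κ → α) (u : α → ℝ)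
    {β b : ℝ} (hβ : 0 < β) :
    ∫⁻ x : α → ℝ, {x | b ^ 2 * ∑ k, u (φ k) ^ 2 < (∑ k, u (φ k) * x (φ k)) ^ 2}.indicator
      (fun x => ENNReal.ofReal (Real.exp (-β * ∑ k, x (φ k) ^ 2))) x ≤
    ENNReal.ofReal (2 * Real.exp (1 - b * √β)) *
      ∫⁻ x : α → ℝ, ENNReal.ofReal (Real.exp (-β * ∑ k, x (φ k) ^ 2)) := by
  set T := ∑ k, u (φ k) ^ 2
  have hT0 : 0 ≤ T := Finset.sum_nonneg fun _ _ => sq_nonneg _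
  have hmeas : Measurable fun x : α → ℝ =>
      ENNReal.ofReal (Real.exp (-β * ∑ k, x (φ k) ^ 2)) := by fun_prop
  have hcs : ∀ x : α → ℝ, (∑ k, u (φ k) * x (φ k)) ^ 2 ≤ T * ∑ k, x (φ k) ^ 2 := fun x =>
    Finset.sum_mul_sq_le_sq_mul_sq Finset.univ (fun k => u (φ k)) fun k => x (φ k)
  -- If all relevant coefficients vanish, Cauchy–Schwarz shows that the event is empty.
  rcases hT0.eq_or_lt with hT | hT
  · refine le_trans (le_of_eq ?_) (zero_le)
    rw [lintegral_eq_zero_iff' ?_]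
    · refine Filter.Eventually.of_forall fun x => Set.indicator_of_notMem ?_ _
      intro hx
      have h1 := hcs x
      rw [Set.mem_ofPred_eq, ← hT] at hx
      rw [← hT] at h1
      linarith
    · refine (hmeas.indicator (measurableSet_lt ?_ ?_)).aemeasurable <;> fun_prop
  -- Normalised so that tilting by `θ` times the linear form costs `θ² T / (4 β) = 1 / 4`, rounded
  -- up to `1`. An exponential tail is enough here, because it is used at `y`, a power of `M`.
  set θ := √β / √T
  have hsβ := Real.sqrt_pos.mpr hβ
  have hsT := Real.sqrt_pos.mpr hT
  have hθ : 0 < θ := div_pos hsβ hsT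
  have hθ2 : θ ^ 2 * T = β := by
    rw [div_pow, Real.sq_sqrt hβ.le, Real.sq_sqrt hT.le, div_mul_cancel₀ _ hT.ne']
  have key : ∀ (σ : ℝ) (_ : σ ^ 2 = 1) (x : α → ℝ),
      σ * (θ * ∑ k, u (φ k) * x (φ k)) + -β * ∑ k, x (φ k) ^ 2 ≤
        1 + -β * ∑ k, (x (φ k) - σ * (θ / (2 * β) * u (φ k))) ^ 2 := by
    intro σ hσ x
    have e : ∑ k, (x (φ k) - σ * (θ / (2 * β) * u (φ k))) ^ 2 = ∑ k, x (φ k) ^ 2 -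
        σ * (θ / β) * ∑ k, u (φ k) * x (φ k) + (θ / (2 * β)) ^ 2 * T := by
      simp only [T, Finset.mul_sum]
      rw [← Finset.sum_sub_distrib, ← Finset.sum_add_distrib]
      refine Finset.sum_congr rfl fun k _ => ?_
      have : (x (φ k) - σ * (θ / (2 * β) * u (φ k))) ^ 2 = x (φ k) ^ 2 -
        σ * (θ / β) * (u (φ k) * x (φ k)) + σ ^ 2 * ((θ / (2 * β)) ^ 2 * u (φ k) ^ 2) := by
        field_simp; ring
      rw [this, hσ, one_mul]
    have e2 : β * ((θ / (2 * β)) ^ 2 * T) = 1 / 4 := by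
      have : β * ((θ / (2 * β)) ^ 2 * T) = (θ ^ 2 * T) / (4 * β) := by field_simp; ring
      rw [this, hθ2]; field_simp
    have e3 : β * (σ * (θ / β) * ∑ k, u (φ k) * x (φ k)) =
        σ * (θ * ∑ k, u (φ k) * x (φ k)) := by field_simp
    rw [e]
    linarith
  have hsub : {x : α → ℝ | b ^ 2 * T < (∑ k, u (φ k) * x (φ k)) ^ 2} ⊆
      {x | b * √β < |θ * ∑ k, u (φ k) * x (φ k)|} := by
    intro x hx
    rw [Set.mem_ofPred_eq] at hx ⊢
    rw [abs_mul, abs_of_pos hθ]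
    have h1 : b * √T < |∑ k, u (φ k) * x (φ k)| := by
      refine lt_of_pow_lt_pow_left₀ 2 (abs_nonneg _) ?_
      rwa [sq_abs, mul_pow, Real.sq_sqrt hT.le]
    calc b * √β = θ * (b * √T) := by simp only [θ]; field_simp
      _ < _ := mul_lt_mul_of_pos_left h1 hθ
  refine (lintegral_mono fun x => Set.indicator_le_indicator_of_subset hsub
    (fun _ => zero_le) x).trans ?_
  refine lintegral_abs_tail_le volume hmeas (by fun_prop) (fun i => θ / (2 * β) * u i) 1 _
    (fun x => ?_) fun x => ?_
  · rw [← ENNReal.ofReal_mul (Real.exp_pos _).le, ← ENNReal.ofReal_mul (Real.exp_pos _).le,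
      ← Real.exp_add, ← Real.exp_add]
    refine ENNReal.ofReal_le_ofReal (Real.exp_le_exp.mpr ?_)
    have := key 1 (by norm_num) x
    simp only [one_mul] at this
    exact this
  · rw [← ENNReal.ofReal_mul (Real.exp_pos _).le, ← ENNReal.ofReal_mul (Real.exp_pos _).le,
      ← Real.exp_add, ← Real.exp_add]
    refine ENNReal.ofReal_le_ofReal (Real.exp_le_exp.mpr ?_)
    have := key (-1) (by norm_num) x
    simp only [neg_one_mul] at this
    exact this

/-- The trace pairs `X` only with the symmetric part of `T`, whose Frobenius norm is no larger.
Indexing by ordered pairs gives off-diagonal entries their double weight. -/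
theorem lintegral_trace_tail {ι : Type*} [Fintype ι] (T : Matrix ι ι ℝ) {β b : ℝ} (hβ : 0 < β) :
    ∫⁻ x, {x | b ^ 2 * frobSq T < ((symMat x * T).trace) ^ 2}.indicator (gaussWeight β 0) x ≤
    ENNReal.ofReal (2 * Real.exp (1 - b * √β)) * ∫⁻ x, gaussWeight β (0 : Sym2 ι → ℝ) x := by
  have h := lintegral_linear_tail (fun k : ι × ι => s(k.1, k.2)) (symCoord T) (b := b) hβ
  have e : (fun x : Sym2 ι → ℝ => ENNReal.ofReal (Real.exp (-β * ∑ k : ι × ι, x s(k.1, k.2) ^ 2)))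
      = gaussWeight β 0 := by
    funext x
    simp [gaussWeight, Fintype.sum_prod_type]
  rw [e] at h
  refine (lintegral_mono fun x => Set.indicator_le_indicator_of_subset ?_
    (fun _ => zero_le) x).trans h
  intro x hx
  rw [Set.mem_ofPred_eq] at hx ⊢
  have e1 : ∑ k : ι × ι, symCoord T s(k.1, k.2) * x s(k.1, k.2) = (symMat x * T).trace := by
    simp only [Matrix.trace, Matrix.diag, Matrix.mul_apply, Fintype.sum_prod_type, symCoord_mk,
      symMat_apply]
    have h1 : ∀ i j, (T i j + T j i) / 2 * x s(i, j) =
        1 / 2 * (x s(i, j) * T j i) + 1 / 2 * (x s(j, i) * T i j) := by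
      intro i j; rw [Sym2.eq_swap (a := j)]; ring
    simp only [h1, Finset.sum_add_distrib, ← Finset.mul_sum]
    rw [Finset.sum_comm (f := fun i j => x s(j, i) * T i j)]
    ring
  have e2 : ∑ k : ι × ι, symCoord T s(k.1, k.2) ^ 2 ≤ frobSq T := by
    simp only [Fintype.sum_prod_type, symCoord_mk, frobSq]
    have h1 : ∀ i j, ((T i j + T j i) / 2) ^ 2 ≤ 1 / 2 * T i j ^ 2 + 1 / 2 * T j i ^ 2 := by
      intro i j; nlinarith [sq_nonneg (T i j - T j i)]
    refine (Finset.sum_le_sum fun i _ => Finset.sum_le_sum fun j _ => h1 i j).trans ?_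
    simp only [Finset.sum_add_distrib, ← Finset.mul_sum]
    rw [Finset.sum_comm (f := fun i j => T j i ^ 2)]
    linarith
  rw [e1]
  exact lt_of_le_of_lt (mul_le_mul_of_nonneg_left e2 (sq_nonneg b)) hx

end Tail

/-! ### What each block of the chain depends on -/

section Chain

variable {N M : ℕ}

/-- Only the diagonal blocks up to `k` and the off-diagonal blocks before `k` enter; this is the
source of the independences used below. -/
theorem D_congr {lam : ℝ} {a a' : BlockMatrix N M} (k : ℕ) (hk : k < N)
    (h : ∀ i (hi : i < N), i ≤ k → a ⟨i, hi⟩ ⟨i, hi⟩ = a' ⟨i, hi⟩ ⟨i, hi⟩)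
    (h' : ∀ i (hi : i + 1 < N), i < k → B a i hi = B a' i hi) : D lam a k hk = D lam a' k hk := by
  induction k with
  | zero => rw [D, D, h 0 hk le_rfl]
  | succ k ih =>
    rw [D, D, h _ hk le_rfl, h' k hk (Nat.lt_succ_self k),
      ih _ (fun i hi hik => h i hi (hik.trans (Nat.le_succ k)))
        fun i hi hik => h' i hi (hik.trans (Nat.lt_succ_self k))]

theorem D_transpose (lam : ℝ) (a : tridiagonal N M) (k : ℕ) (hk : k < N) :
    (D lam a.1 k hk)ᵀ = D lam a.1 k hk := by
  induction k with
  | zero => rw [D, Matrix.transpose_sub, transpose_apply_of_mem]; simp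
  | succ k ih =>
    rw [D, Matrix.transpose_sub, Matrix.transpose_sub, transpose_apply_of_mem,
      Matrix.conjTranspose_eq_transpose_of_trivial]
    simp only [Matrix.transpose_smul, Matrix.transpose_one, Matrix.transpose_mul,
      Matrix.transpose_transpose, Matrix.transpose_nonsing_inv, ih, Matrix.mul_assoc]

theorem measurable_B (k : ℕ) (hk : k + 1 < N) (i j : Fin M) :
    Measurable fun a : tridiagonal N M => B a.1 k hk i j :=
  (measurable_entry _ _ i j).neg

theorem measurable_mul_apply {α : Type*} [MeasurableSpace α] {f g : α → Matrix (Fin M) (Fin M) ℝ}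
    (hf : ∀ i j, Measurable fun a => f a i j) (hg : ∀ i j, Measurable fun a => g a i j)
    (i j : Fin M) : Measurable fun a => (f a * g a) i j := by
  simp only [Matrix.mul_apply]
  exact Finset.measurable_sum _ fun l _ => (hf i l).mul (hg l j)

theorem measurable_D (lam : ℝ) (k : ℕ) (hk : k < N) (i j : Fin M) :
    Measurable fun a : tridiagonal N M => D lam a.1 k hk i j := by
  induction k generalizing i j with
  | zero => exact (measurable_entry _ _ i j).sub measurable_const
  | succ k ih =>
    simp only [D, Matrix.sub_apply]
    refine ((measurable_entry _ _ i j).sub measurable_const).sub ?_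
    refine measurable_mul_apply (measurable_mul_apply ?_ ?_) (measurable_B k hk) i j
    · exact fun u v => measurable_B k hk v u
    · exact measurable_inv_apply (ih _)

theorem measurable_Q (lam : ℝ) (k : ℕ) (hk : k + 1 < N) (i j : Fin M) :
    Measurable fun a : tridiagonal N M => Q lam a.1 k hk i j :=
  measurable_mul_apply (measurable_mul_apply (fun u v => measurable_B k hk v u)
    (measurable_inv_apply (measurable_D lam k _))) (measurable_B k hk) i j

theorem add_diagBlock_of_ne (a : tridiagonal N M) {p i j : Fin N} (h : ¬ (i = p ∧ j = p))
    (x : Sym2 (Fin M) → ℝ) : (a + diagBlock p x).1 i j = a.1 i j := by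
  rw [Submodule.coe_add, Matrix.add_apply, diagBlock_of_ne h, add_zero]

theorem B_add_diagBlock (a : tridiagonal N M) (p : Fin N) (x : Sym2 (Fin M) → ℝ) (k : ℕ)
    (hk : k + 1 < N) : B (a + diagBlock p x).1 k hk = B a.1 k hk := by
  rw [B, B, add_diagBlock_of_ne]
  rintro ⟨h1, h2⟩
  rw [← h2] at h1
  simp at h1

theorem D_add_diagBlock_of_lt (lam : ℝ) (a : tridiagonal N M) {p : Fin N}
    (x : Sym2 (Fin M) → ℝ) {k : ℕ} (hk : k < N) (hkp : k < p) :
    D lam (a + diagBlock p x).1 k hk = D lam a.1 k hk := by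
  refine D_congr k hk (fun i hi hik => add_diagBlock_of_ne a ?_ x)
    fun i hi _ => B_add_diagBlock a p x i hi
  rintro ⟨h, -⟩
  rw [← h] at hkp
  exact absurd hkp (not_lt.mpr hik)

theorem D_add_diagBlock (lam : ℝ) (a : tridiagonal N M) (k : ℕ) (hk : k < N)
    (x : Sym2 (Fin M) → ℝ) :
    D lam (a + diagBlock ⟨k, hk⟩ x).1 k hk = symMat x + D lam a.1 k hk := by
  cases k with
  | zero =>
    rw [D, D, Submodule.coe_add, Matrix.add_apply, diagBlock_self]; abel
  | succ k =>
    rw [D, D, B_add_diagBlock, D_add_diagBlock_of_lt _ _ _ _ (Nat.lt_succ_self k),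
      Submodule.coe_add, Matrix.add_apply, diagBlock_self]
    abel

theorem D_add_colBlock (lam : ℝ) (a : tridiagonal N M) {k : ℕ} (hk : k < N) (j : Fin M)
    (x : Fin M → ℝ) : D lam (a + colBlock k j x).1 k hk = D lam a.1 k hk := by
  refine D_congr k hk (fun i hi _ => ?_) fun i hi hik => ?_
  · rw [Submodule.coe_add, Matrix.add_apply, colBlock_apply, if_neg (by dsimp only; omega),
      if_neg (by dsimp only; omega), add_zero]
  · rw [B, B, Submodule.coe_add, Matrix.add_apply, colBlock_apply, if_neg (by dsimp only; omega),
      if_neg (by dsimp only; omega), add_zero]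

theorem B_add_colBlock (a : tridiagonal N M) {k : ℕ} (hk : k + 1 < N) (j : Fin M)
    (x : Fin M → ℝ) : B (a + colBlock k j x).1 k hk = B a.1 k hk - colMat j x := by
  rw [B, B, Submodule.coe_add, Matrix.add_apply, colBlock_apply, if_pos ⟨rfl, rfl⟩, neg_add,
    sub_eq_add_neg]

end Chain

/-- Markov's inequality for the number of exceptional indices. The small ball probabilities are only
of order `1 / y` and would not survive a union bound over columns, but a quarter of exceptional
columns can be tolerated. -/
theorem measure_card_filter_le {α ι : Type*} [MeasurableSpace α] [Fintype ι] (μ : Measure α)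
    {S : ι → Set α} (hS : ∀ j, MeasurableSet (S j)) {δ : ENNReal} (h : ∀ j, μ (S j) ≤ δ)
    [∀ a, DecidablePred fun j => a ∈ S j] :
    μ {a | (Fintype.card ι : ℝ) < 4 * (Finset.univ.filter fun j => a ∈ S j).card} ≤ 4 * δ := by
  rcases isEmpty_or_nonempty ι with hι | hι
  · simp
  have hcard : (Fintype.card ι : ENNReal) ≠ 0 := by simp
  have h1 : ∫⁻ a, ∑ j, (S j).indicator (fun _ => 4) a ∂μ ≤ 4 * (Fintype.card ι * δ) := by
    rw [lintegral_finsetSum _ fun j _ => measurable_const.indicator (hS j), ← nsmul_eq_mul,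
      ← Finset.card_univ, ← Finset.sum_const, Finset.mul_sum]
    refine Finset.sum_le_sum fun j _ => ?_
    rw [lintegral_indicator_const (hS j)]
    exact mul_le_mul_right (h j) _
  have h2 : {a | (Fintype.card ι : ℝ) < 4 * (Finset.univ.filter fun j => a ∈ S j).card} ⊆
      {a | (Fintype.card ι : ENNReal) ≤ ∑ j, (S j).indicator (fun _ => 4) a} := by
    intro a ha
    rw [Set.mem_ofPred_eq] at ha ⊢
    have e : ∑ j, (S j).indicator (fun _ => (4 : ENNReal)) a =
        ((4 * (Finset.univ.filter fun j => a ∈ S j).card : ℕ) : ENNReal) := by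
      simp only [Set.indicator_apply]
      rw [← Finset.sum_filter, Finset.sum_const, nsmul_eq_mul, mul_comm]
      push_cast; rfl
    rw [e]
    have : Fintype.card ι ≤ 4 * (Finset.univ.filter fun j => a ∈ S j).card := by
      have : (Fintype.card ι : ℝ) < ((4 * (Finset.univ.filter fun j => a ∈ S j).card : ℕ) : ℝ) := by
        push_cast; exact ha
      exact (Nat.cast_lt.mp this).le
    exact_mod_cast this
  refine (measure_mono h2).trans ((meas_ge_le_lintegral_div ?_ hcard (by simp)).trans ?_)
  · exact (Finset.measurable_sum _ fun j _ => measurable_const.indicator (hS j)).aemeasurable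
  · refine ENNReal.div_le_of_le_mul ?_
    exact h1.trans (le_of_eq (by ring))

/-! ### Conditional estimates for the law -/

section Law

variable {N M : ℕ} [IsProbabilityMeasure (law N M)]

theorem measurable_symCoord {α : Type*} [MeasurableSpace α] {F : α → Matrix (Fin M) (Fin M) ℝ}
    (hF : ∀ i j, Measurable fun a => F a i j) : Measurable fun a => symCoord (F a) := by
  refine measurable_pi_lambda _ fun z => ?_
  induction z using Sym2.ind with
  | _ i j => exact ((hF i j).add (hF j i)).div_const 2

theorem measurable_frobSq {α : Type*} [MeasurableSpace α] {F : α → Matrix (Fin M) (Fin M) ℝ}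
    (hF : ∀ i j, Measurable fun a => F a i j) : Measurable fun a => frobSq (F a) :=
  Finset.measurable_sum _ fun i _ => Finset.measurable_sum _ fun j _ => (hF i j).pow_const 2

theorem measurable_trace {α : Type*} [MeasurableSpace α] {F : α → Matrix (Fin M) (Fin M) ℝ}
    (hF : ∀ i j, Measurable fun a => F a i j) : Measurable fun a => (F a).trace :=
  Finset.measurable_sum _ fun i _ => hF i i

/-- Events that only concern a matrix containing the `p`-th diagonal block additively. -/
theorem law_diag_le (p : Fin N) {F : tridiagonal N M → Matrix (Fin M) (Fin M) ℝ}
    (hF : ∀ i j, Measurable fun a => F a i j)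
    (hadd : ∀ a x, F (a + diagBlock p x) = symMat x + F a)
    {U : Set (Sym2 (Fin M) → ℝ)} (hU : MeasurableSet U) {δ : ENNReal} (hδ : δ ≠ ⊤)
    (h : ∀ S, ∫⁻ x, U.indicator (gaussWeight ((M : ℝ) / 4) S) x ≤
      δ * ∫⁻ x, gaussWeight ((M : ℝ) / 4) S x) :
    law N M {a | symCoord (F a) ∈ U} ≤ δ := by
  have hms : MeasurableSet {a | symCoord (F a) ∈ U} := measurable_symCoord hF hU
  refine law_le_of_diagBlock p hms hδ fun a _ => ?_
  set S := symCoord (F a)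
  have hc : ∀ x, symCoord (F (a + diagBlock p x)) = x + S := by
    intro x
    rw [hadd]
    funext z
    induction z using Sym2.ind with
    | _ i j =>
      simp only [S, symCoord_mk, Matrix.add_apply, symMat_apply, Pi.add_apply, Sym2.eq_swap (a := j)]
      ring
  have hw : ∀ x, gaussWeight ((M : ℝ) / 4) S (x + S) = gaussWeight ((M : ℝ) / 4) 0 x := by
    intro x; simp [gaussWeight]
  have h1 : ∀ x, {x | a + diagBlock p x ∈ {a | symCoord (F a) ∈ U}}.indicator
      (gaussWeight ((M : ℝ) / 4) 0) x = U.indicator (gaussWeight ((M : ℝ) / 4) S) (x + S) := by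
    intro x
    by_cases hx : x + S ∈ U
    · rw [Set.indicator_of_mem hx, hw, Set.indicator_of_mem]
      rw [Set.mem_ofPred_eq, Set.mem_ofPred_eq, hc]; exact hx
    · rw [Set.indicator_of_notMem hx, Set.indicator_of_notMem]
      rw [Set.mem_ofPred_eq, Set.mem_ofPred_eq, hc]; exact hx
  simp only [h1, ← hw]
  rw [lintegral_add_right_eq_self (fun x => U.indicator (gaussWeight ((M : ℝ) / 4) S) x) S,
    lintegral_add_right_eq_self (fun x => gaussWeight ((M : ℝ) / 4) S x) S]
  exact h S

theorem law_diag_tail (hM : 0 < M) (p : Fin N) {T : tridiagonal N M → Matrix (Fin M) (Fin M) ℝ}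
    (hT : ∀ i j, Measurable fun a => T a i j) (hadd : ∀ a x, T (a + diagBlock p x) = T a) (b : ℝ) :
    law N M {a | b ^ 2 * frobSq (T a) < (a.1 p p * T a).trace ^ 2} ≤
      ENNReal.ofReal (2 * Real.exp (1 - b * √((M : ℝ) / 4))) := by
  have hms : MeasurableSet {a | b ^ 2 * frobSq (T a) < (a.1 p p * T a).trace ^ 2} :=
    measurableSet_lt ((measurable_frobSq hT).const_mul _)
      ((measurable_trace (measurable_mul_apply (measurable_entry p p) hT)).pow_const 2)
  refine law_le_of_diagBlock p hms ENNReal.ofReal_ne_top fun a ha => ?_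
  have h := lintegral_trace_tail (T a) (β := (M : ℝ) / 4) (b := b) (by positivity)
  refine (lintegral_mono fun x => Set.indicator_le_indicator_of_subset (fun x hx => ?_)
    (fun _ => zero_le) x).trans h
  have e : (a + diagBlock p x).1 p p = symMat x := by
    rw [Submodule.coe_add, Matrix.add_apply, ha, diagBlock_self, zero_add]
  rw [Set.mem_ofPred_eq, Set.mem_ofPred_eq, hadd, e] at hx
  exact hx

theorem law_col_tail (hM : 0 < M) (k : ℕ) (hk : k + 1 < N) (j : Fin M)
    {t : tridiagonal N M → Fin M → ℝ} (ht : ∀ i, Measurable fun a => t a i)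
    (hadd : ∀ a x, t (a + colBlock k j x) = t a) (b : ℝ) :
    law N M {a | b ^ 2 * ∑ i, t a i ^ 2 < (∑ i, t a i * B a.1 k hk i j) ^ 2} ≤
      ENNReal.ofReal (2 * Real.exp (1 - b * √((M : ℝ) / 2))) := by
  have hms : MeasurableSet
      {a | b ^ 2 * ∑ i, t a i ^ 2 < (∑ i, t a i * B a.1 k hk i j) ^ 2} := measurableSet_lt
    ((Finset.measurable_sum _ fun i _ => (ht i).pow_const 2).const_mul _)
    ((Finset.measurable_sum _ fun i _ => (ht i).mul (measurable_B k hk i j)).pow_const 2)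
  refine law_le_of_colBlock k hk j hms ENNReal.ofReal_ne_top fun a ha => ?_
  have h := lintegral_linear_tail (id : Fin M → Fin M) (t a) (β := (M : ℝ) / 2) (b := b)
    (by positivity)
  refine (lintegral_mono fun x => Set.indicator_le_indicator_of_subset (fun x hx => ?_)
    (fun _ => zero_le) x).trans h
  have hB : ∀ i, B (a + colBlock k j x).1 k hk i j = -x i := by
    intro i
    rw [B_add_colBlock, Matrix.sub_apply]
    have : B a.1 k hk i j = 0 := by rw [B, Matrix.neg_apply, ha i, neg_zero]
    rw [this]; simp [colMat]
  rw [Set.mem_ofPred_eq, Set.mem_ofPred_eq, hadd] at hx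
  simp only [hB, mul_neg, Finset.sum_neg_distrib, neg_sq] at hx
  exact hx

/-- Conditionally on the other entries the `j`-th column is Gaussian and `W` is fixed. Positivity of
the trace is part of the event because for `W = 0` the inequality would always hold. -/
theorem law_col_small_ball (hM : 0 < M) (k : ℕ) (hk : k + 1 < N) (j : Fin M)
    {W : tridiagonal N M → Matrix (Fin M) (Fin M) ℝ} (hW : ∀ u v, Measurable fun a => W a u v)
    (hpos : ∀ a, (W a).PosSemidef) (hadd : ∀ a x, W (a + colBlock k j x) = W a)
    {s : ℝ} (hs : 0 < s) :
    law N M {a | 0 < (W a).trace ∧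
      (fun i => B a.1 k hk i j) ⬝ᵥ W a *ᵥ (fun i => B a.1 k hk i j) ≤ s * (W a).trace / M} ≤
      ENNReal.ofReal (Real.exp 1 * √s) := by
  have hM' : (0 : ℝ) < M := Nat.cast_pos.mpr hM
  have hmeas : Measurable fun a : tridiagonal N M =>
      (fun i => B a.1 k hk i j) ⬝ᵥ W a *ᵥ (fun i => B a.1 k hk i j) := by
    simp only [dotProduct, Matrix.mulVec]
    exact Finset.measurable_sum _ fun u _ => (measurable_B k hk u j).mul
      (Finset.measurable_sum _ fun v _ => (hW u v).mul (measurable_B k hk v j))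
  have hms : MeasurableSet {a | 0 < (W a).trace ∧ (fun i => B a.1 k hk i j) ⬝ᵥ W a *ᵥ
      (fun i => B a.1 k hk i j) ≤ s * (W a).trace / M} :=
    (measurableSet_lt measurable_const (measurable_trace hW)).inter
      (measurableSet_le hmeas (((measurable_trace hW).const_mul _).div_const _))
  refine law_le_of_colBlock k hk j hms ENNReal.ofReal_ne_top fun a ha => ?_
  have hB : ∀ x : Fin M → ℝ, (fun i => B (a + colBlock k j x).1 k hk i j) = -x := by
    intro x
    funext i
    rw [B_add_colBlock, Matrix.sub_apply]
    have : B a.1 k hk i j = 0 := by rw [B, Matrix.neg_apply, ha i, neg_zero]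
    rw [this]; simp [colMat]
  rcases le_or_gt (W a).trace 0 with h0 | h0
  · refine le_trans (le_of_eq ((lintegral_congr fun x => Set.indicator_of_notMem ?_ _).trans
      lintegral_zero)) zero_le
    rintro ⟨h1, -⟩
    rw [hadd] at h1
    exact absurd h1 (not_lt.mpr h0)
  · have h := lintegral_small_ball_le (W a) (hpos a) (γ := (M : ℝ) / 2)
      (b := s * (W a).trace / M) (by positivity) (by positivity) 0
    simp only [Pi.zero_apply, sub_zero] at h
    refine (lintegral_mono fun x => Set.indicator_le_indicator_of_subset ?_
      (fun _ => zero_le) x).trans (h.trans (mul_le_mul_left (ENNReal.ofReal_le_ofReal ?_) _))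
    · rintro x ⟨-, h2⟩
      rw [hadd, hB] at h2
      simpa [Matrix.mulVec_neg] using h2
    · refine mul_le_mul_of_nonneg_left ?_ (Real.exp_pos 1).le
      -- At rate `M / 2` the threshold makes the ratio `2 / s`, and `(1 + 2 / s) ^ (-1 / 2) ≤ √s`.
      have e : (W a).trace / ((M : ℝ) / 2 * (s * (W a).trace / M)) = 2 / s := by field_simp
      rw [e, Real.sqrt_eq_rpow]
      have h1 : s ^ (1 / 2 : ℝ) = (s⁻¹) ^ (-(1 / 2) : ℝ) := by
        rw [Real.inv_rpow hs.le, Real.rpow_neg hs.le, inv_inv]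
      rw [h1]
      refine Real.rpow_le_rpow_of_nonpos (inv_pos.mpr hs) ?_ (by norm_num)
      rw [div_eq_mul_inv]
      have := inv_pos.mpr hs
      linarith

/-- `D_k` is a freely varying symmetric block plus an independent shift, and singular symmetric
matrices form a null set. -/
theorem law_not_isUnit_D (lam : ℝ) (k : ℕ) (hk : k < N) :
    law N M {a | ¬ IsUnit (D lam a.1 k hk)} = 0 := by
  have hU : MeasurableSet {x : Sym2 (Fin M) → ℝ | (symMat x).det = 0} := by
    refine measurableSet_eq_fun (measurable_det measurable_symMat) measurable_const
  have h := law_diag_le ⟨k, hk⟩ (measurable_D lam k hk) (D_add_diagBlock lam · k hk) hU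
    (δ := 0) ENNReal.zero_ne_top fun S => ?_
  · refine le_antisymm ((measure_mono ?_).trans h) zero_le
    intro a ha
    rw [Set.mem_ofPred_eq, Matrix.isUnit_iff_isUnit_det, isUnit_iff_ne_zero, not_not] at ha
    rw [Set.mem_ofPred_eq, Set.mem_ofPred_eq, symMat_symCoord (D_transpose lam a k hk)]
    exact ha
  · rw [zero_mul, nonpos_iff_eq_zero, lintegral_indicator hU, Measure.restrict_eq_zero.mpr,
      lintegral_zero_measure]
    have := ae_det_symMat_ne_zero (κ := Fin M)
    rw [ae_iff] at this
    simpa using this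

end Law

theorem measure_exists_exists_le {α : Type*} [MeasurableSpace α] {M : ℕ} (μ : Measure α)
    {p : Fin M → Fin M → α → Prop} {ρ : ℝ} (h : ∀ i j, μ {a | p i j a} ≤ ENNReal.ofReal ρ) :
    μ {a | ∃ i j, p i j a} ≤ ENNReal.ofReal ((M : ℝ) ^ 2 * ρ) := by
  have e : {a | ∃ i j, p i j a} = ⋃ i, ⋃ j, {a | p i j a} := by ext a; simp
  rw [e]
  refine (measure_iUnion_fintype_le _ _).trans
    ((Finset.sum_le_sum fun i _ => (measure_iUnion_fintype_le _ _).trans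
      (Finset.sum_le_sum fun j _ => h i j)).trans (le_of_eq ?_))
  simp only [Finset.sum_const, Finset.card_univ, Fintype.card_fin, nsmul_eq_mul]
  rw [ENNReal.ofReal_mul (by positivity), ← mul_assoc, pow_two,
    ENNReal.ofReal_mul (Nat.cast_nonneg _), ENNReal.ofReal_natCast]

theorem div_sqrt_mul_sqrt {M : ℕ} (hM : 0 < M) (y : ℝ) : y / √M * √((M : ℝ) / 4) = y / 2 := by
  have h4 : √(4 : ℝ) = 2 := by rw [show (4 : ℝ) = 2 ^ 2 by norm_num]; exact Real.sqrt_sq (by norm_num)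
  have : 0 < √(M : ℝ) := Real.sqrt_pos.mpr (Nat.cast_pos.mpr hM)
  rw [Real.sqrt_div (Nat.cast_nonneg _), h4]
  field_simp

theorem div_sqrt_sq (M : ℕ) (y : ℝ) : (y / √M) ^ 2 = y ^ 2 / M := by
  rw [div_pow, Real.sq_sqrt (Nat.cast_nonneg _)]

/-! ### Gram matrices avoiding one column -/

section Gram

variable {N M : ℕ}

/-- Varying the `j`-th column of `B` changes no other column of `X * B`; this is why diagonal
entries of `Bᵀ X B` are treated separately. -/
theorem mul_B_add_colBlock {k : ℕ} (hk : k + 1 < N)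
    {X : tridiagonal N M → Matrix (Fin M) (Fin M) ℝ} (hadd : ∀ j a x, X (a + colBlock k j x) = X a)
    (a : tridiagonal N M) {i j : Fin M} (hij : i ≠ j) (l : Fin M) (x : Fin M → ℝ) :
    (X (a + colBlock k j x) * B (a + colBlock k j x).1 k hk) l i = (X a * B a.1 k hk) l i := by
  rw [hadd, B_add_colBlock, Matrix.mul_sub, Matrix.sub_apply, sub_eq_self, Matrix.mul_apply]
  exact Finset.sum_eq_zero fun u _ => by rw [colMat, if_neg hij, mul_zero]

/-- The Gram matrix of the columns of `Y` other than the `j`-th one. -/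
def gramExcept (Y : Matrix (Fin M) (Fin M) ℝ) (j : Fin M) : Matrix (Fin M) (Fin M) ℝ :=
  Matrix.of fun u v => ∑ i, if i = j then 0 else Y u i * Y v i

theorem dotProduct_gramExcept (Y : Matrix (Fin M) (Fin M) ℝ) (j : Fin M) (c : Fin M → ℝ) :
    c ⬝ᵥ gramExcept Y j *ᵥ c = ∑ i, if i = j then 0 else (∑ u, c u * Y u i) ^ 2 := by
  simp only [dotProduct, Matrix.mulVec, gramExcept, Matrix.of_apply, Finset.sum_mul,
    Finset.mul_sum]
  rw [Finset.sum_congr rfl fun u _ => Finset.sum_comm, Finset.sum_comm]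
  refine Finset.sum_congr rfl fun i _ => ?_
  split_ifs with h
  · simp
  · rw [pow_two, Finset.sum_mul_sum]
    exact Finset.sum_congr rfl fun u _ => Finset.sum_congr rfl fun v _ => by ring

theorem trace_gramExcept (Y : Matrix (Fin M) (Fin M) ℝ) (j : Fin M) :
    (gramExcept Y j).trace = ∑ i, if i = j then 0 else ∑ l, Y l i ^ 2 := by
  simp only [Matrix.trace, Matrix.diag, gramExcept, Matrix.of_apply]
  rw [Finset.sum_comm]
  refine Finset.sum_congr rfl fun i _ => ?_
  split_ifs with h
  · simp
  · exact Finset.sum_congr rfl fun u _ => (pow_two _).symm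

theorem posSemidef_gramExcept (Y : Matrix (Fin M) (Fin M) ℝ) (j : Fin M) :
    (gramExcept Y j).PosSemidef := by
  refine Matrix.PosSemidef.of_dotProduct_mulVec_nonneg ?_ fun x => ?_
  · ext u v
    simp [gramExcept, mul_comm]
  · rw [star_trivial, dotProduct_gramExcept]
    exact Finset.sum_nonneg fun i _ => by split_ifs <;> positivity

end Gram

/-! ### Probabilities of the exceptional events at scale `y` -/

section Events

variable {N M : ℕ} [IsProbabilityMeasure (law N M)] {y : ℝ}

theorem law_trace_mul_gt (hM : 0 < M) (p : Fin N)
    {T : tridiagonal N M → Matrix (Fin M) (Fin M) ℝ}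
    (hT : ∀ i j, Measurable fun a => T a i j) (hadd : ∀ a x, T (a + diagBlock p x) = T a) (y : ℝ) :
    law N M {a | y ^ 2 / M * frobSq (T a) < (a.1 p p * T a).trace ^ 2} ≤
      ENNReal.ofReal (2 * Real.exp (1 - y / 2)) := by
  have h := law_diag_tail hM p hT hadd (y / √M)
  rwa [div_sqrt_mul_sqrt hM, div_sqrt_sq] at h

theorem law_sum_mul_gt (hM : 0 < M) (hy : 0 ≤ y) (k : ℕ) (hk : k + 1 < N) (j : Fin M)
    {t : tridiagonal N M → Fin M → ℝ} (ht : ∀ i, Measurable fun a => t a i)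
    (hadd : ∀ a x, t (a + colBlock k j x) = t a) :
    law N M {a | y ^ 2 / M * ∑ i, t a i ^ 2 < (∑ i, t a i * B a.1 k hk i j) ^ 2} ≤
      ENNReal.ofReal (2 * Real.exp (1 - y / 2)) := by
  have h := law_col_tail hM k hk j ht hadd (y / √M)
  rw [div_sqrt_sq] at h
  -- The column rate `M / 2` is weakened to the diagonal rate `M / 4`, so that all linear tails
  -- share one bound.
  refine h.trans (ENNReal.ofReal_le_ofReal (mul_le_mul_of_nonneg_left
    (Real.exp_le_exp.mpr (sub_le_sub_left ?_ 1)) zero_le_two))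
  rw [← div_sqrt_mul_sqrt hM]
  refine mul_le_mul_of_nonneg_left (Real.sqrt_le_sqrt ?_) (by positivity)
  have : (0 : ℝ) ≤ M := Nat.cast_nonneg _
  linarith

theorem law_exists_diag_entry_gt (hM : 0 < M) (p : Fin N) (y : ℝ) :
    law N M {a | ∃ i j, y ^ 2 / M < a.1 p p i j ^ 2} ≤
      ENNReal.ofReal ((M : ℝ) ^ 2 * (2 * Real.exp (1 - y / 2))) := by
  refine measure_exists_exists_le _ fun i j => ?_
  have h := law_trace_mul_gt hM p (T := fun _ => Matrix.single j i 1)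
    (fun _ _ => measurable_const) (fun _ _ => rfl) y
  have e : frobSq (Matrix.single j i (1 : ℝ)) = 1 := by
    simp [frobSq, Matrix.single_apply, ite_and, ite_pow]
  have e' : ∀ X : Matrix (Fin M) (Fin M) ℝ, (X * Matrix.single j i (1 : ℝ)).trace = X i j := by
    intro X
    rw [Matrix.trace_mul_single]; simp
  simp only [e, e', mul_one] at h
  exact h

theorem law_exists_B_entry_gt (hM : 0 < M) (hy : 0 ≤ y) (k : ℕ) (hk : k + 1 < N) :
    law N M {a | ∃ i j, y ^ 2 / M < B a.1 k hk i j ^ 2} ≤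
      ENNReal.ofReal ((M : ℝ) ^ 2 * (2 * Real.exp (1 - y / 2))) := by
  refine measure_exists_exists_le _ fun i j => ?_
  have h := law_sum_mul_gt hM hy k hk j (t := fun _ => Pi.single i 1)
    (fun _ => measurable_const) (fun _ _ => rfl)
  simpa [Pi.single_apply, ite_pow] using h

theorem law_exists_mul_B_gt (hM : 0 < M) (hy : 0 ≤ y) (k : ℕ) (hk : k + 1 < N)
    {X : tridiagonal N M → Matrix (Fin M) (Fin M) ℝ} (hX : ∀ u v, Measurable fun a => X a u v)
    (hadd : ∀ j a x, X (a + colBlock k j x) = X a) :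
    law N M {a | ∃ i j, y ^ 2 / M * ∑ l, X a i l ^ 2 < (X a * B a.1 k hk) i j ^ 2} ≤
      ENNReal.ofReal ((M : ℝ) ^ 2 * (2 * Real.exp (1 - y / 2))) := by
  refine measure_exists_exists_le _ fun i j => ?_
  simp only [Matrix.mul_apply]
  exact law_sum_mul_gt hM hy k hk j (t := fun a l => X a i l) (fun l => hX i l)
    (fun a x => by rw [hadd])

theorem law_exists_conj_gt (hM : 0 < M) (hy : 0 ≤ y) (k : ℕ) (hk : k + 1 < N)
    {X : tridiagonal N M → Matrix (Fin M) (Fin M) ℝ} (hX : ∀ u v, Measurable fun a => X a u v)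
    (hadd : ∀ j a x, X (a + colBlock k j x) = X a) :
    law N M {a | ∃ i j, i ≠ j ∧ y ^ 2 / M * ∑ l, (X a * B a.1 k hk) l j ^ 2 <
        ((B a.1 k hk)ᵀ * X a * B a.1 k hk) i j ^ 2} ≤
      ENNReal.ofReal ((M : ℝ) ^ 2 * (2 * Real.exp (1 - y / 2))) := by
  refine measure_exists_exists_le _ fun i j => ?_
  -- For `i ≠ j` the entry is linear in the `i`-th column of `B`, with coefficients from the `j`-th
  -- column of `X * B`, which does not involve it.
  by_cases hij : i = j
  · simp [hij]
  have h := law_sum_mul_gt hM hy k hk i (t := fun a l => (X a * B a.1 k hk) l j)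
    (fun l => measurable_mul_apply hX (measurable_B k hk) l j)
    (fun a x => funext fun l => mul_B_add_colBlock hk hadd a (Ne.symm hij) l x)
  refine (measure_mono ?_).trans h
  rintro a ⟨-, ha⟩
  have e : ((B a.1 k hk)ᵀ * X a * B a.1 k hk) i j =
      ∑ l, (X a * B a.1 k hk) l j * B a.1 k hk l i := by
    rw [Matrix.mul_assoc, Matrix.mul_apply]
    exact Finset.sum_congr rfl fun l _ => mul_comm _ _
  rw [e] at ha
  exact ha

/-- The regularisation is `η = y ^ (-2)`, so that the failure probability, of order `√η`, is of
order `1 / y`. -/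
theorem law_trace_regInv_gt (hM : 8 ≤ M) (hy : 1 ≤ y) (p : Fin N)
    {F : tridiagonal N M → Matrix (Fin M) (Fin M) ℝ}
    (hF : ∀ i j, Measurable fun a => F a i j) (hsymm : ∀ a, (F a)ᵀ = F a)
    (hadd : ∀ a x, F (a + diagBlock p x) = symMat x + F a) :
    law N M {a | (M : ℝ) / (4 * (y⁻¹ ^ 2) ^ 2) < (regInv (y⁻¹ ^ 2) (F a)).trace} ≤
      ENNReal.ofReal (28 * y⁻¹) := by
  have hy0 : 0 < y := by linarith
  have h := law_diag_le p hF hadd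
    (U := {x | (M : ℝ) / (4 * (y⁻¹ ^ 2) ^ 2) < (regInv (y⁻¹ ^ 2) (symMat x)).trace})
    (measurableSet_lt measurable_const (measurable_trace_regInv _))
    (δ := ENNReal.ofReal (28 * y⁻¹)) ENNReal.ofReal_ne_top fun S => by
      have h := lintegral_trace_regInv_le S (η := y⁻¹ ^ 2) (by positivity)
        (pow_le_one₀ (by positivity) (inv_le_one_of_one_le₀ hy)) (by simpa using hM)
      rwa [Fintype.card_fin, Real.sqrt_sq (by positivity)] at h
  refine (measure_mono fun a ha => ?_).trans h
  rw [Set.mem_ofPred_eq] at ha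
  rw [Set.mem_ofPred_eq, Set.mem_ofPred_eq, symMat_symCoord (hsymm a)]
  exact ha

/-- The scale is natural: at rate `β = M / 4` the factor `√(β M)` is `M / 2`, so exceeding `M y`
costs `1 / y`. -/
theorem law_frobSq_inv_D_gt (hM : 0 < M) (hy : 0 < y) (lam : ℝ) (k : ℕ) (hk : k < N) :
    law N M {a | (M * y) ^ 2 < frobSq (D lam a.1 k hk)⁻¹} ≤
      ENNReal.ofReal (24 * Real.exp 4 * y⁻¹) := by
  have hM' : (0 : ℝ) < M := Nat.cast_pos.mpr hM
  have h := law_diag_le ⟨k, hk⟩ (measurable_D lam k hk) (D_add_diagBlock lam · k hk)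
    (U := {x | (M * y) ^ 2 < frobSq (symMat x)⁻¹})
    (measurableSet_lt measurable_const
      (measurable_frobSq (measurable_inv_apply measurable_symMat)))
    (δ := ENNReal.ofReal (24 * Real.exp 4 * y⁻¹)) ENNReal.ofReal_ne_top fun S => by
      have h := lintegral_inv_frobSq_le S (β := (M : ℝ) / 4) (t := M * y) (by positivity)
        (by positivity)
      have e : √((M : ℝ) / 4 * Fintype.card (Fin M)) = M / 2 := by
        rw [Fintype.card_fin, show (M : ℝ) / 4 * M = (M / 2) ^ 2 by ring]
        exact Real.sqrt_sq (by positivity)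
      have e' : 48 * Real.exp 4 * ((M : ℝ) / 2 / (M * y)) = 24 * Real.exp 4 * y⁻¹ := by
        field_simp; norm_num
      rwa [e, e'] at h
  refine (measure_mono fun a ha => ?_).trans h
  rw [Set.mem_ofPred_eq] at ha
  rw [Set.mem_ofPred_eq, Set.mem_ofPred_eq, symMat_symCoord (D_transpose lam a k hk)]
  exact ha

open Classical in
-- The squared norm of a column of `X * B` is the quadratic form `XᵀX` in the corresponding column
-- of `B`.
theorem law_card_mul_B_le (hM : 0 < M) (hy : 0 < y) (k : ℕ) (hk : k + 1 < N)
    {X : tridiagonal N M → Matrix (Fin M) (Fin M) ℝ} (hX : ∀ u v, Measurable fun a => X a u v)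
    (hadd : ∀ j a x, X (a + colBlock k j x) = X a) :
    law N M {a | (M : ℝ) < 4 * (Finset.univ.filter fun j => 0 < frobSq (X a) ∧
        ∑ l, (X a * B a.1 k hk) l j ^ 2 ≤ y⁻¹ ^ 2 * frobSq (X a) / M).card} ≤
      ENNReal.ofReal (4 * (Real.exp 1 * y⁻¹)) := by
  have hm : ∀ u v, Measurable fun a => ((X a)ᵀ * X a) u v :=
    measurable_mul_apply (fun u v => hX v u) hX
  have hms : ∀ j, MeasurableSet {a | 0 < frobSq (X a) ∧
      ∑ l, (X a * B a.1 k hk) l j ^ 2 ≤ y⁻¹ ^ 2 * frobSq (X a) / M} := fun j =>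
    (measurableSet_lt measurable_const (measurable_frobSq hX)).inter (measurableSet_le
      (Finset.measurable_sum _ fun l _ =>
        (measurable_mul_apply hX (measurable_B k hk) l j).pow_const 2)
      (((measurable_frobSq hX).const_mul _).div_const _))
  have h := measure_card_filter_le (law N M) hms (δ := ENNReal.ofReal (Real.exp 1 * y⁻¹))
    fun j => by
      have h := law_col_small_ball hM k hk j hm
        (fun a => by
          have := Matrix.posSemidef_conjTranspose_mul_self (X a)
          rwa [Matrix.conjTranspose_eq_transpose_of_trivial] at this)
        (fun a x => by rw [hadd]) (s := y⁻¹ ^ 2) (by positivity)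
      rw [Real.sqrt_sq (by positivity)] at h
      refine (measure_mono fun a ha => ?_).trans h
      rw [Set.mem_ofPred_eq] at ha ⊢
      rw [← frobSq_eq_trace]
      refine ⟨ha.1, le_trans (le_of_eq ?_) ha.2⟩
      rw [← Matrix.mulVec_mulVec, Matrix.dotProduct_mulVec, ← Matrix.mulVec_transpose,
        Matrix.transpose_transpose]
      exact Finset.sum_congr rfl fun l _ => (pow_two _).symm
  rw [Fintype.card_fin, ← ENNReal.ofReal_ofNat 4, ← ENNReal.ofReal_mul (by norm_num)] at h
  exact h

open Classical in
-- The off-diagonal part of row `j` of `Bᵀ X B` is a quadratic form in column `j` of `B`, with the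
-- Gram matrix of the other columns of `X * B`, which is independent of that column.
theorem law_card_conj_le (hM : 0 < M) (hy : 0 < y) (k : ℕ) (hk : k + 1 < N)
    {X : tridiagonal N M → Matrix (Fin M) (Fin M) ℝ} (hX : ∀ u v, Measurable fun a => X a u v)
    (hadd : ∀ j a x, X (a + colBlock k j x) = X a) :
    law N M {a | (M : ℝ) < 4 * (Finset.univ.filter fun j =>
        0 < (∑ i, if i = j then 0 else ∑ l, (X a * B a.1 k hk) l i ^ 2) ∧
        ∑ i, (if i = j then 0 else ((B a.1 k hk)ᵀ * X a * B a.1 k hk) j i ^ 2) ≤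
      y⁻¹ ^ 2 * (∑ i, if i = j then 0 else ∑ l, (X a * B a.1 k hk) l i ^ 2) / M).card} ≤
      ENNReal.ofReal (4 * (Real.exp 1 * y⁻¹)) := by
  have hY : ∀ u v, Measurable fun a => (X a * B a.1 k hk) u v :=
    measurable_mul_apply hX (measurable_B k hk)
  have hm : ∀ j u v, Measurable fun a => gramExcept (X a * B a.1 k hk) j u v := by
    intro j u v
    simp only [gramExcept, Matrix.of_apply]
    refine Finset.measurable_sum _ fun i _ => ?_
    split_ifs
    · exact measurable_const
    · exact (hY u i).mul (hY v i)
  have he : ∀ (a : tridiagonal N M) j,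
      (fun u => B a.1 k hk u j) ⬝ᵥ gramExcept (X a * B a.1 k hk) j *ᵥ (fun u => B a.1 k hk u j) =
      ∑ i, (if i = j then 0 else ((B a.1 k hk)ᵀ * X a * B a.1 k hk) j i ^ 2) := by
    intro a j
    rw [dotProduct_gramExcept]
    refine Finset.sum_congr rfl fun i _ => ?_
    rw [Matrix.mul_assoc, Matrix.mul_apply]
    rfl
  have hmt : ∀ j, Measurable fun a => (gramExcept (X a * B a.1 k hk) j).trace :=
    fun j => measurable_trace (hm j)
  have hmq : ∀ j, Measurable fun a : tridiagonal N M =>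
      (∑ i, if i = j then 0 else ((B a.1 k hk)ᵀ * X a * B a.1 k hk) j i ^ 2) := by
    intro j
    refine Finset.measurable_sum _ fun i _ => ?_
    split_ifs
    · exact measurable_const
    · exact (measurable_mul_apply (measurable_mul_apply (fun u v => measurable_B k hk v u) hX)
        (measurable_B k hk) j i).pow_const 2
  simp only [← trace_gramExcept]
  have hms : ∀ j, MeasurableSet {a | 0 < (gramExcept (X a * B a.1 k hk) j).trace ∧
      (∑ i, if i = j then 0 else ((B a.1 k hk)ᵀ * X a * B a.1 k hk) j i ^ 2) ≤
        y⁻¹ ^ 2 * (gramExcept (X a * B a.1 k hk) j).trace / M} := fun j =>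
    (measurableSet_lt measurable_const (hmt j)).inter (measurableSet_le (hmq j)
      (((hmt j).const_mul _).div_const _))
  have h := measure_card_filter_le (law N M) hms (δ := ENNReal.ofReal (Real.exp 1 * y⁻¹))
    fun j => by
      have h := law_col_small_ball hM k hk j (hm j) (fun a => posSemidef_gramExcept _ _)
        (fun a x => by
          ext u v
          simp only [gramExcept, Matrix.of_apply]
          refine Finset.sum_congr rfl fun i _ => ?_
          split_ifs with hij
          · rfl
          · rw [mul_B_add_colBlock hk hadd a hij, mul_B_add_colBlock hk hadd a hij])
        (s := y⁻¹ ^ 2) (by positivity)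
      rw [Real.sqrt_sq (by positivity)] at h
      simpa only [he] using h
  rw [Fintype.card_fin, ← ENNReal.ofReal_ofNat 4, ← ENNReal.ofReal_mul (by norm_num)] at h
  exact h

end Events

theorem measure_union_le_ofReal {α : Type*} [MeasurableSpace α] {μ : Measure α} {S T : Set α}
    {x y : ℝ} (hx : 0 ≤ x) (hy : 0 ≤ y) (hS : μ S ≤ ENNReal.ofReal x)
    (hT : μ T ≤ ENNReal.ofReal y) : μ (S ∪ T) ≤ ENNReal.ofReal (x + y) := by
  rw [ENNReal.ofReal_add hx hy]
  exact (measure_union_le S T).trans (add_le_add hS hT)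

theorem measure_union_null_le {α : Type*} [MeasurableSpace α] {μ : Measure α} {S T : Set α}
    {δ : ENNReal} (hS : μ S = 0) (hT : μ T ≤ δ) : μ (S ∪ T) ≤ δ :=
  (measure_union_le S T).trans (by rwa [hS, zero_add])

theorem frobSq_le_of_entry_le {M : ℕ} {X : Matrix (Fin M) (Fin M) ℝ} {c : ℝ}
    (h : ∀ i j, X i j ^ 2 ≤ c) : frobSq X ≤ (M : ℝ) ^ 2 * c := by
  refine (Finset.sum_le_sum fun i _ => Finset.sum_le_sum fun j _ => h i j).trans (le_of_eq ?_)
  simp only [Finset.sum_const, Finset.card_univ, Fintype.card_fin, nsmul_eq_mul]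
  ring

/-! ### Deterministic consequences at scale `y` -/

section Schur

variable {N M : ℕ} {y r : ℝ}

/-- The constant is `288 = 16 * 18`, where `18 M y ^ 8` covers three times the squared norms of the
terms in the bounded part of `D`. -/
theorem inv_lower_of_bound (hM : 0 < M) {F K : ℝ} (hF : 0 ≤ F) (hK : K ≤ 18 * M * y ^ 8)
    (h : ((M : ℝ) / 4) ^ 2 ≤ F * K) : (M : ℝ) ≤ 288 * y ^ 8 * F := by
  have hM' : (0 : ℝ) < M := Nat.cast_pos.mpr hM
  have h1 := h.trans (mul_le_mul_of_nonneg_left hK hF)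
  have h2 : (M : ℝ) * M ≤ M * (288 * y ^ 8 * F) := by nlinarith
  exact le_of_mul_le_mul_left h2 hM'

/-- The first block of the chain has no predecessor: the low rank part is zero. -/
theorem frobSq_inv_sub_smul_ge (hM : 0 < M) (hy : 1 ≤ y) (hr : r ^ 2 ≤ y ^ 2)
    {A : Matrix (Fin M) (Fin M) ℝ} (hA : ∀ i j, A i j ^ 2 ≤ y ^ 2 / M)
    (hu : IsUnit (A - r • 1)) : (M : ℝ) ≤ 288 * y ^ 8 * frobSq (A - r • 1)⁻¹ := by
  have hM' : (0 : ℝ) < M := Nat.cast_pos.mpr hM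
  have hA' : frobSq A ≤ M * y ^ 2 :=
    (frobSq_le_of_entry_le hA).trans (le_of_eq (by field_simp))
  have hu' : IsUnit (A - r • 1 + 0).det := by
    rw [add_zero]; exact (Matrix.isUnit_iff_isUnit_det _).mp hu
  have h := frobSq_inv_ge hu' (by rw [Matrix.rank_zero]; simp)
  rw [add_zero, Fintype.card_fin] at h
  refine inv_lower_of_bound hM (frobSq_nonneg _) ?_ h
  have h1 := frobSq_sub_sub_le A (r • 1) 0
  rw [sub_zero, frobSq_smul_one, Fintype.card_fin] at h1
  have h0 : frobSq (0 : Matrix (Fin M) (Fin M) ℝ) = 0 := by simp [frobSq]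
  have h2 : y ^ 2 ≤ y ^ 8 := pow_le_pow_right₀ hy (by norm_num)
  have h3 : r ^ 2 * M ≤ y ^ 2 * M := mul_le_mul_of_nonneg_right hr hM'.le
  have h4 : (M : ℝ) * y ^ 2 ≤ M * y ^ 8 := mul_le_mul_of_nonneg_left h2 hM'.le
  have h5 : 0 ≤ (M : ℝ) * y ^ 8 := by positivity
  linarith

theorem frobSq_schur_inv_lower (hM : 0 < M) (hy : 1 ≤ y) (hr : r ^ 2 ≤ y ^ 2)
    {D A B : Matrix (Fin M) (Fin M) ℝ} (hA : ∀ i j, A i j ^ 2 ≤ y ^ 2 / M)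
    (hB : ∀ i j, B i j ^ 2 ≤ y ^ 2 / M) (hD : Dᵀ = D) (hu : IsUnit D)
    (hT : (regInv (y⁻¹ ^ 2) D).trace ≤ M / (4 * (y⁻¹ ^ 2) ^ 2))
    (hu' : IsUnit (A - r • 1 - Bᵀ * D⁻¹ * B)) :
    (M : ℝ) ≤ 288 * y ^ 8 * frobSq (A - r • 1 - Bᵀ * D⁻¹ * B)⁻¹ := by
  have hM' : (0 : ℝ) < M := Nat.cast_pos.mpr hM
  have hy0 : 0 < y := by linarith
  have hA' : frobSq A ≤ M * y ^ 2 :=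
    (frobSq_le_of_entry_le hA).trans (le_of_eq (by field_simp))
  have hB' : frobSq B ≤ M * y ^ 2 :=
    (frobSq_le_of_entry_le hB).trans (le_of_eq (by field_simp))
  -- `τ = 2 y` turns the hypothesis on `B` into the available bound `frobSq B ≤ M y²`.
  have h := frobSq_schur_inv_ge (η := y⁻¹ ^ 2) (τ := 2 * y) (r := r) (A := A) (by positivity)
    (by positivity) hD ((Matrix.isUnit_iff_isUnit_det _).mp hu) (by rwa [Fintype.card_fin])
    (by rw [Fintype.card_fin]; refine hB'.trans (le_of_eq (by ring)))
    ((Matrix.isUnit_iff_isUnit_det _).mp hu')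
  rw [Fintype.card_fin] at h
  refine inv_lower_of_bound hM (frobSq_nonneg _) ?_ h
  have e : ((y⁻¹ ^ 2)⁻¹ * (2 * y)) ^ 2 = 4 * y ^ 6 := by field_simp; norm_num
  rw [e]
  have h2 : y ^ 2 ≤ y ^ 8 := pow_le_pow_right₀ hy (by norm_num)
  have h3 : r ^ 2 * M ≤ y ^ 2 * M := mul_le_mul_of_nonneg_right hr hM'.le
  have h4 : (M : ℝ) * y ^ 2 ≤ M * y ^ 8 := mul_le_mul_of_nonneg_left h2 hM'.le
  have h5 : 4 * y ^ 6 * frobSq B ≤ 4 * y ^ 6 * (M * y ^ 2) :=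
    mul_le_mul_of_nonneg_left hB' (by positivity)
  have h6 : 4 * y ^ 6 * (M * y ^ 2) = 4 * (M * y ^ 8) := by ring
  linarith

/-- `Bᵀ X B` is not small if few columns of `B` are exceptional for `X`. -/
theorem frobSq_conj_lower {X B : Matrix (Fin M) (Fin M) ℝ} {s : ℝ} (hM : 4 ≤ M) (hs : 0 < s)
    (hX : 0 < frobSq X) {J K : Finset (Fin M)}
    (hJ : ∀ j, j ∈ J ↔ 0 < frobSq X ∧ ∑ l, (X * B) l j ^ 2 ≤ s * frobSq X / M)
    (hK : ∀ j, j ∈ K ↔ 0 < (∑ i, if i = j then 0 else ∑ l, (X * B) l i ^ 2) ∧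
      ∑ i, (if i = j then 0 else (Bᵀ * X * B) j i ^ 2) ≤
        s * (∑ i, if i = j then 0 else ∑ l, (X * B) l i ^ 2) / M)
    (hJ4 : (4 * J.card : ℝ) ≤ M) (hK4 : (4 * K.card : ℝ) ≤ M) :
    3 / 8 * s ^ 2 * frobSq X ≤ frobSq (Bᵀ * X * B) := by
  have hM' : (4 : ℝ) ≤ M := by exact_mod_cast hM
  have hp : ∀ j, 0 < ∑ i, if i = j then 0 else ∑ l, (X * B) l i ^ 2 := by
    intro j
    have hnn : ∀ i ∈ Finset.univ, 0 ≤ if i = j then 0 else ∑ l, (X * B) l i ^ 2 := by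
      intro i _; split_ifs <;> positivity
    refine lt_of_le_of_ne (Finset.sum_nonneg hnn) fun h => ?_
    have hz := (Finset.sum_eq_zero_iff_of_nonneg hnn).mp h.symm
    -- If every other column of `X * B` vanished, all of them would be exceptional, contradicting
    -- that at most a quarter are.
    have hsub : Finset.univ.erase j ⊆ J := by
      intro i hi
      have h1 := hz i (Finset.mem_univ i)
      rw [if_neg (Finset.ne_of_mem_erase hi)] at h1
      rw [hJ, h1]
      exact ⟨hX, by positivity⟩
    have hc := Finset.card_le_card hsub
    rw [Finset.card_erase_of_mem (Finset.mem_univ j), Finset.card_univ, Fintype.card_fin] at hc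
    have : (M : ℝ) ≤ J.card + 1 := by
      have : M ≤ J.card + 1 := by omega
      exact_mod_cast this
    linarith
  refine frobSq_conj_ge hs.le (by rwa [Fintype.card_fin]) ?_ ?_
  · rw [Fintype.card_fin]
    refine le_trans (mul_le_mul_of_nonneg_left (Nat.cast_le.mpr (Finset.card_le_card ?_))
      (by norm_num)) hJ4
    intro j hj
    exact (hJ j).mpr ⟨hX, (Finset.mem_filter.mp hj).2⟩
  · rw [Fintype.card_fin]
    refine le_trans (mul_le_mul_of_nonneg_left (Nat.cast_le.mpr (Finset.card_le_card ?_))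
      (by norm_num)) hK4
    intro j hj
    exact (hK j).mpr ⟨hp j, (Finset.mem_filter.mp hj).2⟩

theorem Q_eq (lam : ℝ) (a : BlockMatrix N M) (k : ℕ) (hk : k + 1 < N) :
    Q lam a k hk = (B a k hk)ᵀ * (D lam a k (Nat.lt_of_succ_lt hk))⁻¹ * B a k hk := by
  rw [Q, Matrix.conjTranspose_eq_transpose_of_trivial]

theorem Q_add_diagBlock (lam : ℝ) (a : tridiagonal N M) (k : ℕ) (hk : k + 1 < N)
    (x : Sym2 (Fin M) → ℝ) : Q lam (a + diagBlock ⟨k + 1, hk⟩ x).1 k hk = Q lam a.1 k hk := by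
  rw [Q, Q, B_add_diagBlock, D_add_diagBlock_of_lt _ _ _ _ (Nat.lt_succ_self k)]

/-- Two-sided bounds for the Frobenius norms and bounds for the traces, in terms of the
auxiliary scale `y`. -/
structure Good (y : ℝ) (G Q : Matrix (Fin M) (Fin M) ℝ) : Prop where
  diag_lower : (M : ℝ) ≤ y ^ 16 * frobSq G
  diag_upper : frobSq G ≤ y ^ 16 * M
  conj_lower : (M : ℝ) ≤ y ^ 16 * frobSq Q
  conj_upper : frobSq Q ≤ y ^ 16 * (M : ℝ) ^ 2
  trace_sq : (G * Q).trace ^ 2 ≤ y ^ 10 * M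
  trace_diag_sq : G.trace ^ 2 ≤ y ^ 2 * M

/-- The hypotheses are the complements of the exceptional events. The lower bound `28 ≤ y` serves to
absorb numerical constants into powers of `y`. -/
theorem good_of_bounds (hM : 8 ≤ M) (hy : 28 ≤ y) {G X B : Matrix (Fin M) (Fin M) ℝ}
    {J K : Finset (Fin M)}
    (hJ : ∀ j, j ∈ J ↔ 0 < frobSq X ∧ ∑ l, (X * B) l j ^ 2 ≤ y⁻¹ ^ 2 * frobSq X / M)
    (hK : ∀ j, j ∈ K ↔ 0 < (∑ i, if i = j then 0 else ∑ l, (X * B) l i ^ 2) ∧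
      ∑ i, (if i = j then 0 else (Bᵀ * X * B) j i ^ 2) ≤
        y⁻¹ ^ 2 * (∑ i, if i = j then 0 else ∑ l, (X * B) l i ^ 2) / M)
    (hJ4 : (4 * J.card : ℝ) ≤ M) (hK4 : (4 * K.card : ℝ) ≤ M)
    (hsymm : Gᵀ = G) (hG : ∀ i j, G i j ^ 2 ≤ y ^ 2 / M)
    (hT : (regInv (y⁻¹ ^ 2) G).trace ≤ M / (4 * (y⁻¹ ^ 2) ^ 2))
    (hX : frobSq X ≤ (M * y) ^ 2) (hX' : (M : ℝ) ≤ 288 * y ^ 8 * frobSq X)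
    (hB : ∀ i j, B i j ^ 2 ≤ y ^ 2 / M)
    (hXB : ∀ i j, (X * B) i j ^ 2 ≤ y ^ 2 / M * ∑ l, X i l ^ 2)
    (hBXB : ∀ i j, i ≠ j → (Bᵀ * X * B) i j ^ 2 ≤ y ^ 2 / M * ∑ l, (X * B) l j ^ 2)
    (htr : (G * (Bᵀ * X * B)).trace ^ 2 ≤ y ^ 2 / M * frobSq (Bᵀ * X * B)) :
    Good y G (Bᵀ * X * B) := by
  have hM8 : (8 : ℝ) ≤ M := by exact_mod_cast hM
  have hM' : (0 : ℝ) < M := by linarith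
  have hy0 : 0 < y := by linarith
  have hy1 : 1 ≤ y := by linarith
  have hb : (y / √M) ^ 2 = y ^ 2 / M := div_sqrt_sq M y
  have hXpos : 0 < frobSq X := by
    by_contra h
    have : 288 * y ^ 8 * frobSq X ≤ 0 := mul_nonpos_of_nonneg_of_nonpos (by positivity)
      (not_lt.mp h)
    linarith
  have hup : frobSq (Bᵀ * X * B) ≤ y ^ 8 * (M : ℝ) ^ 2 := by
    have h := frobSq_conj_le (X := X) (B := B) (a := y / √M) (by rwa [hb]) (by rwa [hb])
      (by rwa [hb])
    rw [hb, Fintype.card_fin] at h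
    calc frobSq (Bᵀ * X * B) ≤ 2 * (M * (y ^ 2 / M)) ^ 2 * frobSq X := h
      _ ≤ 2 * (M * (y ^ 2 / M)) ^ 2 * (M * y) ^ 2 :=
          mul_le_mul_of_nonneg_left hX (by positivity)
      _ = 2 * (y ^ 6 * M ^ 2) := by field_simp
      _ ≤ y ^ 2 * (y ^ 6 * M ^ 2) := mul_le_mul_of_nonneg_right (by nlinarith) (by positivity)
      _ = _ := by ring
  refine ⟨?_, ?_, ?_, ?_, ?_, ?_⟩
  · have h := frobSq_ge_of_trace_regInv_le (η := y⁻¹ ^ 2) (by positivity) hsymm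
      (by rwa [Fintype.card_fin])
    rw [Fintype.card_fin] at h
    have h1 := mul_le_mul_of_nonneg_left h (by positivity : (0 : ℝ) ≤ 2 * y ^ 4)
    have e : 2 * y ^ 4 * ((M : ℝ) / 2 * (y⁻¹ ^ 2) ^ 2) = M := by field_simp
    rw [e] at h1
    refine h1.trans (mul_le_mul_of_nonneg_right ?_ (frobSq_nonneg G))
    calc 2 * y ^ 4 ≤ y * y ^ 4 := mul_le_mul_of_nonneg_right (by linarith) (by positivity)
      _ = y ^ 5 := by ring
      _ ≤ y ^ 16 := pow_le_pow_right₀ hy1 (by norm_num)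
  · refine (frobSq_le_of_entry_le hG).trans ?_
    have e : (M : ℝ) ^ 2 * (y ^ 2 / M) = y ^ 2 * M := by field_simp
    rw [e]
    exact mul_le_mul_of_nonneg_right (pow_le_pow_right₀ hy1 (by norm_num)) hM'.le
  · have h := frobSq_conj_lower (by omega) (by positivity) hXpos hJ hK hJ4 hK4
    have h1 : 3 * frobSq X ≤ 8 * y ^ 4 * frobSq (Bᵀ * X * B) := by
      have := mul_le_mul_of_nonneg_left h (by positivity : (0 : ℝ) ≤ 8 * y ^ 4)
      have e : 8 * y ^ 4 * (3 / 8 * (y⁻¹ ^ 2) ^ 2 * frobSq X) = 3 * frobSq X := by field_simp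
      rwa [e] at this
    have h2 := mul_le_mul_of_nonneg_left h1 (by positivity : (0 : ℝ) ≤ 96 * y ^ 8)
    have h3 : (M : ℝ) ≤ 768 * (y ^ 12 * frobSq (Bᵀ * X * B)) := by nlinarith
    have hQ : 0 ≤ y ^ 12 * frobSq (Bᵀ * X * B) := by
      have := frobSq_nonneg (Bᵀ * X * B)
      positivity
    have h4 : (768 : ℝ) ≤ y ^ 4 := by
      calc (768 : ℝ) ≤ 28 ^ 4 := by norm_num
        _ ≤ y ^ 4 := pow_le_pow_left₀ (by norm_num) hy 4
    calc (M : ℝ) ≤ 768 * (y ^ 12 * frobSq (Bᵀ * X * B)) := h3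
      _ ≤ y ^ 4 * (y ^ 12 * frobSq (Bᵀ * X * B)) := mul_le_mul_of_nonneg_right h4 hQ
      _ = _ := by ring
  · exact hup.trans (mul_le_mul_of_nonneg_right (pow_le_pow_right₀ hy1 (by norm_num))
      (by positivity))
  · refine htr.trans ((mul_le_mul_of_nonneg_left hup (by positivity)).trans (le_of_eq ?_))
    field_simp
  · have h := sq_sum_le_card_mul_sum_sq (s := Finset.univ) (f := fun i => G i i)
    rw [Finset.card_univ, Fintype.card_fin] at h
    refine h.trans ?_
    have : ∑ i, G i i ^ 2 ≤ ∑ _i : Fin M, y ^ 2 / M := Finset.sum_le_sum fun i _ => hG i i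
    rw [Finset.sum_const, Finset.card_univ, Fintype.card_fin, nsmul_eq_mul] at this
    calc (M : ℝ) * ∑ i, G i i ^ 2 ≤ M * (M * (y ^ 2 / M)) :=
          mul_le_mul_of_nonneg_left this hM'.le
      _ = _ := by field_simp

end Schur

/-! ### Union of the exceptional events -/

section Union

variable {N M : ℕ} [IsProbabilityMeasure (law N M)] {y lam : ℝ}

/-- For `k > 0` one Schur complement step from the preceding block suffices. It uses only that this
block is symmetric, invertible and has few small eigenvalues, which holds for every shift, so
nothing accumulates along the chain. -/
theorem law_frobSq_inv_D_lt (hM : 8 ≤ M) (hy : 1 ≤ y) (hlam : |lam| ≤ y) (k : ℕ) (hk : k < N) :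
    law N M {a | 288 * y ^ 8 * frobSq (D lam a.1 k hk)⁻¹ < M} ≤
      ENNReal.ofReal ((M : ℝ) ^ 2 * (2 * Real.exp (1 - y / 2)) +
        ((M : ℝ) ^ 2 * (2 * Real.exp (1 - y / 2)) + 28 * y⁻¹)) := by
  have hM0 : 0 < M := by omega
  have hy0 : 0 < y := by linarith
  have hlam2 : lam ^ 2 ≤ y ^ 2 := sq_le_sq' (neg_le_of_abs_le hlam) (le_of_abs_le hlam)
  have hunit := law_not_isUnit_D (M := M) lam k hk
  have hA := law_exists_diag_entry_gt hM0 (⟨k, hk⟩ : Fin N) y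
  cases k with
  | zero =>
    refine (measure_mono ?_).trans ((measure_union_null_le hunit hA).trans
      (ENNReal.ofReal_le_ofReal (le_add_of_nonneg_right (by positivity))))
    intro a ha
    by_contra h
    simp only [Set.mem_union, Set.mem_ofPred_eq, not_or, not_not, not_exists, not_lt] at h ha
    exact absurd (frobSq_inv_sub_smul_ge hM0 hy hlam2 h.2 h.1) (not_le.mpr ha)
  | succ k =>
    have hunit' := law_not_isUnit_D (M := M) lam k (Nat.lt_of_succ_lt hk)
    have hB := law_exists_B_entry_gt hM0 hy0.le k hk
    have hT := law_trace_regInv_gt hM hy (⟨k, Nat.lt_of_succ_lt hk⟩ : Fin N)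
      (measurable_D lam k _) (D_transpose lam · k _) (D_add_diagBlock lam · k _)
    refine (measure_mono ?_).trans (measure_union_null_le hunit (measure_union_null_le hunit'
      (measure_union_le_ofReal (by positivity) (by positivity) hA
        (measure_union_le_ofReal (by positivity) (by positivity) hB hT))))
    intro a ha
    by_contra h
    simp only [Set.mem_union, Set.mem_ofPred_eq, not_or, not_not, not_exists, not_lt] at h ha
    obtain ⟨h1, h2, h3, h4, h5⟩ := h
    rw [D, Matrix.conjTranspose_eq_transpose_of_trivial] at h1 ha
    exact absurd (frobSq_schur_inv_lower hM0 hy hlam2 h3 h4 (D_transpose lam a k _) h2 h5 h1)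
      (not_le.mpr ha)

theorem law_not_good_le (hM : 8 ≤ M) (hy : 28 ≤ y) (hlam : |lam| ≤ y) (k : ℕ) (hk : k + 1 < N) :
    law N M {a | ¬ Good y (a.1 ⟨k + 1, hk⟩ ⟨k + 1, hk⟩) (Q lam a.1 k hk)} ≤
      ENNReal.ofReal (2100 * y⁻¹ + 14 * (M : ℝ) ^ 2 * Real.exp (1 - y / 2)) := by
  classical
  have hM0 : 0 < M := by omega
  have hM1 : (1 : ℝ) ≤ M := by exact_mod_cast hM0
  have hy0 : 0 < y := by linarith
  have hy1 : 1 ≤ y := by linarith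
  have hXm : ∀ u v, Measurable fun a : tridiagonal N M =>
      (D lam a.1 k (Nat.lt_of_succ_lt hk))⁻¹ u v := measurable_inv_apply (measurable_D lam k _)
  have hXa : ∀ j (a : tridiagonal N M) x,
      (D lam (a + colBlock k j x).1 k (Nat.lt_of_succ_lt hk))⁻¹ =
        (D lam a.1 k (Nat.lt_of_succ_lt hk))⁻¹ := fun j a x => by rw [D_add_colBlock]
  set p : Fin N := ⟨k + 1, hk⟩
  have b1 := law_exists_diag_entry_gt hM0 p y
  have b2 := law_trace_regInv_gt hM hy1 p (measurable_entry p p)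
    (fun a => transpose_apply_of_mem a p p)
    (fun a x => by rw [Submodule.coe_add, Matrix.add_apply, diagBlock_self, add_comm])
  have b3 := law_frobSq_inv_D_gt hM0 hy0 lam k (Nat.lt_of_succ_lt hk)
  have b4 := law_frobSq_inv_D_lt hM hy1 hlam k (Nat.lt_of_succ_lt hk)
  have b5 := law_exists_B_entry_gt hM0 hy0.le k hk
  have b6 := law_exists_mul_B_gt hM0 hy0.le k hk hXm hXa
  have b7 := law_exists_conj_gt hM0 hy0.le k hk hXm hXa
  have b8 := law_trace_mul_gt hM0 p (measurable_Q lam k hk) (fun a x => Q_add_diagBlock lam a k hk x)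
    y
  have b9 := law_card_mul_B_le hM0 hy0 k hk hXm hXa
  have b10 := law_card_conj_le hM0 hy0 k hk hXm hXa
  refine (measure_mono ?_).trans ((measure_union_le_ofReal (by positivity) (by positivity) b1
    (measure_union_le_ofReal (by positivity) (by positivity) b2
    (measure_union_le_ofReal (by positivity) (by positivity) b3
    (measure_union_le_ofReal (by positivity) (by positivity) b4
    (measure_union_le_ofReal (by positivity) (by positivity) b5
    (measure_union_le_ofReal (by positivity) (by positivity) b6
    (measure_union_le_ofReal (by positivity) (by positivity) b7
    (measure_union_le_ofReal (by positivity) (by positivity) b8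
    (measure_union_le_ofReal (by positivity) (by positivity) b9 b10))))))))).trans
      (ENNReal.ofReal_le_ofReal ?_))
  · intro a ha
    by_contra h
    simp only [Set.mem_union, Set.mem_ofPred_eq, not_or, not_exists, not_and, not_lt] at h
    obtain ⟨h1, h2, h3, h4, h5, h6, h7, h8, h9, h10⟩ := h
    refine ha ?_
    rw [Q_eq] at h8 ⊢
    exact good_of_bounds hM hy (fun j => by simp) (fun j => by simp) h9 h10
      (transpose_apply_of_mem a p p) h1 h2 h3 h4 h5 h6 h7 h8
  -- The coefficient of `1 / y` is `56 + 24 e ^ 4 + 8 e`, below `2100`. The exponential terms total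
  -- at most `14 M ^ 2`, the lower bound on `D_k⁻¹` counting twice.
  · have he1 : Real.exp 1 ≤ 3 := Real.exp_one_lt_d9.le.trans (by norm_num)
    have he4 : Real.exp 4 ≤ 81 := by
      rw [show (4 : ℝ) = ((4 : ℕ) : ℝ) * 1 by norm_num, Real.exp_nat_mul]
      exact (pow_le_pow_left₀ (Real.exp_pos 1).le he1 4).trans (by norm_num)
    have hyi : 0 ≤ y⁻¹ := by positivity
    have h1 : Real.exp 4 * y⁻¹ ≤ 81 * y⁻¹ := mul_le_mul_of_nonneg_right he4 hyi
    have h2 : Real.exp 1 * y⁻¹ ≤ 3 * y⁻¹ := mul_le_mul_of_nonneg_right he1 hyi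
    have h3 : Real.exp (1 - y / 2) ≤ (M : ℝ) ^ 2 * Real.exp (1 - y / 2) :=
      le_mul_of_one_le_left (Real.exp_pos _).le (one_le_pow₀ hM1)
    linarith

end Union

/-! ### From powers of the scale to powers of `M` -/

section Scale

variable {M : ℕ}

theorem frob_eq_sqrt (X : Matrix (Fin M) (Fin M) ℝ) : frob X = √(frobSq X) := by
  rw [frob, frobSq_eq_trace, Matrix.conjTranspose_eq_transpose_of_trivial]

/-- The auxiliary scale may be a small power of the block size. -/
theorem eventually_scale {ε δ : ℝ} (hδ : 0 < δ) : ∀ᶠ x : ℝ in Filter.atTop,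
    8 ≤ x ∧ 28 ≤ x ^ δ ∧ ε⁻¹ ≤ x ^ δ ∧
      2100 * (x ^ δ)⁻¹ + 14 * x ^ 2 * Real.exp (1 - x ^ δ / 2) ≤ x ^ (-(δ / 2)) := by
  have hlim := tendsto_rpow_atTop hδ
  -- The failure bound divided by `u ^ (-1 / 2)`, with `u = x ^ δ`. Half of the decay in `1 / u` is
  -- given up to absorb the constants.
  have h1 : Filter.Tendsto (fun u : ℝ => 2100 * u ^ (-(1 / 2) : ℝ) +
      14 * Real.exp 1 * (u ^ (2 / δ + 1 / 2) * Real.exp (-(1 / 2) * u))) Filter.atTop (nhds 0) := by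
    have h2 := (tendsto_rpow_neg_atTop (y := 1 / 2) (by norm_num)).const_mul 2100
    have h3 := (tendsto_rpow_mul_exp_neg_mul_atTop_nhds_zero (2 / δ + 1 / 2) (1 / 2)
      (by norm_num)).const_mul (14 * Real.exp 1)
    simpa using h2.add h3
  have h4 := hlim.eventually (h1.eventually_le_const zero_lt_one)
  filter_upwards [Filter.eventually_ge_atTop 8, hlim.eventually_ge_atTop 28,
    hlim.eventually_ge_atTop ε⁻¹, h4] with x hx hx1 hx2 hx3
  refine ⟨hx, hx1, hx2, ?_⟩
  have hx0 : 0 < x := by linarith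
  set u := x ^ δ
  have hu : 0 < u := Real.rpow_pos_of_pos hx0 δ
  have e1 : x ^ (-(δ / 2)) = u ^ (-(1 / 2) : ℝ) := by
    rw [← Real.rpow_mul hx0.le]; congr 1; ring
  have e2 : x ^ 2 = u ^ (2 / δ) := by
    rw [← Real.rpow_mul hx0.le, mul_div_cancel₀ _ hδ.ne', Real.rpow_two]
  have e3 : u⁻¹ = u ^ (-(1 / 2) : ℝ) * u ^ (-(1 / 2) : ℝ) := by
    rw [← Real.rpow_add hu, ← Real.rpow_neg_one]; norm_num
  have e4 : u ^ (2 / δ) = u ^ (-(1 / 2) : ℝ) * u ^ (2 / δ + 1 / 2) := by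
    rw [← Real.rpow_add hu]; congr 1; ring
  have e5 : Real.exp (1 - u / 2) = Real.exp 1 * Real.exp (-(1 / 2) * u) := by
    rw [← Real.exp_add]; congr 1; ring
  rw [e1, e2, e3, e4, e5]
  have := mul_le_mul_of_nonneg_left hx3 (Real.rpow_pos_of_pos hu (-(1 / 2))).le
  rw [mul_one] at this
  refine le_trans (le_of_eq ?_) this
  ring

variable {ε y lam : ℝ} {G Q : Matrix (Fin M) (Fin M) ℝ}

theorem rpow_half_sub_le_frob (hM : 0 < M) (hy : y ^ 8 ≤ (M : ℝ) ^ ε)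
    (h : (M : ℝ) ≤ y ^ 16 * frobSq G) : (M : ℝ) ^ (1 / 2 - ε) ≤ frob G := by
  have hM' : (0 : ℝ) < M := Nat.cast_pos.mpr hM
  rw [frob_eq_sqrt, Real.rpow_sub hM', ← Real.sqrt_eq_rpow,
    div_le_iff₀ (Real.rpow_pos_of_pos hM' ε), mul_comm]
  have h1 := Real.sqrt_le_sqrt h
  rw [Real.sqrt_mul (by positivity), show y ^ 16 = (y ^ 8) ^ 2 by ring,
    Real.sqrt_sq (by positivity)] at h1
  exact h1.trans (mul_le_mul_of_nonneg_right hy (Real.sqrt_nonneg _))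

theorem frob_le_mul_rpow {R : ℝ} (hR : 0 ≤ R) (hy : y ^ 8 ≤ (M : ℝ) ^ ε)
    (h : frobSq G ≤ y ^ 16 * R ^ 2) : frob G ≤ R * (M : ℝ) ^ ε := by
  rw [frob_eq_sqrt]
  refine Real.sqrt_le_iff.mpr ⟨mul_nonneg hR ((by positivity : 0 ≤ y ^ 8).trans hy), h.trans ?_⟩
  rw [mul_pow, mul_comm, show y ^ 16 = (y ^ 8) ^ 2 by ring]
  exact mul_le_mul_of_nonneg_left (pow_le_pow_left₀ (by positivity) hy 2) (sq_nonneg R)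

theorem Good.bounds (h : Good y G Q) (hM : 0 < M) (hy2 : 2 ≤ y) (hy : y ^ 8 ≤ (M : ℝ) ^ ε)
    (hlam : |lam| ≤ y) :
    ((M : ℝ) ^ (1 / 2 - ε) ≤ frob G ∧ frob G ≤ (M : ℝ) ^ (1 / 2 + ε)) ∧
    ((M : ℝ) ^ (1 / 2 - ε) ≤ frob Q ∧ frob Q ≤ (M : ℝ) ^ (1 + ε)) ∧
    |(G * (lam • 1 + Q)).trace| ≤ (M : ℝ) ^ (1 / 2 + ε) ∧
    |(G * Q).trace| ≤ (M : ℝ) ^ (1 / 2 + ε) := by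
  have hM' : (0 : ℝ) < M := Nat.cast_pos.mpr hM
  have hy0 : 0 ≤ y := by linarith
  have hy1 : 1 ≤ y := by linarith
  have hs : (M : ℝ) ^ (1 / 2 + ε) = √M * (M : ℝ) ^ ε := by
    rw [Real.rpow_add hM', Real.sqrt_eq_rpow]
  have hs2 : √(M : ℝ) ^ 2 = M := Real.sq_sqrt hM'.le
  have hs0 := Real.sqrt_nonneg (M : ℝ)
  have htr : |(G * Q).trace| ≤ y ^ 5 * √M := by
    refine abs_le_of_sq_le_sq (h.trace_sq.trans (le_of_eq ?_)) (by positivity)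
    rw [mul_pow, hs2]; ring
  have htd : |G.trace| ≤ y * √M := by
    refine abs_le_of_sq_le_sq (h.trace_diag_sq.trans (le_of_eq ?_)) (by positivity)
    rw [mul_pow, hs2]
  have h58 : y ^ 5 * √M ≤ y ^ 8 * √M :=
    mul_le_mul_of_nonneg_right (pow_le_pow_right₀ hy1 (by norm_num)) hs0
  have hfin : y ^ 8 * √M ≤ (M : ℝ) ^ (1 / 2 + ε) := by
    rw [hs, mul_comm]; exact mul_le_mul_of_nonneg_left hy hs0
  refine ⟨⟨rpow_half_sub_le_frob hM hy h.diag_lower, ?_⟩,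
    ⟨rpow_half_sub_le_frob hM hy h.conj_lower, ?_⟩, ?_, htr.trans (h58.trans hfin)⟩
  · rw [hs]
    exact frob_le_mul_rpow hs0 hy (by rw [hs2]; exact h.diag_upper)
  · rw [Real.rpow_add hM', Real.rpow_one]
    exact frob_le_mul_rpow hM'.le hy h.conj_upper
  · refine le_trans ?_ hfin
    rw [Matrix.mul_add, Matrix.trace_add, Matrix.mul_smul, Matrix.mul_one, Matrix.trace_smul,
      smul_eq_mul]
    refine (abs_add_le _ _).trans ?_
    rw [abs_mul]
    have h1 : |lam| * |G.trace| ≤ y * (y * √M) := mul_le_mul hlam htd (abs_nonneg _) hy0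
    -- The two terms come from `lam * tr G` and from `tr (G Q)`.
    have h2 : y ^ 2 + y ^ 5 ≤ y ^ 8 := by
      have h3 : y ^ 2 ≤ y ^ 5 := pow_le_pow_right₀ hy1 (by norm_num)
      have h4 : 2 * y ^ 5 ≤ y * y ^ 5 := mul_le_mul_of_nonneg_right hy2 (by positivity)
      have h5 : y ^ 6 ≤ y ^ 8 := pow_le_pow_right₀ hy1 (by norm_num)
      nlinarith
    have h6 := mul_le_mul_of_nonneg_right h2 hs0
    linarith

end Scale

end BlockBand

/-! ### The main theorem -/

theorem lemma2p2 (ε : ℝ) (hε : 0 < ε) :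
    ∃ C c : ℝ, 1 < C ∧ 0 < c ∧ c < 1 ∧
      ∀ (lam : ℝ), |lam| < ε⁻¹ →
      ∀ (N M : ℕ), C ≤ (M : ℝ) →
      ∀ (k : ℕ) (hk : k + 1 < N)
        {Ω : Type*} [MeasurableSpace Ω] (P : Measure Ω) [IsProbabilityMeasure P]
        (A : Ω → BlockBand.tridiagonal N M), HasLaw A (BlockBand.law N M) P →
        (∀ᵐ ω ∂P, ∀ (j : ℕ) (hj : j < N),
          IsUnit (BlockBand.D lam (A ω : BlockBand.BlockMatrix N M) j hj)) ∧
        1 - (M : ℝ) ^ (-c) ≤ P.real {ω |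
          let a : BlockBand.BlockMatrix N M := A ω
          let G : Matrix (Fin M) (Fin M) ℝ := a ⟨k + 1, hk⟩ ⟨k + 1, hk⟩
          let Q : Matrix (Fin M) (Fin M) ℝ := BlockBand.Q lam a k hk
          ((M : ℝ) ^ (1 / 2 - ε) ≤ BlockBand.frob G ∧
            BlockBand.frob G ≤ (M : ℝ) ^ (1 / 2 + ε)) ∧
          ((M : ℝ) ^ (1 / 2 - ε) ≤ BlockBand.frob Q ∧
            BlockBand.frob Q ≤ (M : ℝ) ^ (1 + ε)) ∧
          |(G * (lam • 1 + Q)).trace| ≤ (M : ℝ) ^ (1 / 2 + ε) ∧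
          |(G * Q).trace| ≤ (M : ℝ) ^ (1 / 2 + ε)} := by
  -- The squared norms lose `y ^ 16`, hence the norms `y ^ 8 ≤ M ^ ε`. The minimum with `1` keeps `c
  -- = δ / 2` below `1`.
  set δ := min ε 1 / 8
  have hδ : 0 < δ := div_pos (lt_min hε one_pos) (by norm_num)
  have hδ1 : 8 * δ ≤ 1 := by
    have := min_le_right ε 1
    simp only [δ]; linarith
  have hδε : 8 * δ ≤ ε := by
    have := min_le_left ε 1
    simp only [δ]; linarith
  obtain ⟨C, hC⟩ := Filter.eventually_atTop.mp (BlockBand.eventually_scale (ε := ε) hδ)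
  refine ⟨max C 2, δ / 2, lt_max_of_lt_right one_lt_two, by positivity, by linarith, ?_⟩
  intro lam hlam N M hCM k hk Ω _ P _ A hA
  obtain ⟨hM8, hy, hεy, hbound⟩ := hC M ((le_max_left _ _).trans hCM)
  have hM : 8 ≤ M := by exact_mod_cast hM8
  have hM' : (1 : ℝ) ≤ M := by linarith
  set y : ℝ := (M : ℝ) ^ δ
  have hy8 : y ^ 8 ≤ (M : ℝ) ^ ε := by
    rw [← Real.rpow_natCast, ← Real.rpow_mul (by linarith)]
    exact Real.rpow_le_rpow_of_exponent_le hM' (by push_cast; linarith)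
  have hlamy : |lam| ≤ y := hlam.le.trans hεy
  -- Total mass one is inherited from `P`, so integrability of the density need not be checked.
  have : IsProbabilityMeasure (BlockBand.law N M) := by
    rw [← hA.map_eq]
    exact Measure.isProbabilityMeasure_map hA.aemeasurable
  constructor
  · refine ae_all_iff.mpr fun j => ae_all_iff.mpr fun hj => ?_
    refine ae_of_ae_map hA.aemeasurable
      (p := fun a : BlockBand.tridiagonal N M => IsUnit (BlockBand.D lam a.1 j hj)) ?_
    rw [hA.map_eq, ae_iff]
    exact BlockBand.law_not_isUnit_D lam j hj
  · set S : Set (BlockBand.tridiagonal N M) :=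
      {a | ¬ BlockBand.Good y (a.1 ⟨k + 1, hk⟩ ⟨k + 1, hk⟩) (BlockBand.Q lam a.1 k hk)}
    have hS : P.real (A ⁻¹' S) ≤ (M : ℝ) ^ (-(δ / 2)) := by
      -- This inequality holds for arbitrary sets, so measurability of the bad event is not
      -- required.
      have h := (Measure.le_map_apply hA.aemeasurable S).trans
        (hA.map_eq ▸ (BlockBand.law_not_good_le hM hy hlamy k hk).trans
          (ENNReal.ofReal_le_ofReal hbound))
      exact ENNReal.toReal_le_of_le_ofReal (by positivity) h
    -- Subadditivity replaces the formula for the measure of a complement, which would need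
    -- measurability.
    have hcover : P.real (A ⁻¹' Sᶜ ∪ A ⁻¹' S) = 1 := by
      rw [← Set.preimage_union, Set.compl_union_self, Set.preimage_univ, probReal_univ]
    have hle := measureReal_union_le (μ := P) (A ⁻¹' Sᶜ) (A ⁻¹' S)
    have hsub := measureReal_mono (μ := P) (fun ω (hω : ω ∈ A ⁻¹' Sᶜ) =>
      (not_not.mp hω).bounds (lam := lam) (by omega) (by linarith) hy8 hlamy)
    refine le_trans ?_ hsub
    linarith
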